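/- **Setting.** Fix $T>0$. Let $h:[0,\infty)\to[0,\infty)$ be differentiable, with $h$ and $h'$ locally integrable and locally bounded. Let $\phi:[0,\infty)\to(0,\infty)$ be $\alpha$-Lipschitz for some $0<\alpha<\infty$ with $\alpha\int_0^T|h(t)|\,dt<1$, and let $\inf_{x\ge 0}\phi(x)>0$. Let $M_1(\mathbb N)$ be the set of probability measures on $\mathbb N=\{0,1,2,\dots\}$ with finite first moment, with the $L^1$-Wasserstein metric $W_1$. Let $M[0,T]$ be the set of càdlàg paths $\mu=(\mu_t)_{t\in[0,T]}$ in $(M_1(\mathbb N),W_1)$ such that $\mu_0=\delta_0$ and $t\mapsto\mu_t([0,x])$ is non-increasing for every $x\in\mathbb N$. Convergence $\mu^{(n)}\to\mu$ in $M[0,T]$ means $\sup_{t\in[0,T]}W_1(\mu^{(n)}_t,\mu_t)\to0$. Write $\langle\mu_t,g\rangle=\sum_{x\in\mathbb N}g(x)\mu_t(\{x\})$; let $\bar\mu_t=\sum_x x\,\mu_t(\{x\})$, which is non-decreasing in $t$, and $\lambda_\mu(t)=\phi\big(\int_0^t h(t-u)\,d\bar\mu_u\big)$. For $\psi:[0,T]\times\mathbb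 N\to\mathbb R$ put $D\psi(t,x)=\psi(t,x+1)-\psi(t,x)$. **Perturbed mean field.** For a bounded measurable $\varphi:[0,T]\times\mathbb N\to\mathbb R$, let $\mu^\varphi$ denote the unique $\mu\in M[0,T]$ such that, for all $t\in[0,T]$, $$\langle\mu_t,\psi(t)\rangle=\psi(0,0)+\int_0^t\langle\mu_s,\partial_s\psi(s)\rangle\,ds+\int_0^t\big\langle\mu_s,e^{\varphi(s)}D\psi(s)\big\rangle\,\lambda_\mu(s)\,ds$$ for every $\psi$ that is continuously differentiable in time, with $\sup_{t,x}|D\psi(t,x)|<\infty$ and $\int_0^T\langle\mu_t,|\partial_t\psi(t)|\rangle\,dt<\infty$. **Rate function.** For $\mu\in M[0,T]$ let $$I(\mu)=\sup_\psi\Big\{\langle\mu_T,\psi(T)\rangle-\psi(0,0)-\int_0^T\langle\mu_t,\partial_t\psi(t)\rangle\,dt-\int_0^T\big\langle\mu_t,e^{D\psi(t)}-1\big\rangle\,\lambda_\mu(t)\,dt\Big\}\in[0,\infty],$$ where the supremum is over all bounded $\psi:[0,T]\times\mathbb N\to\mathbb R$ that are continuously differentiable in time, with $\int_0^T\langle\mu_t,|\partial_t\psi(t)|\rangle\,dt<\infty$.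 **Theorem.** Let $\mu\in M[0,T]$ with $I(\mu)<\infty$. Then there is a sequence of bounded measurable functions $\varphi^{(n)}:[0,T]\times\mathbb N\to\mathbb R$ (each bounded, with no uniform bound in $n$ required) for which the perturbed mean fields $\mu^{(n)}:=\mu^{\varphi^{(n)}}\in M[0,T]$ exist, are unique, and satisfy $$\mu^{(n)}\to\mu\ \text{ in } M[0,T]\qquad\text{and}\qquad \lim_{n\to\infty}I(\mu^{(n)})=I(\mu).$$ -/

import Mathlib

open MeasureTheory Set Filter Topology
open scoped ENNReal NNReal

noncomputable section

namespace MeanFieldHawkes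

/-- The standing assumptions on the exciting function `h : [0,∞) → [0,∞)` and on the rate function
`ϕ : [0,∞) → (0,∞)`.  Both are represented by functions on `ℝ`, of which only the restriction to
`[0,∞)` is ever used. -/
structure Assumptions (T : ℝ) (α : ℝ≥0) (h ϕ : ℝ → ℝ) : Prop where
  h_nonneg : ∀ t, 0 ≤ t → 0 ≤ h t
  h_locallyIntegrable : LocallyIntegrableOn h (Ici 0)
  h_locallyBounded : ∀ R : ℝ, ∃ C : ℝ, ∀ t ∈ Icc 0 R, |h t| ≤ C
  h_differentiable : DifferentiableOn ℝ h (Ici 0)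
  deriv_locallyIntegrable : LocallyIntegrableOn (fun t => |derivWithin h (Ici 0) t|) (Ici 0)
  deriv_locallyBounded : ∀ R : ℝ, ∃ C : ℝ, ∀ t ∈ Icc 0 R, |derivWithin h (Ici 0) t| ≤ C
  ϕ_pos : ∀ x, 0 ≤ x → 0 < ϕ x
  α_pos : 0 < α
  ϕ_lipschitz : LipschitzOnWith α ϕ (Ici 0)
  subcritical : (α : ℝ) * ∫ t in (0 : ℝ)..T, |h t| < 1
  ϕ_bddBelow : ∃ c : ℝ, 0 < c ∧ ∀ x, 0 ≤ x → c ≤ ϕ x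

/-- The law `ν` on `ℕ` has a finite first moment, i.e. it belongs to `M₁(ℕ)`. -/
def FiniteMean (ν : ProbabilityMeasure ℕ) : Prop :=
  Integrable (fun x : ℕ => (x : ℝ)) (ν : Measure ℕ)

/-- The first moment. -/
def mean (ν : ProbabilityMeasure ℕ) : ℝ :=
  ∫ x : ℕ, (x : ℝ) ∂(ν : Measure ℕ)

/-- The `L¹`-Wasserstein distance on `ℕ`: the infimum of `∫ |x - y| dπ(x, y)` over all couplings
`π` of `ν` and `μ`. -/
def W1 (ν μ : ProbabilityMeasure ℕ) : ℝ≥0∞ :=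
  ⨅ π ∈ {π : Measure (ℕ × ℕ) | π.map Prod.fst = ν ∧ π.map Prod.snd = μ},
    ∫⁻ p, ENNReal.ofReal |(p.1 : ℝ) - (p.2 : ℝ)| ∂π

/-- The path space `M[0,T]`: càdlàg paths `[0,T] → (M₁(ℕ), W₁)` started at `δ₀` whose distribution
functions are decreasing in time.  A path is represented by a function on `ℝ`; only its values at
times in `[0,T]` matter. -/
structure MFPath (T : ℝ) where
  law : ℝ → ProbabilityMeasure ℕ
  finiteMean : ∀ t ∈ Icc 0 T, FiniteMean (law t)
  rightCts : ∀ t ∈ Ico 0 T, Tendsto (fun s => W1 (law s) (law t)) (𝓝[>] t) (𝓝 0)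
  leftLim : ∀ t ∈ Ioc 0 T, ∃ ν : ProbabilityMeasure ℕ, FiniteMean ν ∧
    Tendsto (fun s => W1 (law s) ν) (𝓝[<] t) (𝓝 0)
  init : (law 0 : Measure ℕ) {0} = 1
  antitone_cdf : ∀ x : ℕ, AntitoneOn (fun t => (law t : Measure ℕ) (Iic x)) (Icc 0 T)

/-- The topology of `M[0,T]` is that of uniform convergence in the Wasserstein distance. -/
def ConvergesTo {T : ℝ} (μs : ℕ → MFPath T) (μ : MFPath T) : Prop :=
  Tendsto (fun n => ⨆ t ∈ Icc 0 T, W1 ((μs n).law t) (μ.law t)) atTop (𝓝 0)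

theorem mean_le_mean {ν μ : ProbabilityMeasure ℕ} (hν : FiniteMean ν) (hμ : FiniteMean μ)
    (hle : ∀ x : ℕ, (μ : Measure ℕ) (Iic x) ≤ (ν : Measure ℕ) (Iic x)) : mean ν ≤ mean μ := by
  have key : ∀ t : ℝ, 0 < t →
      (ν : Measure ℕ) {a : ℕ | t < (a : ℝ)} ≤ (μ : Measure ℕ) {a : ℕ | t < (a : ℝ)} := by
    intro t ht
    have hs : {a : ℕ | t < (a : ℝ)} = (Iic ⌊t⌋₊)ᶜ := by
      ext a
      simp [Nat.floor_lt ht.le]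
    rw [hs, prob_compl_eq_one_sub (MeasurableSet.of_discrete),
      prob_compl_eq_one_sub (MeasurableSet.of_discrete)]
    exact tsub_le_tsub_left (hle _) 1
  have nn : ∀ ρ : Measure ℕ, 0 ≤ᵐ[ρ] (fun x : ℕ => (x : ℝ)) := fun ρ =>
    Eventually.of_forall fun x => Nat.cast_nonneg x
  have h1 : ENNReal.ofReal (mean ν) ≤ ENNReal.ofReal (mean μ) := by
    unfold mean
    rw [ofReal_integral_eq_lintegral_ofReal hν (nn _), ofReal_integral_eq_lintegral_ofReal hμ (nn _),
      lintegral_eq_lintegral_meas_lt _ (nn _) hν.aemeasurable,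
      lintegral_eq_lintegral_meas_lt _ (nn _) hμ.aemeasurable]
    exact setLIntegral_mono' measurableSet_Ioi fun t ht => key t ht
  exact (ENNReal.ofReal_le_ofReal_iff (integral_nonneg fun x => Nat.cast_nonneg x)).1 h1

namespace MFPath

variable {T : ℝ} (μ : MFPath T)

/-- The mean `μ̄_t`, extended from `[0,T]` to `ℝ` by constants. -/
def meanFun (t : ℝ) : ℝ := mean (μ.law (max 0 (min t T)))

theorem monotone_meanFun : Monotone μ.meanFun := by
  intro s t hst
  unfold meanFun
  rcases lt_or_ge T 0 with hT | hT
  · rw [max_eq_left ((min_le_right s T).trans hT.le), max_eq_left ((min_le_right t T).trans hT.le)]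
  · have mem : ∀ u : ℝ, max 0 (min u T) ∈ Icc 0 T := fun u =>
      ⟨le_max_left _ _, max_le hT (min_le_right _ _)⟩
    exact mean_le_mean (μ.finiteMean _ (mem s)) (μ.finiteMean _ (mem t)) fun x =>
      μ.antitone_cdf x (mem s) (mem t) (max_le_max le_rfl (min_le_min hst le_rfl))

/-- The Stieltjes measure `dμ̄_u`. -/
def dmean : Measure ℝ := μ.monotone_meanFun.stieltjesFunction.measure

/-- The mean-field intensity `ϕ(∫₀ᵗ h(t-u) dμ̄_u)`. -/
def intensity (h ϕ : ℝ → ℝ) (t : ℝ) : ℝ := ϕ (∫ u in Ioc 0 t, h (t - u) ∂μ.dmean)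

end MFPath

/-- The time derivative, on `[0,T]`, of a function of time and of the state. -/
def timeDeriv (T : ℝ) (ψ : ℝ → ℕ → ℝ) (t : ℝ) (x : ℕ) : ℝ :=
  derivWithin (fun s => ψ s x) (Icc 0 T) t

/-- The increment of `ψ` along the jump `x → x + 1`. -/
def jump (ψ : ℝ → ℕ → ℝ) (t : ℝ) (x : ℕ) : ℝ := ψ t (x + 1) - ψ t x

/-- Functions on `[0,T] × ℕ` that are continuously differentiable in time and bounded. -/
def C1b (T : ℝ) : Set (ℝ → ℕ → ℝ) :=
  {ψ | (∀ x, ContDiffOn ℝ 1 (fun t => ψ t x) (Icc 0 T)) ∧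
    ∃ C : ℝ, ∀ t ∈ Icc 0 T, ∀ x, |ψ t x| ≤ C}

/-- Functions on `[0,T] × ℕ` that are continuously differentiable in time and Lipschitz in the
state, uniformly in time. -/
def C1lip (T : ℝ) : Set (ℝ → ℕ → ℝ) :=
  {ψ | (∀ x, ContDiffOn ℝ 1 (fun t => ψ t x) (Icc 0 T)) ∧
    ∃ C : ℝ, ∀ t ∈ Icc 0 T, ∀ x, |jump ψ t x| ≤ C}

/-- `∫₀ᵀ ⟨μ_t, |∂_t ψ(t)|⟩ dt < ∞`, so that the integral of `⟨μ_t, ∂_t ψ(t)⟩` makes sense. -/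
def DerivIntegrable {T : ℝ} (μ : MFPath T) (ψ : ℝ → ℕ → ℝ) : Prop :=
  ∫⁻ t in Icc 0 T, ∫⁻ x, ‖timeDeriv T ψ t x‖ₑ ∂(μ.law t : Measure ℕ) < ⊤

/-- `μ` solves the mean-field equation perturbed by `φ`. -/
def SolvesPerturbed {T : ℝ} (h ϕ : ℝ → ℝ) (φ : ℝ → ℕ → ℝ) (μ : MFPath T) : Prop :=
  ∀ ψ ∈ C1lip T, DerivIntegrable μ ψ → ∀ t ∈ Icc 0 T,
    ∫ x, ψ t x ∂(μ.law t : Measure ℕ) =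
      ψ 0 0 + (∫ s in (0 : ℝ)..t, ∫ x, timeDeriv T ψ s x ∂(μ.law s : Measure ℕ)) +
        ∫ s in (0 : ℝ)..t,
          (∫ x, jump ψ s x * Real.exp (φ s x) ∂(μ.law s : Measure ℕ)) * μ.intensity h ϕ s

/-- `μ = μ^φ`: `μ` is the unique solution in `M[0,T]` of the mean-field equation perturbed
by `φ`. -/
def IsPerturbedMeanField {T : ℝ} (h ϕ : ℝ → ℝ) (φ : ℝ → ℕ → ℝ) (μ : MFPath T) : Prop :=
  SolvesPerturbed h ϕ φ μ ∧ ∀ ν : MFPath T, SolvesPerturbed h ϕ φ ν → EqOn ν.law μ.law (Icc 0 T)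

/-- The functional `J_μ(ψ)` whose supremum is the rate function. -/
def J {T : ℝ} (h ϕ : ℝ → ℝ) (μ : MFPath T) (ψ : ℝ → ℕ → ℝ) : ℝ :=
  (∫ x, ψ T x ∂(μ.law T : Measure ℕ)) - ψ 0 0
    - (∫ t in (0 : ℝ)..T, ∫ x, timeDeriv T ψ t x ∂(μ.law t : Measure ℕ))
    - ∫ t in (0 : ℝ)..T,
        (∫ x, (Real.exp (jump ψ t x) - 1) ∂(μ.law t : Measure ℕ)) * μ.intensity h ϕ t

/-- The rate function `I(μ) ∈ [0,∞]`. -/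
def rateFunction {T : ℝ} (h ϕ : ℝ → ℝ) (μ : MFPath T) : EReal :=
  ⨆ ψ ∈ {ψ | ψ ∈ C1b T ∧ DerivIntegrable μ ψ}, (J h ϕ μ ψ : EReal)

end MeanFieldHawkes

end

open MeanFieldHawkes

/-!
A path `μ` of `M[0,T]` only moves mass upwards, one state at a time, so it is encoded by its tails
`μ_t((x,∞))`, which are non-decreasing in time. Their Stieltjes measures `γ_x` are the fluxes of
mass from `x` to `x + 1`. Integration by parts along the path (`tendsto_sum_integral_flux`) turns
the functional `J_μ(ψ)` into

`∑ₓ (∫ f dγ_x - ∫ (e^f - 1) μ_t({x}) λ_μ(t) dt)`, with `f = Dψ`,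

which depends on `ψ` only through its jumps (`tendsto_cost`). By density of polynomials in `L¹`, the
inequality `I(μ) ≤ R` bounds this expression by `R` for *every* bounded measurable `f` and every
finite set of states (`cost_le`). All estimates below use the rate function in this dual form, so
that no explicit entropy formula is needed.

Three consequences prepare the approximation. Testing with `f = a 1_{(s,t]}` shows that a path of
finite rate has a continuous mean (`exists_modulus`). The rate function is lower semicontinuous
(`eventually_lt_rateFunction`), so only an upper bound on the rate of the approximating paths is
needed. And a path with flux densities `g_x(t)` comparable with its masses is a perturbed mean
field: `φ = log (g_x(t) / (μ_t({x}) λ_μ(t)))` is bounded, and uniqueness is a Gronwall argument,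
because after an integration by parts the intensity `λ_μ` is a Lipschitz functional of the mean
(`exists_lam_bounds`, `tl_unique`, `exists_isPerturbedMeanField`).

The approximating path is the mixture, with weights `1 - ε` and `ε`, of two paths. The first is `μ`
stopped at a large state `N` and delayed by a random time uniform on `[η, 2η]`; the averaging over
the delay gives its flux a bounded density. The second is a Poisson path of rate one, whose positive
masses make flux and mass comparable. The delay, rather than a symmetric smoothing, keeps the path
at `0` until time `η`, so that nothing has to be compared at small times with the Poisson masses of
the other states, which degenerate there.

For a given `f` and a given intensity the cost is linear in the fluxes and the masses, so that the
rate of the mixture is controlled by the costs of its ingredients (`cost_path_le`). For a fixed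
delay `s`, a test function `f` for the delayed path becomes the test function
`f(t + s) + log (λ̂(t + s) / λ_μ(t))` for `μ`, where `λ̂` is the intensity of the approximating path;
the intensities are bounded below and uniformly close, which makes the error small (`shift_cost_le`).
Stopping at `N` costs at most the rate of the suppressed jumps, and the Poisson path contributes
`O(ε)`. Letting `ε`, `η` and `1/N` tend to zero gives paths converging to `μ` with
`limsup I(μ^{(n)}) ≤ I(μ)` (`exists_approximation`).
-/

noncomputable section

namespace MeanFieldHawkes

/-! ### Tails, quantile functions and the Wasserstein distance -/

/-- The tail `ν((x, ∞))`. -/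
def tail (ν : ProbabilityMeasure ℕ) (x : ℕ) : ℝ := (ν : Measure ℕ).real (Ioi x)

lemma tail_nonneg (ν : ProbabilityMeasure ℕ) (x : ℕ) : 0 ≤ tail ν x := measureReal_nonneg

lemma tail_le_one (ν : ProbabilityMeasure ℕ) (x : ℕ) : tail ν x ≤ 1 := measureReal_le_one

lemma ofReal_tail (ν : ProbabilityMeasure ℕ) (x : ℕ) :
    ENNReal.ofReal (tail ν x) = (ν : Measure ℕ) (Ioi x) := ofReal_measureReal

lemma tail_antitone (ν : ProbabilityMeasure ℕ) : Antitone (tail ν) := fun _ _ hxy =>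
  measureReal_mono (Ioi_subset_Ioi hxy)

lemma real_singleton_zero (ν : ProbabilityMeasure ℕ) :
    (ν : Measure ℕ).real {0} = 1 - tail ν 0 := by
  have h : ({0} : Set ℕ) = (Ioi 0)ᶜ := by ext; simp
  rw [h, probReal_compl_eq_one_sub measurableSet_Ioi, tail]

lemma real_singleton_succ (ν : ProbabilityMeasure ℕ) (x : ℕ) :
    (ν : Measure ℕ).real {x + 1} = tail ν x - tail ν (x + 1) := by
  have h : ({x + 1} : Set ℕ) = Ioi x \ Ioi (x + 1) := by ext; simp; omega
  rw [h, measureReal_sdiff (Ioi_subset_Ioi (Nat.le_succ x)) measurableSet_Ioi, tail, tail]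

lemma tail_eq_one_sub (ν : ProbabilityMeasure ℕ) (x : ℕ) :
    tail ν x = 1 - (ν : Measure ℕ).real (Iic x) := by
  rw [← probReal_compl_eq_one_sub measurableSet_Iic, compl_Iic, tail]

lemma tsum_indicator_Ioi (a : ℕ) :
    ∑' x : ℕ, (Ioi x).indicator (fun _ => (1 : ℝ≥0∞)) a = a := by
  rw [tsum_eq_sum (s := Finset.range a) (by intro x hx; simpa using hx)]
  rw [Finset.sum_congr rfl (g := fun _ => (1 : ℝ≥0∞)) (by intro x hx; simpa using hx)]
  simp

lemma tsum_measure_Ioi (ν : Measure ℕ) : ∑' x : ℕ, ν (Ioi x) = ∫⁻ a : ℕ, (a : ℝ≥0∞) ∂ν := by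
  simp_rw [← tsum_indicator_Ioi]
  rw [lintegral_tsum (fun _ => (Measurable.of_discrete).aemeasurable)]
  simp [lintegral_indicator]

lemma hasSum_tail {ν : ProbabilityMeasure ℕ} (hν : FiniteMean ν) :
    HasSum (tail ν) (mean ν) := by
  have h1 : ENNReal.ofReal (mean ν) = ∑' x, ENNReal.ofReal (tail ν x) := by
    unfold mean
    rw [ofReal_integral_eq_lintegral_ofReal hν
      (Eventually.of_forall fun x => Nat.cast_nonneg x)]
    simp_rw [ofReal_tail, tsum_measure_Ioi, ENNReal.ofReal_natCast]
  have h2 : 0 ≤ mean ν := integral_nonneg fun x => Nat.cast_nonneg x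
  have hs : Summable (tail ν) := by
    refine (ENNReal.summable_toReal (f := fun x => ENNReal.ofReal (tail ν x))
      (h1 ▸ ENNReal.ofReal_ne_top)).congr fun x => ?_
    rw [ENNReal.toReal_ofReal (tail_nonneg ν x)]
  rw [← ENNReal.ofReal_tsum_of_nonneg (tail_nonneg ν) hs,
    ENNReal.ofReal_eq_ofReal_iff h2 (tsum_nonneg (tail_nonneg ν))] at h1
  exact h1 ▸ hs.hasSum

lemma finiteMean_of_summable {ν : ProbabilityMeasure ℕ} (hs : Summable (tail ν)) :
    FiniteMean ν := by
  refine ⟨Measurable.of_discrete.aestronglyMeasurable, ?_⟩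
  rw [hasFiniteIntegral_iff_ofReal (Eventually.of_forall fun x => Nat.cast_nonneg x)]
  simp_rw [ENNReal.ofReal_natCast, ← tsum_measure_Ioi, ← ofReal_tail]
  rw [← ENNReal.ofReal_tsum_of_nonneg (tail_nonneg ν) hs]
  exact ENNReal.ofReal_lt_top

/-- Summation by parts for functions that are constant beyond `M`. -/
lemma integral_min_eq (ν : ProbabilityMeasure ℕ) (g : ℕ → ℝ) (M : ℕ) :
    ∫ x, g (min x M) ∂(ν : Measure ℕ)
      = g 0 + ∑ x ∈ Finset.range M, (g (x + 1) - g x) * tail ν x := by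
  have h : ∀ a : ℕ, g (min a M) = g 0 + ∑ x ∈ Finset.range M,
      (Ioi x).indicator (fun _ => g (x + 1) - g x) a := by
    intro a
    have : ∑ x ∈ Finset.range M, (Ioi x).indicator (fun _ => g (x + 1) - g x) a
        = ∑ x ∈ Finset.range (min a M), (g (x + 1) - g x) := by
      simp_rw [indicator_apply, ← Finset.sum_filter]
      congr 1
      ext x
      simp
      tauto
    rw [this, Finset.sum_range_sub]
    ring
  simp_rw [h]
  rw [integral_add (integrable_const _), integral_finsetSum]
  · simp [integral_indicator, tail, mul_comm]
  · intro i _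
    exact (integrable_const _).indicator measurableSet_Ioi
  · exact integrable_finsetSum _ fun i _ => (integrable_const _).indicator measurableSet_Ioi

/-- Integrals of functions with Lipschitz constant one differ by at most the Wasserstein
distance. -/
lemma lintegral_le_add_W1 (ν μ : ProbabilityMeasure ℕ) (F : ℕ → ℝ≥0∞)
    (hF : ∀ a b : ℕ, F a ≤ F b + ENNReal.ofReal |(a : ℝ) - b|) :
    ∫⁻ a, F a ∂(ν : Measure ℕ) ≤ ∫⁻ a, F a ∂(μ : Measure ℕ) + W1 ν μ := by
  refine tsub_le_iff_left.1 (le_iInf₂ fun π hπ => tsub_le_iff_left.2 ?_)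
  rw [← hπ.1, ← hπ.2, lintegral_map Measurable.of_discrete measurable_fst,
    lintegral_map Measurable.of_discrete measurable_snd, ← lintegral_add_left]
  · exact lintegral_mono fun p => hF _ _
  · exact Measurable.of_discrete

lemma W1_le_lintegral {ν μ : ProbabilityMeasure ℕ} (π : Measure (ℕ × ℕ))
    (h1 : π.map Prod.fst = ν) (h2 : π.map Prod.snd = μ) :
    W1 ν μ ≤ ∫⁻ p, ENNReal.ofReal |(p.1 : ℝ) - (p.2 : ℝ)| ∂π :=
  iInf₂_le π ⟨h1, h2⟩

lemma W1_comm_le (ν μ : ProbabilityMeasure ℕ) : W1 ν μ ≤ W1 μ ν := by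
  refine le_iInf₂ fun π hπ => ?_
  refine (W1_le_lintegral (π.map Prod.swap) ?_ ?_).trans ?_
  · rw [Measure.map_map measurable_fst measurable_swap]
    exact hπ.2
  · rw [Measure.map_map measurable_snd measurable_swap]
    exact hπ.1
  · rw [lintegral_map Measurable.of_discrete measurable_swap]
    exact lintegral_mono fun p => by simp [abs_sub_comm]

lemma W1_comm (ν μ : ProbabilityMeasure ℕ) : W1 ν μ = W1 μ ν :=
  le_antisymm (W1_comm_le ν μ) (W1_comm_le μ ν)

lemma ofReal_abs_tail_sub_le (ν μ : ProbabilityMeasure ℕ) (x : ℕ) :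
    ENNReal.ofReal |tail ν x - tail μ x| ≤ W1 ν μ := by
  have key : ∀ ν μ : ProbabilityMeasure ℕ,
      ENNReal.ofReal (tail ν x) ≤ ENNReal.ofReal (tail μ x) + W1 ν μ := by
    intro ν μ
    have := lintegral_le_add_W1 ν μ ((Ioi x).indicator 1) (by
      intro a b
      by_cases hb : x < b
      · refine le_add_right ?_
        simp only [indicator_apply, mem_Ioi, hb, if_true, Pi.one_apply]
        split_ifs <;> simp
      by_cases ha : x < a
      · refine le_add_left ?_
        simp only [indicator_apply, mem_Ioi, ha, if_true, Pi.one_apply]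
        rw [← ENNReal.ofReal_one]
        refine ENNReal.ofReal_le_ofReal ?_
        have : ((b : ℝ) + 1) ≤ a := by exact_mod_cast (by omega : b + 1 ≤ a)
        exact le_trans (by linarith) (le_abs_self _)
      · simp [ha])
    simpa [ofReal_tail, lintegral_indicator] using this
  rcases abs_cases (tail ν x - tail μ x) with h | h
  · rw [h.1, ENNReal.ofReal_sub _ (tail_nonneg _ _)]
    exact tsub_le_iff_left.2 (key ν μ)
  · rw [h.1, neg_sub, ENNReal.ofReal_sub _ (tail_nonneg _ _), W1_comm]
    exact tsub_le_iff_left.2 (key μ ν)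

lemma mean_nonneg (ν : ProbabilityMeasure ℕ) : 0 ≤ mean ν :=
  integral_nonneg fun x => Nat.cast_nonneg x

lemma ofReal_abs_mean_sub_le {ν μ : ProbabilityMeasure ℕ} (hν : FiniteMean ν)
    (hμ : FiniteMean μ) : ENNReal.ofReal |mean ν - mean μ| ≤ W1 ν μ := by
  have key : ∀ ν μ : ProbabilityMeasure ℕ, FiniteMean ν → FiniteMean μ →
      ENNReal.ofReal (mean ν) ≤ ENNReal.ofReal (mean μ) + W1 ν μ := by
    intro ν μ hν hμ
    have := lintegral_le_add_W1 ν μ (fun a => ENNReal.ofReal a) (by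
      intro a b
      rw [← ENNReal.ofReal_add (by positivity) (by positivity)]
      exact ENNReal.ofReal_le_ofReal (by linarith [le_abs_self ((a : ℝ) - b)]))
    unfold mean
    rwa [ofReal_integral_eq_lintegral_ofReal hν (Eventually.of_forall fun x => Nat.cast_nonneg x),
      ofReal_integral_eq_lintegral_ofReal hμ (Eventually.of_forall fun x => Nat.cast_nonneg x)]
  rcases abs_cases (mean ν - mean μ) with h | h
  · rw [h.1, ENNReal.ofReal_sub _ (mean_nonneg _)]
    exact tsub_le_iff_left.2 (key ν μ hν hμ)
  · rw [h.1, neg_sub, ENNReal.ofReal_sub _ (mean_nonneg _), W1_comm]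
    exact tsub_le_iff_left.2 (key μ ν hμ hν)

/-- The generalised inverse of a decreasing function `g` on `ℕ`; when `g` is the tail of a
probability measure this is a quantile function, read from the top. -/
def quant (g : ℕ → ℝ) (u : ℝ) : ℕ := sInf {x | g x ≤ u}

lemma lt_quant_iff {g : ℕ → ℝ} (hg : Antitone g) (h0 : Tendsto g atTop (𝓝 0)) {u : ℝ}
    (hu : 0 < u) (x : ℕ) : x < quant g u ↔ u < g x := by
  have hne : {x | g x ≤ u}.Nonempty := by
    obtain ⟨N, hN⟩ := ((h0.eventually_lt_const hu).exists)
    exact ⟨N, hN.le⟩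
  constructor
  · intro h
    by_contra hc
    exact absurd (Nat.sInf_le (not_lt.1 hc : x ∈ {x | g x ≤ u})) (not_le.2 h)
  · intro h
    by_contra hc
    have h1 : g (quant g u) ≤ u := Nat.sInf_mem hne
    exact absurd (h.trans_le (hg (not_lt.1 hc))) (not_lt.2 h1)

lemma aemeasurable_quant {g : ℕ → ℝ} (hg : Antitone g) (h0 : Tendsto g atTop (𝓝 0)) :
    AEMeasurable (quant g) (volume.restrict (Ioc (0 : ℝ) 1)) := by
  refine aemeasurable_restrict_of_antitoneOn measurableSet_Ioc ?_
  intro u hu v hv huv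
  by_contra hc
  rw [not_le, lt_quant_iff hg h0 hv.1] at hc
  have := (lt_quant_iff hg h0 hu.1 (quant g u)).2 (huv.trans_lt hc)
  exact lt_irrefl _ this

lemma map_quant_Ioi {g : ℕ → ℝ} (hg : Antitone g) (h0 : Tendsto g atTop (𝓝 0))
    (h1 : ∀ x, g x ≤ 1) (x : ℕ) :
    (volume.restrict (Ioc (0 : ℝ) 1)).map (quant g) (Ioi x) = ENNReal.ofReal (g x) := by
  have hs : quant g ⁻¹' Ioi x ∩ Ioc 0 1 = Ioo 0 (g x) := by
    ext u
    simp only [mem_inter_iff, mem_preimage, mem_Ioi, mem_Ioc, mem_Ioo]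
    constructor
    · rintro ⟨h, hu⟩
      exact ⟨hu.1, (lt_quant_iff hg h0 hu.1 x).1 h⟩
    · rintro ⟨hu, h⟩
      exact ⟨(lt_quant_iff hg h0 hu x).2 h, hu, h.le.trans (h1 x)⟩
  rw [Measure.map_apply_of_aemeasurable (aemeasurable_quant hg h0) measurableSet_Ioi,
    Measure.restrict_apply' measurableSet_Ioc, hs]
  simp

lemma tail_tendsto (ν : ProbabilityMeasure ℕ) : Tendsto (tail ν) atTop (𝓝 0) := by
  have h : Tendsto (fun x : ℕ => (ν : Measure ℕ) (Ioi x)) atTop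
      (𝓝 ((ν : Measure ℕ) (⋂ x : ℕ, Ioi x))) :=
    tendsto_measure_iInter_atTop (fun _ => measurableSet_Ioi.nullMeasurableSet)
      (fun _ _ h => Ioi_subset_Ioi h) ⟨0, measure_ne_top _ _⟩
  have he : (⋂ x : ℕ, Ioi x) = ∅ := by
    ext a
    simp only [mem_iInter, mem_Ioi, mem_empty_iff_false, iff_false]
    exact fun h => lt_irrefl _ (h a)
  rw [he, measure_empty] at h
  exact (ENNReal.tendsto_toReal ENNReal.zero_ne_top).comp h

lemma eq_of_tail {ν μ : Measure ℕ} [IsProbabilityMeasure ν] [IsProbabilityMeasure μ]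
    (h : ∀ x, ν (Ioi x) = μ (Ioi x)) : ν = μ := by
  refine Measure.ext_of_Iic _ _ fun x => ?_
  rw [← compl_Ioi, prob_compl_eq_one_sub measurableSet_Ioi,
    prob_compl_eq_one_sub measurableSet_Ioi, h]

instance : IsProbabilityMeasure (volume.restrict (Ioc (0 : ℝ) 1)) := ⟨by simp⟩

lemma map_quant_tail (ν : ProbabilityMeasure ℕ) :
    (volume.restrict (Ioc (0 : ℝ) 1)).map (quant (tail ν)) = ν := by
  have := Measure.isProbabilityMeasure_map (aemeasurable_quant (tail_antitone ν) (tail_tendsto ν))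
  refine eq_of_tail fun x => ?_
  rw [map_quant_Ioi (tail_antitone ν) (tail_tendsto ν) (tail_le_one ν), ofReal_tail]

/-- The bound comes from the quantile coupling, which is in fact optimal. -/
lemma W1_le_tsum (ν μ : ProbabilityMeasure ℕ) :
    W1 ν μ ≤ ∑' x, ENNReal.ofReal |tail ν x - tail μ x| := by
  set g := tail ν with hg
  set g' := tail μ with hg'
  have hq := aemeasurable_quant (tail_antitone ν) (tail_tendsto ν)
  have hq' := aemeasurable_quant (tail_antitone μ) (tail_tendsto μ)
  refine (W1_le_lintegral ((volume.restrict (Ioc (0 : ℝ) 1)).map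
    fun u => (quant g u, quant g' u)) ?_ ?_).trans ?_
  · rw [AEMeasurable.map_map_of_aemeasurable measurable_fst.aemeasurable (hq.prodMk hq')]
    exact map_quant_tail ν
  · rw [AEMeasurable.map_map_of_aemeasurable measurable_snd.aemeasurable (hq.prodMk hq')]
    exact map_quant_tail μ
  rw [lintegral_map' Measurable.of_discrete.aemeasurable (hq.prodMk hq')]
  calc ∫⁻ u in Ioc (0 : ℝ) 1, ENNReal.ofReal |(quant g u : ℝ) - quant g' u|
      ≤ ∫⁻ u in Ioc (0 : ℝ) 1, ∑' x, (Ico (min (g x) (g' x)) (max (g x) (g' x))).indicator 1 u := by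
        -- `|a - b|` counts the integers `x` with `min a b ≤ x < max a b`.
        refine setLIntegral_mono' measurableSet_Ioc fun u hu => ?_
        have e1 := lt_quant_iff (tail_antitone ν) (tail_tendsto ν) hu.1
        have e2 := lt_quant_iff (tail_antitone μ) (tail_tendsto μ) hu.1
        rw [← hg] at e1
        rw [← hg'] at e2
        set a := quant g u
        set b := quant g' u
        refine le_trans ?_ (ENNReal.sum_le_tsum (Finset.Ico (min a b) (max a b)))
        rw [Finset.sum_congr rfl (g := fun _ => (1 : ℝ≥0∞))]
        · simp only [Finset.sum_const, Nat.card_Ico, nsmul_eq_mul, mul_one]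
          rw [← ENNReal.ofReal_natCast]
          refine ENNReal.ofReal_le_ofReal ?_
          rw [Nat.cast_sub min_le_max, Nat.cast_max, Nat.cast_min, max_sub_min_eq_abs]
          rw [abs_sub_comm]
        · intro x hx
          rw [Finset.mem_Ico, min_le_iff, lt_max_iff] at hx
          refine indicator_of_mem ?_ _
          rw [mem_Ico, min_le_iff, lt_max_iff, ← e1, ← e2, ← not_lt, ← not_lt, ← e1, ← e2]
          omega
    _ = ∑' x, ∫⁻ u in Ioc (0 : ℝ) 1, (Ico (min (g x) (g' x)) (max (g x) (g' x))).indicator 1 u :=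
        lintegral_tsum fun x => (measurable_one.indicator measurableSet_Ico).aemeasurable
    _ ≤ ∑' x, ENNReal.ofReal |g x - g' x| := by
        refine ENNReal.tsum_le_tsum fun x => ?_
        refine (setLIntegral_le_lintegral _ _).trans ?_
        rw [lintegral_indicator measurableSet_Ico]
        simp [max_sub_min_eq_abs, abs_sub_comm]

/-- The probability measure on `ℕ` with tail `g`. -/
def ofTail (g : ℕ → ℝ) (hg : Antitone g) (h0 : Tendsto g atTop (𝓝 0)) : ProbabilityMeasure ℕ :=
  ⟨(volume.restrict (Ioc (0 : ℝ) 1)).map (quant g),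
    Measure.isProbabilityMeasure_map (aemeasurable_quant hg h0)⟩

lemma tail_ofTail {g : ℕ → ℝ} (hg : Antitone g) (h0 : Tendsto g atTop (𝓝 0))
    (h1 : ∀ x, g x ≤ 1) (x : ℕ) : tail (ofTail g hg h0) x = g x := by
  have h : ((ofTail g hg h0 : ProbabilityMeasure ℕ) : Measure ℕ) (Ioi x)
      = ENNReal.ofReal (g x) := map_quant_Ioi hg h0 h1 x
  rw [tail, measureReal_def, h, ENNReal.toReal_ofReal (hg.le_of_tendsto h0 x)]

/-! ### Integration by parts against a Stieltjes measure -/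

/-- Fubini's theorem applied to `1_{u ≤ s} g'(s)`.  Differentiability is only required in the
interior, since the exciting function has a one-sided derivative at the endpoint `0`. -/
lemma integral_stieltjes_by_parts (F : StieltjesFunction ℝ) {a b : ℝ} (hab : a ≤ b)
    {g g' : ℝ → ℝ} (hg : ContinuousOn g (Icc a b))
    (hd : ∀ t ∈ Ioo a b, HasDerivAt g (g' t) t) (hi : IntervalIntegrable g' volume a b) :
    ∫ u in Ioc a b, g u ∂F.measure = g b * F b - g a * F a - ∫ s in a..b, g' s * F s := by
  have : IsFiniteMeasure (F.measure.restrict (Ioc a b)) := ⟨by simp⟩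
  have hi' : IntegrableOn g' (Ioc a b) := (intervalIntegrable_iff_integrableOn_Ioc_of_le hab).1 hi
  have hftc : ∀ u ∈ Icc a b, ∫ s in u..b, g' s = g b - g u := by
    intro u hu
    refine intervalIntegral.integral_eq_sub_of_hasDerivAt_of_le hu.2
      (hg.mono (Icc_subset_Icc_left hu.1)) (fun t ht => hd t ⟨hu.1.trans_lt ht.1, ht.2⟩) ?_
    exact hi.mono_set (by rw [uIcc_of_le hu.2, uIcc_of_le hab]; exact Icc_subset_Icc_left hu.1)
  have hint : Integrable (Function.uncurry fun (u s : ℝ) => if u ≤ s then g' s else 0)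
      ((F.measure.restrict (Ioc a b)).prod (volume.restrict (Ioc a b))) := by
    have := (hi'.comp_snd (F.measure.restrict (Ioc a b))).indicator
      (measurableSet_le measurable_fst measurable_snd)
    refine this.congr (Eventually.of_forall fun p => ?_)
    simp [indicator_apply, Function.uncurry]
  have hsw := integral_integral_swap hint
  have hFi : IntervalIntegrable (fun s => g' s * F s) volume a b := by
    rw [intervalIntegrable_iff_integrableOn_Ioc_of_le hab]
    refine Integrable.mul_bdd (c := max |F a| |F b|) hi' F.mono.measurable.aestronglyMeasurable ?_
    filter_upwards [ae_restrict_mem measurableSet_Ioc] with s hs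
    exact abs_le_max_abs_abs (F.mono hs.1.le) (F.mono hs.2)
  have h1 : ∫ u in Ioc a b, ∫ s in Ioc a b, (if u ≤ s then g' s else 0) ∂volume ∂F.measure
      = ∫ u in Ioc a b, (g b - g u) ∂F.measure := by
    refine setIntegral_congr_fun measurableSet_Ioc fun u hu => ?_
    rw [← hftc u ⟨hu.1.le, hu.2⟩, intervalIntegral.integral_of_le hu.2,
      ← integral_Icc_eq_integral_Ioc (x := u)]
    have : ∀ s, (if u ≤ s then g' s else 0) = (Ici u).indicator g' s := fun s => by
      simp [indicator_apply]
    simp_rw [this]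
    rw [setIntegral_indicator measurableSet_Ici]
    congr 2
    ext s
    simp only [mem_inter_iff, mem_Ioc, mem_Ici, mem_Icc]
    exact ⟨fun h => ⟨h.2, h.1.2⟩, fun h => ⟨⟨hu.1.trans_le h.1, h.2⟩, h.1⟩⟩
  have h2 : ∫ s in Ioc a b, ∫ u in Ioc a b, (if u ≤ s then g' s else 0) ∂F.measure
      = ∫ s in Ioc a b, g' s * (F s - F a) := by
    refine setIntegral_congr_fun measurableSet_Ioc fun s hs => ?_
    have : ∀ u, (if u ≤ s then g' s else 0) = (Iic s).indicator (fun _ => g' s) u := fun u => by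
      simp [indicator_apply]
    simp_rw [this]
    rw [setIntegral_indicator measurableSet_Iic, setIntegral_const]
    have hset : Ioc a b ∩ Iic s = Ioc a s := by
      ext u
      simp only [mem_inter_iff, mem_Ioc, mem_Iic]
      exact ⟨fun h => ⟨h.1.1, h.2⟩, fun h => ⟨⟨h.1, h.2.trans hs.2⟩, h.2⟩⟩
    rw [hset, measureReal_def, F.measure_Ioc,
      ENNReal.toReal_ofReal (sub_nonneg.2 (F.mono hs.1.le)), smul_eq_mul, mul_comm]
  have hgint : Integrable g (F.measure.restrict (Ioc a b)) := by
    have : IntegrableOn g (Icc a b) F.measure := hg.integrableOn_compact isCompact_Icc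
    exact this.mono_set Ioc_subset_Icc_self
  rw [h1, h2, integral_sub (integrable_const _) hgint, setIntegral_const, measureReal_def,
    F.measure_Ioc, ENNReal.toReal_ofReal (sub_nonneg.2 (F.mono hab)), smul_eq_mul,
    ← intervalIntegral.integral_of_le (μ := volume) hab] at hsw
  have h3 : ∫ s in a..b, g' s * (F s - F a)
      = (∫ s in a..b, g' s * F s) - (g b - g a) * F a := by
    simp_rw [mul_sub]
    rw [intervalIntegral.integral_sub hFi (hi.mul_const _), intervalIntegral.integral_mul_const,
      hftc a ⟨le_rfl, hab⟩]
  rw [h3] at hsw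
  linarith

/-! ### Tails of a path and the measures they generate -/

namespace MFPath

variable {T : ℝ} (μ : MFPath T)

/-- The law at time `t`, extended from `[0,T]` to `ℝ` by constants. -/
def lawc (t : ℝ) : ProbabilityMeasure ℕ := μ.law (max 0 (min t T))

/-- The tail `μ_t((x,∞))`.  As paths only jump upwards, by one, this is the mass that has
crossed from `x` to `x + 1` by time `t`. -/
def tl (x : ℕ) (t : ℝ) : ℝ := tail (μ.lawc t) x

/-- The mass `μ_t({x})`. -/
def ms (x : ℕ) (t : ℝ) : ℝ := (μ.lawc t : Measure ℕ).real {x}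

lemma clamp_mem (hT : 0 < T) (t : ℝ) : max 0 (min t T) ∈ Icc 0 T :=
  ⟨le_max_left _ _, max_le hT.le (min_le_right _ _)⟩

lemma lawc_eq {t : ℝ} (ht : t ∈ Icc 0 T) : μ.lawc t = μ.law t := by
  rw [lawc, min_eq_left ht.2, max_eq_right ht.1]

lemma lawc_of_nonpos (hT : 0 < T) {t : ℝ} (ht : t ≤ 0) : μ.lawc t = μ.law 0 := by
  rw [lawc, min_eq_left (ht.trans hT.le), max_eq_left ht]

lemma lawc_of_ge {t : ℝ} (hT : 0 < T) (ht : T ≤ t) : μ.lawc t = μ.law T := by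
  rw [lawc, min_eq_right ht, max_eq_right hT.le]

lemma finiteMean_lawc (hT : 0 < T) (t : ℝ) : FiniteMean (μ.lawc t) :=
  μ.finiteMean _ (clamp_mem hT t)

lemma tl_mono (hT : 0 < T) (x : ℕ) : Monotone (μ.tl x) := by
  intro s t hst
  unfold tl
  rw [tail_eq_one_sub, tail_eq_one_sub]
  have h := μ.antitone_cdf x (clamp_mem hT s) (clamp_mem hT t)
    (max_le_max le_rfl (min_le_min hst le_rfl))
  have := (ENNReal.toReal_le_toReal (measure_ne_top _ _) (measure_ne_top _ _)).2 h
  simp only [lawc, measureReal_def]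
  linarith

lemma tl_nonneg (x : ℕ) (t : ℝ) : 0 ≤ μ.tl x t := tail_nonneg _ _

lemma tl_le_one (x : ℕ) (t : ℝ) : μ.tl x t ≤ 1 := tail_le_one _ _

lemma tl_antitone (t : ℝ) : Antitone fun x => μ.tl x t := tail_antitone _

lemma tl_of_nonpos (hT : 0 < T) (x : ℕ) {t : ℝ} (ht : t ≤ 0) : μ.tl x t = 0 := by
  have h0 : (μ.law 0 : Measure ℕ).real {0} = 1 := by rw [measureReal_def, μ.init]; simp
  rw [real_singleton_zero] at h0
  refine le_antisymm ?_ (μ.tl_nonneg x t)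
  refine (μ.tl_antitone t (Nat.zero_le x)).trans ?_
  change tail (μ.lawc t) 0 ≤ 0
  rw [μ.lawc_of_nonpos hT ht]
  linarith

lemma ms_nonneg (x : ℕ) (t : ℝ) : 0 ≤ μ.ms x t := measureReal_nonneg

lemma ms_le_one (x : ℕ) (t : ℝ) : μ.ms x t ≤ 1 := measureReal_le_one

lemma ms_zero (t : ℝ) : μ.ms 0 t = 1 - μ.tl 0 t := real_singleton_zero _

lemma ms_succ (x : ℕ) (t : ℝ) : μ.ms (x + 1) t = μ.tl x t - μ.tl (x + 1) t :=
  real_singleton_succ _ _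

lemma sum_ms (M : ℕ) (t : ℝ) : ∑ x ∈ Finset.range (M + 1), μ.ms x t = 1 - μ.tl M t := by
  induction M with
  | zero => simp [ms_zero]
  | succ n ih => rw [Finset.sum_range_succ, ih, ms_succ]; ring

lemma sum_ms_le_one (M : ℕ) (t : ℝ) : ∑ x ∈ Finset.range M, μ.ms x t ≤ 1 := by
  cases M with
  | zero => simp
  | succ n => rw [sum_ms]; linarith [μ.tl_nonneg n t]

lemma measurable_tl (hT : 0 < T) (x : ℕ) : Measurable (μ.tl x) := (μ.tl_mono hT x).measurable

lemma measurable_ms (hT : 0 < T) (x : ℕ) : Measurable (μ.ms x) := by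
  cases x with
  | zero =>
    rw [show μ.ms 0 = fun t => 1 - μ.tl 0 t from funext μ.ms_zero]
    exact measurable_const.sub (μ.measurable_tl hT 0)
  | succ n =>
    rw [show μ.ms (n + 1) = fun t => μ.tl n t - μ.tl (n + 1) t from funext (μ.ms_succ n)]
    exact (μ.measurable_tl hT n).sub (μ.measurable_tl hT (n + 1))

lemma hasSum_tl (hT : 0 < T) (t : ℝ) : HasSum (fun x => μ.tl x t) (μ.meanFun t) :=
  hasSum_tail (μ.finiteMean_lawc hT t)

lemma sum_tl_le (hT : 0 < T) (M : ℕ) (t : ℝ) :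
    ∑ x ∈ Finset.range M, μ.tl x t ≤ μ.meanFun t :=
  sum_le_hasSum _ (fun x _ => μ.tl_nonneg x t) (μ.hasSum_tl hT t)

lemma meanFun_nonneg (t : ℝ) : 0 ≤ μ.meanFun t := mean_nonneg _

lemma meanFun_of_nonpos (hT : 0 < T) {t : ℝ} (ht : t ≤ 0) : μ.meanFun t = 0 := by
  refine (μ.hasSum_tl hT t).unique ?_
  simp_rw [μ.tl_of_nonpos hT _ ht]
  exact hasSum_zero

lemma meanFun_le (hT : 0 < T) (t : ℝ) : μ.meanFun t ≤ μ.meanFun T := by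
  rcases le_total t T with h | h
  · exact μ.monotone_meanFun h
  · have h1 := μ.lawc_of_ge hT h
    have h2 := μ.lawc_of_ge hT le_rfl
    change mean (μ.lawc t) ≤ mean (μ.lawc T)
    rw [h1, h2]

lemma _root_.MeanFieldHawkes.W1_self (ν : ProbabilityMeasure ℕ) : W1 ν ν = 0 :=
  le_antisymm ((W1_le_tsum ν ν).trans (by simp)) bot_le

lemma tendsto_W1_lawc (hT : 0 < T) (t : ℝ) :
    Tendsto (fun s => W1 (μ.lawc s) (μ.lawc t)) (𝓝[>] t) (𝓝 0) := by
  rcases lt_or_ge t 0 with h | h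
  · refine tendsto_const_nhds.congr' ?_
    filter_upwards [Ioo_mem_nhdsGT h] with s hs
    rw [μ.lawc_of_nonpos hT h.le, μ.lawc_of_nonpos hT hs.2.le, W1_self]
  rcases lt_or_ge t T with h' | h'
  · refine (μ.rightCts t ⟨h, h'⟩).congr' ?_
    filter_upwards [Ioo_mem_nhdsGT h'] with s hs
    rw [μ.lawc_eq ⟨h, h'.le⟩, μ.lawc_eq ⟨h.trans hs.1.le, hs.2.le⟩]
  · refine tendsto_const_nhds.congr' ?_
    filter_upwards [self_mem_nhdsWithin] with s hs
    rw [μ.lawc_of_ge hT h', μ.lawc_of_ge hT (h'.trans (le_of_lt hs)), W1_self]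

lemma _root_.MeanFieldHawkes.tendsto_of_ofReal_abs_le {ι : Type*} {l : Filter ι} {f : ι → ℝ}
    {a : ℝ} {w : ι → ℝ≥0∞} (hw : Tendsto w l (𝓝 0))
    (h : ∀ᶠ i in l, ENNReal.ofReal |f i - a| ≤ w i) : Tendsto f l (𝓝 a) := by
  have h1 : Tendsto (fun i => ENNReal.ofReal |f i - a|) l (𝓝 0) :=
    tendsto_of_tendsto_of_tendsto_of_le_of_le' tendsto_const_nhds hw
      (Eventually.of_forall fun _ => bot_le) h
  have h2 := (ENNReal.tendsto_toReal ENNReal.zero_ne_top).comp h1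
  rw [tendsto_iff_norm_sub_tendsto_zero]
  refine h2.congr fun i => ?_
  simp [ENNReal.toReal_ofReal, Real.norm_eq_abs]

lemma tl_rightCts (hT : 0 < T) (x : ℕ) (t : ℝ) : ContinuousWithinAt (μ.tl x) (Ici t) t := by
  rw [← continuousWithinAt_Ioi_iff_Ici]
  exact tendsto_of_ofReal_abs_le (μ.tendsto_W1_lawc hT t)
    (Eventually.of_forall fun s => ofReal_abs_tail_sub_le _ _ x)

lemma meanFun_rightCts (hT : 0 < T) (t : ℝ) : ContinuousWithinAt μ.meanFun (Ici t) t := by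
  rw [← continuousWithinAt_Ioi_iff_Ici]
  exact tendsto_of_ofReal_abs_le (μ.tendsto_W1_lawc hT t)
    (Eventually.of_forall fun s =>
      ofReal_abs_mean_sub_le (μ.finiteMean_lawc hT s) (μ.finiteMean_lawc hT t))

/-- The tail `t ↦ μ_t((x,∞))` as a Stieltjes function. -/
def stl (hT : 0 < T) (x : ℕ) : StieltjesFunction ℝ where
  toFun := μ.tl x
  mono' := μ.tl_mono hT x
  right_continuous' := μ.tl_rightCts hT x

@[simp] lemma stl_apply (hT : 0 < T) (x : ℕ) (t : ℝ) : μ.stl hT x t = μ.tl x t := rfl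

/-- The flux measure: `γ_x((s,t])` is the mass crossing from `x` to `x + 1` during `(s,t]`. -/
def flux (hT : 0 < T) (x : ℕ) : Measure ℝ := (μ.stl hT x).measure

lemma flux_Ioc (hT : 0 < T) (x : ℕ) (a b : ℝ) :
    μ.flux hT x (Ioc a b) = ENNReal.ofReal (μ.tl x b - μ.tl x a) :=
  (μ.stl hT x).measure_Ioc a b

lemma flux_real_Ioc (hT : 0 < T) (x : ℕ) {a b : ℝ} (hab : a ≤ b) :
    (μ.flux hT x).real (Ioc a b) = μ.tl x b - μ.tl x a := by
  rw [measureReal_def, flux_Ioc, ENNReal.toReal_ofReal (sub_nonneg.2 (μ.tl_mono hT x hab))]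

instance (hT : 0 < T) (x : ℕ) : IsFiniteMeasure (μ.flux hT x) :=
  (μ.stl hT x).isFiniteMeasure_of_forall_abs_le (C := 1) fun t => by
    rw [stl_apply, abs_of_nonneg (μ.tl_nonneg x t)]
    exact μ.tl_le_one x t

/-- The mean as a Stieltjes function. -/
def smean (hT : 0 < T) : StieltjesFunction ℝ where
  toFun := μ.meanFun
  mono' := μ.monotone_meanFun
  right_continuous' := μ.meanFun_rightCts hT

lemma dmean_eq (hT : 0 < T) : μ.dmean = (μ.smean hT).measure := by
  have h : μ.monotone_meanFun.stieltjesFunction = μ.smean hT := by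
    ext t
    rw [Monotone.stieltjesFunction_eq]
    exact (μ.smean hT).rightLim_eq t
  rw [dmean, h]

end MFPath

/-! ### The intensity as a Lipschitz functional of the mean -/

lemma Assumptions.hasDerivAt {T : ℝ} {α : ℝ≥0} {h ϕ : ℝ → ℝ} (hA : Assumptions T α h ϕ) {t : ℝ}
    (ht : 0 < t) : HasDerivAt h (deriv h t) t :=
  ((hA.h_differentiable t ht.le).differentiableAt (Ici_mem_nhds ht)).hasDerivAt

lemma Assumptions.exists_deriv_bound {T : ℝ} {α : ℝ≥0} {h ϕ : ℝ → ℝ}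
    (hA : Assumptions T α h ϕ) : ∃ C : ℝ, 0 ≤ C ∧ ∀ t ∈ Ioc 0 T, |deriv h t| ≤ C := by
  obtain ⟨C, hC⟩ := hA.deriv_locallyBounded T
  refine ⟨max C 0, le_max_right _ _, fun t ht => ?_⟩
  have := hC t ⟨ht.1.le, ht.2⟩
  rw [derivWithin_of_mem_nhds (Ici_mem_nhds ht.1)] at this
  exact this.trans (le_max_left _ _)

namespace MFPath

variable {T : ℝ} {α : ℝ≥0} {h ϕ : ℝ → ℝ} (μ ν : MFPath T)

/-- The convolution `∫₀ᵗ h(t-u) dμ̄_u` after an integration by parts; the integral may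
extend to `T`, as the mean vanishes at negative times. -/
def conv (h : ℝ → ℝ) (t : ℝ) : ℝ :=
  h 0 * μ.meanFun t + ∫ u in (0 : ℝ)..T, deriv h u * μ.meanFun (t - u)

/-- The intensity, in a form that is defined at all real times and depends on the path only
through the values of its mean. -/
def lam (h ϕ : ℝ → ℝ) (t : ℝ) : ℝ := ϕ (max 0 (μ.conv h t))

lemma intervalIntegrable_deriv_mul (hT : 0 < T) (hA : Assumptions T α h ϕ) (t : ℝ) :
    IntervalIntegrable (fun u => deriv h u * μ.meanFun (t - u)) volume 0 T := by
  obtain ⟨C, hC0, hC⟩ := hA.exists_deriv_bound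
  rw [intervalIntegrable_iff_integrableOn_Ioc_of_le hT.le]
  refine Integrable.of_bound (C := C * μ.meanFun T) ?_ ?_
  · exact ((measurable_deriv h).mul (μ.monotone_meanFun.measurable.comp
      (measurable_const.sub measurable_id))).aestronglyMeasurable
  · filter_upwards [ae_restrict_mem measurableSet_Ioc] with u hu
    rw [norm_mul, Real.norm_eq_abs, Real.norm_eq_abs, abs_of_nonneg (μ.meanFun_nonneg _)]
    exact mul_le_mul (hC u hu) (μ.meanFun_le hT _) (μ.meanFun_nonneg _) hC0

lemma conv_eq (hT : 0 < T) (hA : Assumptions T α h ϕ) {t : ℝ} (ht : t ∈ Icc 0 T) :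
    ∫ u in Ioc 0 t, h (t - u) ∂μ.dmean = μ.conv h t := by
  obtain ⟨C, hC0, hC⟩ := hA.exists_deriv_bound
  have hcont : ContinuousOn (fun u => h (t - u)) (Icc 0 t) :=
    hA.h_differentiable.continuousOn.comp (by fun_prop) fun u hu => sub_nonneg.2 hu.2
  have hint : IntervalIntegrable (fun u => -deriv h (t - u)) volume 0 t := by
    rw [intervalIntegrable_iff_integrableOn_Ioo_of_le ht.1]
    refine Integrable.of_bound (C := C) ?_ ?_
    · exact ((measurable_deriv h).comp
        (measurable_const.sub measurable_id)).neg.aestronglyMeasurable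
    · filter_upwards [ae_restrict_mem measurableSet_Ioo] with u hu
      rw [norm_neg]
      exact hC _ ⟨sub_pos.2 hu.2, by linarith [hu.1, ht.2]⟩
  rw [μ.dmean_eq hT, integral_stieltjes_by_parts (μ.smean hT) ht.1 hcont
    (g' := fun u => -deriv h (t - u)) (fun u hu => ?_) hint]
  · change h (t - t) * μ.meanFun t - h (t - 0) * μ.meanFun 0
      - ∫ s in (0 : ℝ)..t, -deriv h (t - s) * μ.meanFun s = _
    rw [μ.meanFun_of_nonpos hT le_rfl, conv]
    have h1 := intervalIntegral.integral_comp_sub_left (a := 0) (b := t)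
      (fun u => deriv h u * μ.meanFun (t - u)) t
    simp only [sub_sub_cancel, sub_self, sub_zero] at h1
    have h2 := intervalIntegral.integral_add_adjacent_intervals
      ((μ.intervalIntegrable_deriv_mul hT hA t).mono_set (c := 0) (d := t) (by
        rw [uIcc_of_le ht.1, uIcc_of_le hT.le]; exact Icc_subset_Icc_right ht.2))
      ((μ.intervalIntegrable_deriv_mul hT hA t).mono_set (c := t) (d := T) (by
        rw [uIcc_of_le ht.2, uIcc_of_le hT.le]; exact Icc_subset_Icc_left ht.1))
    have h3 : ∫ u in t..T, deriv h u * μ.meanFun (t - u) = 0 := by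
      refine intervalIntegral.integral_zero_ae (Eventually.of_forall fun u hu => ?_)
      rw [uIoc_of_le ht.2] at hu
      rw [μ.meanFun_of_nonpos hT (by linarith [hu.1]), mul_zero]
    simp only [neg_mul, intervalIntegral.integral_neg]
    rw [h1, ← h2, h3, sub_self]
    ring
  · exact (hA.hasDerivAt (sub_pos.2 hu.2)).comp_const_sub t u

lemma intensity_eq (hT : 0 < T) (hA : Assumptions T α h ϕ) {t : ℝ} (ht : t ∈ Icc 0 T) :
    μ.intensity h ϕ t = μ.lam h ϕ t := by
  have h0 : 0 ≤ μ.conv h t := by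
    rw [← μ.conv_eq hT hA ht]
    exact setIntegral_nonneg measurableSet_Ioc fun u hu => hA.h_nonneg _ (sub_nonneg.2 hu.2)
  rw [intensity, μ.conv_eq hT hA ht, lam, max_eq_right h0]

lemma measurable_lam (hA : Assumptions T α h ϕ) (hT : 0 < T) : Measurable (μ.lam h ϕ) := by
  have h1 : Continuous fun y : ℝ => ϕ (max 0 y) :=
    hA.ϕ_lipschitz.continuousOn.comp_continuous (by fun_prop) fun y => mem_Ici.2 (le_max_left _ _)
  refine h1.measurable.comp ?_
  refine (μ.monotone_meanFun.measurable.const_mul _).add ?_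
  simp_rw [intervalIntegral.integral_of_le hT.le]
  refine (StronglyMeasurable.integral_prod_right (f := fun (t u : ℝ) =>
    deriv h u * μ.meanFun (t - u)) ?_).measurable
  exact (((measurable_deriv h).comp measurable_snd).mul (μ.monotone_meanFun.measurable.comp
    (measurable_fst.sub measurable_snd))).stronglyMeasurable

/-- The intensity is bounded away from `0`, and Lipschitz in the mean for the supremum norm. -/
lemma _root_.MeanFieldHawkes.Assumptions.exists_lam_bounds (hT : 0 < T)
    (hA : Assumptions T α h ϕ) :
    ∃ c K : ℝ, 0 < c ∧ 0 ≤ K ∧ (∀ (μ : MFPath T) (t : ℝ), c ≤ μ.lam h ϕ t) ∧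
      (∀ (μ : MFPath T) (t : ℝ), μ.lam h ϕ t ≤ ϕ 0 + K * μ.meanFun T) ∧
      ∀ (μ ν : MFPath T) (t t' δ : ℝ),
        (∀ u ∈ Icc 0 T, |μ.meanFun (t - u) - ν.meanFun (t' - u)| ≤ δ) →
        |μ.lam h ϕ t - ν.lam h ϕ t'| ≤ K * δ := by
  obtain ⟨C, hC0, hC⟩ := hA.exists_deriv_bound
  obtain ⟨c, hc0, hc⟩ := hA.ϕ_bddBelow
  have hh0 := hA.h_nonneg 0 le_rfl
  refine ⟨c, α * (h 0 + C * T), hc0, by positivity, fun μ t => hc _ (le_max_left _ _), ?_, ?_⟩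
  · intro μ t
    have h1 : |μ.conv h t| ≤ (h 0 + C * T) * μ.meanFun T := by
      have h2 := intervalIntegral.norm_integral_le_of_norm_le_const (a := 0) (b := T)
        (f := fun u => deriv h u * μ.meanFun (t - u)) (C := C * μ.meanFun T) (fun u hu => by
          rw [uIoc_of_le hT.le] at hu
          rw [norm_mul, Real.norm_eq_abs, Real.norm_eq_abs, abs_of_nonneg (μ.meanFun_nonneg _)]
          exact mul_le_mul (hC u hu) (μ.meanFun_le hT _) (μ.meanFun_nonneg _) hC0)
      rw [sub_zero, abs_of_pos hT, Real.norm_eq_abs] at h2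
      refine (abs_add_le _ _).trans ?_
      rw [abs_of_nonneg (mul_nonneg hh0 (μ.meanFun_nonneg t))]
      nlinarith [mul_le_mul_of_nonneg_left (μ.meanFun_le hT t) hh0]
    have h3 := hA.ϕ_lipschitz.dist_le_mul (max 0 (μ.conv h t)) (mem_Ici.2 (le_max_left _ _)) 0
      (mem_Ici.2 le_rfl)
    rw [Real.dist_eq, Real.dist_eq, sub_zero, abs_of_nonneg (le_max_left 0 (μ.conv h t))] at h3
    have h4 : max 0 (μ.conv h t) ≤ (h 0 + C * T) * μ.meanFun T :=
      max_le (le_trans (abs_nonneg _) h1) ((le_abs_self _).trans h1)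
    have h5 := mul_le_mul_of_nonneg_left h4 α.coe_nonneg
    have h6 := le_abs_self (ϕ (max 0 (μ.conv h t)) - ϕ 0)
    unfold lam
    linarith
  · intro μ ν t t' δ hδ
    have h1 : |μ.conv h t - ν.conv h t'| ≤ (h 0 + C * T) * δ := by
      have h2 := intervalIntegral.norm_integral_le_of_norm_le_const (a := 0) (b := T)
        (f := fun u => deriv h u * μ.meanFun (t - u) - deriv h u * ν.meanFun (t' - u))
        (C := C * δ) (fun u hu => by
          rw [uIoc_of_le hT.le] at hu
          rw [← mul_sub, norm_mul, Real.norm_eq_abs, Real.norm_eq_abs]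
          exact mul_le_mul (hC u hu) (hδ u ⟨hu.1.le, hu.2⟩) (abs_nonneg _) hC0)
      rw [sub_zero, abs_of_pos hT, Real.norm_eq_abs,
        intervalIntegral.integral_sub (μ.intervalIntegrable_deriv_mul hT hA t)
          (ν.intervalIntegrable_deriv_mul hT hA t')] at h2
      have h3 := hδ 0 ⟨le_rfl, hT.le⟩
      rw [sub_zero, sub_zero] at h3
      have h4 : |h 0 * μ.meanFun t - h 0 * ν.meanFun t'| ≤ h 0 * δ := by
        rw [← mul_sub, abs_mul, abs_of_nonneg hh0]
        exact mul_le_mul_of_nonneg_left h3 hh0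
      have h5 := abs_add_le (h 0 * μ.meanFun t - h 0 * ν.meanFun t')
        ((∫ u in (0 : ℝ)..T, deriv h u * μ.meanFun (t - u))
          - ∫ u in (0 : ℝ)..T, deriv h u * ν.meanFun (t' - u))
      unfold conv
      rw [add_sub_add_comm]
      linarith
    have h3 := hA.ϕ_lipschitz.dist_le_mul (max 0 (μ.conv h t)) (mem_Ici.2 (le_max_left _ _))
      (max 0 (ν.conv h t')) (mem_Ici.2 (le_max_left _ _))
    rw [Real.dist_eq, Real.dist_eq] at h3
    have h4 : |max 0 (μ.conv h t) - max 0 (ν.conv h t')| ≤ |μ.conv h t - ν.conv h t'| := by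
      have := abs_max_sub_max_le_max 0 (μ.conv h t) 0 (ν.conv h t')
      simpa using this
    unfold lam
    rw [mul_assoc]
    exact h3.trans (mul_le_mul_of_nonneg_left (h4.trans h1) α.coe_nonneg)

end MFPath

/-! ### Integration by parts along a path -/

lemma hasSum_integral_nat {ν : Measure ℕ} {f : ℕ → ℝ} (hf : Integrable f ν) :
    HasSum (fun x => ν.real {x} * f x) (∫ x, f x ∂ν) := by
  have h := hasSum_integral_iUnion (μ := ν) (f := f) (s := fun x : ℕ => ({x} : Set ℕ))
    (fun x => measurableSet_singleton x) (fun x y hxy => by simpa using hxy)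
    (by simpa [iUnion_of_singleton] using hf)
  simpa [iUnion_of_singleton, integral_singleton, measureReal_def] using h

lemma tendsto_natCast_mul_tail {ν : ProbabilityMeasure ℕ} (hν : FiniteMean ν) :
    Tendsto (fun M : ℕ => (M : ℝ) * tail ν M) atTop (𝓝 0) := by
  have h := tendsto_integral_of_dominated_convergence (μ := (ν : Measure ℕ))
    (F := fun (M : ℕ) => (Ioi M).indicator fun _ => (M : ℝ)) (f := fun _ => 0)
    (fun x => (x : ℝ)) (fun _ => Measurable.of_discrete.aestronglyMeasurable) hν
    (fun M => Eventually.of_forall fun x => by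
      by_cases hx : M < x
      · rw [indicator_of_mem (mem_Ioi.2 hx), Real.norm_eq_abs, abs_of_nonneg (Nat.cast_nonneg _)]
        exact_mod_cast hx.le
      · rw [indicator_of_notMem (by simpa using hx), norm_zero]
        exact Nat.cast_nonneg _)
    (Eventually.of_forall fun x => by
      refine tendsto_const_nhds.congr' ?_
      filter_upwards [eventually_ge_atTop x] with M hM
      rw [indicator_of_notMem (by simpa using hM)])
  simpa [integral_indicator, tail, mul_comm] using h

lemma intervalIntegrable_sum {ι : Type*} {s : Finset ι} {f : ι → ℝ → ℝ} {ν : Measure ℝ} {a b : ℝ}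
    (hf : ∀ i ∈ s, IntervalIntegrable (f i) ν a b) :
    IntervalIntegrable (fun t => ∑ i ∈ s, f i t) ν a b := by
  rw [intervalIntegrable_iff]
  exact integrable_finsetSum _ fun i hi => intervalIntegrable_iff.1 (hf i hi)

section timeDeriv

variable {T : ℝ} {ψ : ℝ → ℕ → ℝ}

lemma continuousOn_timeDeriv (hT : 0 < T)
    (hψ : ∀ x, ContDiffOn ℝ 1 (fun t => ψ t x) (Icc 0 T)) (x : ℕ) :
    ContinuousOn (fun t => timeDeriv T ψ t x) (Icc 0 T) :=
  (hψ x).continuousOn_derivWithin (uniqueDiffOn_Icc hT) le_rfl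

lemma hasDerivAt_timeDeriv (hψ : ∀ x, ContDiffOn ℝ 1 (fun t => ψ t x) (Icc 0 T)) (x : ℕ)
    {t : ℝ} (ht : t ∈ Ioo 0 T) : HasDerivAt (fun t => ψ t x) (timeDeriv T ψ t x) t := by
  have h1 := ((hψ x).differentiableOn one_ne_zero t (Ioo_subset_Icc_self ht)).hasDerivWithinAt
  exact h1.hasDerivAt (Icc_mem_nhds ht.1 ht.2)

lemma intervalIntegrable_timeDeriv (hT : 0 < T)
    (hψ : ∀ x, ContDiffOn ℝ 1 (fun t => ψ t x) (Icc 0 T)) (x : ℕ) {t : ℝ} (ht : t ∈ Icc 0 T) :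
    IntervalIntegrable (fun s => timeDeriv T ψ s x) volume 0 t := by
  refine ContinuousOn.intervalIntegrable ?_
  rw [uIcc_of_le ht.1]
  exact (continuousOn_timeDeriv hT hψ x).mono (Icc_subset_Icc_right ht.2)

end timeDeriv

namespace MFPath

variable {T : ℝ} {α : ℝ≥0} {h ϕ : ℝ → ℝ} (μ : MFPath T) {ψ : ℝ → ℕ → ℝ}

lemma integral_flux_by_parts (hT : 0 < T)
    (hψ : ∀ x, ContDiffOn ℝ 1 (fun t => ψ t x) (Icc 0 T)) (x y : ℕ) {t : ℝ} (ht : t ∈ Icc 0 T) :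
    ∫ u in Ioc 0 t, ψ u y ∂μ.flux hT x
      = ψ t y * μ.tl x t - ∫ s in (0 : ℝ)..t, timeDeriv T ψ s y * μ.tl x s := by
  have h1 := integral_stieltjes_by_parts (μ.stl hT x) ht.1
    ((hψ y).continuousOn.mono (Icc_subset_Icc_right ht.2))
    (g' := fun s => timeDeriv T ψ s y)
    (fun s hs => hasDerivAt_timeDeriv hψ y ⟨hs.1, hs.2.trans_le ht.2⟩)
    (intervalIntegrable_timeDeriv hT hψ y ht)
  simp only [stl_apply, μ.tl_of_nonpos hT x le_rfl, mul_zero, sub_zero] at h1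
  exact h1

lemma integrable_mul_of_bdd {f g : ℝ → ℝ} {a b C : ℝ} (hf : IntervalIntegrable f volume a b)
    (hg : Measurable g) (hC : ∀ s, |g s| ≤ C) :
    IntervalIntegrable (fun s => f s * g s) volume a b := by
  rw [intervalIntegrable_iff] at hf ⊢
  exact Integrable.mul_bdd (c := C) hf hg.aestronglyMeasurable (Eventually.of_forall hC)

lemma abs_tl_le_one (x : ℕ) (t : ℝ) : |μ.tl x t| ≤ 1 := by
  rw [abs_of_nonneg (μ.tl_nonneg x t)]
  exact μ.tl_le_one x t

lemma abs_ms_le_one (x : ℕ) (t : ℝ) : |μ.ms x t| ≤ 1 := by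
  rw [abs_of_nonneg (μ.ms_nonneg x t)]
  exact μ.ms_le_one x t

/-- Integration by parts for a test function frozen beyond the state `M`. -/
lemma integral_min_by_parts (hT : 0 < T)
    (hψ : ∀ x, ContDiffOn ℝ 1 (fun t => ψ t x) (Icc 0 T)) (M : ℕ) {t : ℝ} (ht : t ∈ Icc 0 T) :
    ∫ x, ψ t (min x M) ∂(μ.law t : Measure ℕ)
      = ψ 0 0 + (∫ s in (0 : ℝ)..t, ∫ x, timeDeriv T ψ s (min x M) ∂(μ.law s : Measure ℕ))
        + ∑ x ∈ Finset.range M, ∫ u in Ioc 0 t, jump ψ u x ∂μ.flux hT x := by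
  have hI := fun x => intervalIntegrable_timeDeriv hT hψ x ht
  have hIt := fun x y => integrable_mul_of_bdd (hI x) (μ.measurable_tl hT y) (μ.abs_tl_le_one y)
  have h1 : ∫ x, ψ t (min x M) ∂(μ.law t : Measure ℕ)
      = ψ t 0 + ∑ x ∈ Finset.range M, (ψ t (x + 1) - ψ t x) * μ.tl x t := by
    rw [integral_min_eq, ← μ.lawc_eq ht]
    rfl
  have h2 : ∫ s in (0 : ℝ)..t, ∫ x, timeDeriv T ψ s (min x M) ∂(μ.law s : Measure ℕ)
      = ∫ s in (0 : ℝ)..t, (timeDeriv T ψ s 0 + ∑ x ∈ Finset.range M,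
          (timeDeriv T ψ s (x + 1) * μ.tl x s - timeDeriv T ψ s x * μ.tl x s)) := by
    refine intervalIntegral.integral_congr fun s hs => ?_
    rw [uIcc_of_le ht.1] at hs
    rw [integral_min_eq, ← μ.lawc_eq ⟨hs.1, hs.2.trans ht.2⟩]
    simp_rw [← sub_mul]
    rfl
  have h3 : ∫ s in (0 : ℝ)..t, timeDeriv T ψ s 0 = ψ t 0 - ψ 0 0 :=
    intervalIntegral.integral_eq_sub_of_hasDerivAt_of_le ht.1
      ((hψ 0).continuousOn.mono (Icc_subset_Icc_right ht.2))
      (fun s hs => hasDerivAt_timeDeriv hψ 0 ⟨hs.1, hs.2.trans_le ht.2⟩) (hI 0)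
  have h4 : ∀ x, ∫ u in Ioc 0 t, jump ψ u x ∂μ.flux hT x
      = (ψ t (x + 1) - ψ t x) * μ.tl x t
        - ∫ s in (0 : ℝ)..t,
          (timeDeriv T ψ s (x + 1) * μ.tl x s - timeDeriv T ψ s x * μ.tl x s) := by
    intro x
    have hc : ∀ y, IntegrableOn (fun u => ψ u y) (Ioc 0 t) (μ.flux hT x) := fun y =>
      (((hψ y).continuousOn.mono (Icc_subset_Icc_right ht.2)).integrableOn_compact
        isCompact_Icc).mono_set Ioc_subset_Icc_self
    unfold jump
    rw [integral_sub (hc _) (hc _), μ.integral_flux_by_parts hT hψ x _ ht,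
      μ.integral_flux_by_parts hT hψ x _ ht, intervalIntegral.integral_sub (hIt _ _) (hIt _ _)]
    ring
  rw [h1, h2, intervalIntegral.integral_add (hI 0)
    (intervalIntegrable_sum fun x _ => (hIt _ _).sub (hIt _ _)),
    intervalIntegral.integral_finsetSum fun x _ => (hIt _ _).sub (hIt _ _), h3]
  simp_rw [h4]
  rw [Finset.sum_sub_distrib]
  ring

lemma measure_singleton_eq {t : ℝ} (ht : t ∈ Icc 0 T) (x : ℕ) :
    (μ.law t : Measure ℕ).real {x} = μ.ms x t := by
  rw [← μ.lawc_eq ht, ms]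

lemma lintegral_law_eq {t : ℝ} (ht : t ∈ Icc 0 T) (f : ℕ → ℝ≥0∞) :
    ∫⁻ x, f x ∂(μ.law t : Measure ℕ) = ∑' x, f x * ENNReal.ofReal (μ.ms x t) := by
  rw [lintegral_countable']
  congr 1
  ext x
  rw [← μ.measure_singleton_eq ht, ofReal_measureReal]

lemma integral_min_eq_sum (M : ℕ) {t : ℝ} (ht : t ∈ Icc 0 T) (f : ℕ → ℝ) :
    ∫ x, f (min x M) ∂(μ.law t : Measure ℕ)
      = ∑ x ∈ Finset.range (M + 1), μ.ms x t * f x + f M * μ.tl M t := by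
  have h : ∀ M, f 0 + ∑ x ∈ Finset.range M, (f (x + 1) - f x) * μ.tl x t
      = ∑ x ∈ Finset.range (M + 1), μ.ms x t * f x + f M * μ.tl M t := by
    intro M
    induction M with
    | zero => simp [μ.ms_zero]; ring
    | succ n ih =>
      rw [Finset.sum_range_succ, ← add_assoc, ih, Finset.sum_range_succ _ (n + 1), ms_succ]
      ring
  rw [integral_min_eq, ← h, ← μ.lawc_eq ht]
  rfl

end MFPath

lemma C1lip_abs_le {T : ℝ} {ψ : ℝ → ℕ → ℝ} (hψ : ψ ∈ C1lip T) :
    ∃ B C : ℝ, 0 ≤ B ∧ 0 ≤ C ∧ ∀ t ∈ Icc 0 T, ∀ x : ℕ, |ψ t x| ≤ B + C * x := by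
  obtain ⟨hc, C, hC⟩ := hψ
  obtain ⟨B, hB⟩ := isCompact_Icc.exists_bound_of_continuousOn (hc 0).continuousOn
  refine ⟨max B 0, max C 0, le_max_right _ _, le_max_right _ _, fun t ht x => ?_⟩
  induction x with
  | zero => simpa using (hB t ht).trans (le_max_left B 0)
  | succ n ih =>
    have h1 : ψ t (n + 1) = ψ t n + jump ψ t n := by unfold jump; ring
    rw [h1]
    have h2 := (hC t ht n).trans (le_max_left C 0)
    push_cast
    linarith [abs_add_le (ψ t n) (jump ψ t n)]

lemma C1b_subset_C1lip (T : ℝ) : C1b T ⊆ C1lip T := by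
  rintro ψ ⟨hc, C, hC⟩
  refine ⟨hc, C + C, fun t ht x => ?_⟩
  exact (abs_sub _ _).trans (add_le_add (hC t ht _) (hC t ht _))

namespace MFPath

variable {T : ℝ} {α : ℝ≥0} {h ϕ : ℝ → ℝ} (μ : MFPath T) {ψ : ℝ → ℕ → ℝ}

/-- The contribution of the states above `M` disappears in the limit because of the finite first
moment. -/
lemma tendsto_integral_timeDeriv_tail (hT : 0 < T) (hψ : ψ ∈ C1lip T) {t : ℝ}
    (ht : t ∈ Icc 0 T) :
    Tendsto (fun M : ℕ => ∫ s in (0 : ℝ)..t, timeDeriv T ψ s M * μ.tl M s) atTop (𝓝 0) := by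
  obtain ⟨B, C, hB, hC, hBC⟩ := C1lip_abs_le hψ
  have hlim : Tendsto (fun M : ℕ => 2 * (B * μ.tl M T + C * (M * μ.tl M T))) atTop (𝓝 0) := by
    have h1 : Tendsto (fun M : ℕ => μ.tl M T) atTop (𝓝 0) := tail_tendsto _
    have h2 : Tendsto (fun M : ℕ => (M : ℝ) * μ.tl M T) atTop (𝓝 0) :=
      tendsto_natCast_mul_tail (μ.finiteMean_lawc hT T)
    simpa using ((h1.const_mul B).add (h2.const_mul C)).const_mul 2
  refine squeeze_zero_norm (fun M => ?_) hlim
  have h1 : ∫ s in (0 : ℝ)..t, timeDeriv T ψ s M * μ.tl M s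
      = ψ t M * μ.tl M t - ∫ u in Ioc 0 t, ψ u M ∂μ.flux hT M := by
    rw [μ.integral_flux_by_parts hT hψ.1 M M ht]
    ring
  have hle : μ.tl M t ≤ μ.tl M T := μ.tl_mono hT M ht.2
  have hBM : 0 ≤ B + C * M := by positivity
  have h2 : |ψ t M * μ.tl M t| ≤ (B + C * M) * μ.tl M T := by
    rw [abs_mul, abs_of_nonneg (μ.tl_nonneg M t)]
    exact mul_le_mul (hBC t ht M) hle (μ.tl_nonneg M t) hBM
  have h3 : |∫ u in Ioc 0 t, ψ u M ∂μ.flux hT M| ≤ (B + C * M) * μ.tl M T := by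
    have := norm_setIntegral_le_of_norm_le_const (μ := μ.flux hT M) (s := Ioc 0 t)
      (f := fun u => ψ u M) (C := B + C * M) (measure_lt_top _ _)
      (fun u hu => hBC u ⟨hu.1.le, hu.2.trans ht.2⟩ M)
    rw [μ.flux_real_Ioc hT M ht.1, μ.tl_of_nonpos hT M le_rfl, sub_zero] at this
    exact this.trans (mul_le_mul_of_nonneg_left hle hBM)
  rw [h1, Real.norm_eq_abs]
  refine (abs_sub _ _).trans ?_
  linarith

/-- The weak form of the evolution of a path, with the flux measures as the driving term. -/
theorem tendsto_sum_integral_flux (hT : 0 < T) (hψ : ψ ∈ C1lip T) (hd : DerivIntegrable μ ψ)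
    {t : ℝ} (ht : t ∈ Icc 0 T) :
    Tendsto (fun M => ∑ x ∈ Finset.range M, ∫ u in Ioc 0 t, jump ψ u x ∂μ.flux hT x) atTop
      (𝓝 ((∫ x, ψ t x ∂(μ.law t : Measure ℕ)) - ψ 0 0
        - ∫ s in (0 : ℝ)..t, ∫ x, timeDeriv T ψ s x ∂(μ.law s : Measure ℕ))) := by
  obtain ⟨B, C, hB, hC, hBC⟩ := C1lip_abs_le hψ
  have hcd := continuousOn_timeDeriv hT hψ.1
  have hsub : Ioc 0 t ⊆ Icc 0 T := fun s hs => ⟨hs.1.le, hs.2.trans ht.2⟩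
  have hA : Tendsto (fun M => ∫ x, ψ t (min x M) ∂(μ.law t : Measure ℕ)) atTop
      (𝓝 (∫ x, ψ t x ∂(μ.law t : Measure ℕ))) := by
    refine tendsto_integral_of_dominated_convergence (fun x : ℕ => B + C * x)
      (fun _ => Measurable.of_discrete.aestronglyMeasurable)
      ((integrable_const _).add ((μ.finiteMean t ht).const_mul C))
      (fun M => Eventually.of_forall fun x => ?_) (Eventually.of_forall fun x => ?_)
    · refine (hBC t ht _).trans ?_
      have : ((min x M : ℕ) : ℝ) ≤ x := by exact_mod_cast min_le_left x M
      nlinarith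
    · refine tendsto_const_nhds.congr' ?_
      filter_upwards [eventually_ge_atTop x] with M hM
      rw [min_eq_left hM]
  have hmeas : AEMeasurable (fun s => ∫⁻ x, ‖timeDeriv T ψ s x‖ₑ ∂(μ.law s : Measure ℕ))
      (volume.restrict (Ioc 0 t)) := by
    have : AEMeasurable (fun s => ∑' x, ‖timeDeriv T ψ s x‖ₑ * ENNReal.ofReal (μ.ms x s))
        (volume.restrict (Ioc 0 t)) := by
      refine AEMeasurable.tsum fun x => ?_
      exact ((((hcd x).mono hsub).aestronglyMeasurable measurableSet_Ioc).enorm).mul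
        (μ.measurable_ms hT x).ennreal_ofReal.aemeasurable
    refine this.congr ?_
    filter_upwards [ae_restrict_mem measurableSet_Ioc] with s hs
    rw [μ.lintegral_law_eq (hsub hs)]
  have hfin : ∫⁻ s in Ioc 0 t, ∫⁻ x, ‖timeDeriv T ψ s x‖ₑ ∂(μ.law s : Measure ℕ) ≠ ⊤ :=
    ((lintegral_mono_set hsub).trans_lt hd).ne
  have hB' : Tendsto (fun M => ∫ s in (0 : ℝ)..t,
      ∑ x ∈ Finset.range (M + 1), μ.ms x s * timeDeriv T ψ s x) atTop
      (𝓝 (∫ s in (0 : ℝ)..t, ∫ x, timeDeriv T ψ s x ∂(μ.law s : Measure ℕ))) := by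
    simp_rw [intervalIntegral.integral_of_le ht.1]
    refine tendsto_integral_of_dominated_convergence
      (fun s => (∫⁻ x, ‖timeDeriv T ψ s x‖ₑ ∂(μ.law s : Measure ℕ)).toReal) (fun M => ?_)
      (integrable_toReal_of_lintegral_ne_top hmeas hfin) (fun M => ?_) ?_
    · refine Finset.aestronglyMeasurable_fun_sum _ fun x _ => ?_
      exact (μ.measurable_ms hT x).aestronglyMeasurable.mul
        (((hcd x).mono hsub).aestronglyMeasurable measurableSet_Ioc)
    · filter_upwards [ae_restrict_mem measurableSet_Ioc, ae_lt_top' hmeas hfin] with s hs hs'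
      rw [← ENNReal.ofReal_le_iff_le_toReal hs'.ne, μ.lintegral_law_eq (hsub hs)]
      refine le_trans ?_ (ENNReal.sum_le_tsum (Finset.range (M + 1)))
      refine (ENNReal.ofReal_le_ofReal (norm_sum_le _ _)).trans ?_
      rw [ENNReal.ofReal_sum_of_nonneg fun _ _ => norm_nonneg _]
      refine Finset.sum_le_sum fun x _ => ?_
      rw [norm_mul, mul_comm, ENNReal.ofReal_mul (norm_nonneg _), ofReal_norm,
        Real.norm_eq_abs, abs_of_nonneg (μ.ms_nonneg x s)]
    · filter_upwards [ae_restrict_mem measurableSet_Ioc, ae_lt_top' hmeas hfin] with s hs hs'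
      have hint : Integrable (fun x => timeDeriv T ψ s x) (μ.law s : Measure ℕ) :=
        ⟨Measurable.of_discrete.aestronglyMeasurable, hs'⟩
      have := (hasSum_integral_nat hint).tendsto_sum_nat.comp (tendsto_add_atTop_nat 1)
      refine this.congr fun M => ?_
      simp only [Function.comp, μ.measure_singleton_eq (hsub hs)]
  have hD := (hB'.add (μ.tendsto_integral_timeDeriv_tail hT hψ ht))
  rw [add_zero] at hD
  refine ((hA.sub_const (ψ 0 0)).sub hD).congr fun M => ?_
  rw [μ.integral_min_by_parts hT hψ.1 M ht]
  have h5 : ∫ s in (0 : ℝ)..t, ∫ x, timeDeriv T ψ s (min x M) ∂(μ.law s : Measure ℕ)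
      = (∫ s in (0 : ℝ)..t, ∑ x ∈ Finset.range (M + 1), μ.ms x s * timeDeriv T ψ s x)
        + ∫ s in (0 : ℝ)..t, timeDeriv T ψ s M * μ.tl M s := by
    have hI := fun x => intervalIntegrable_timeDeriv hT hψ.1 x ht
    rw [← intervalIntegral.integral_add]
    · refine intervalIntegral.integral_congr fun s hs => ?_
      rw [uIcc_of_le ht.1] at hs
      exact μ.integral_min_eq_sum M ⟨hs.1, hs.2.trans ht.2⟩ _
    · refine intervalIntegrable_sum fun x _ => ?_
      simp_rw [mul_comm (μ.ms x _)]
      exact integrable_mul_of_bdd (hI x) (μ.measurable_ms hT x) (μ.abs_ms_le_one x)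
    · exact integrable_mul_of_bdd (hI M) (μ.measurable_tl hT M) (μ.abs_tl_le_one M)
  rw [h5]
  ring

end MFPath

/-! ### The rate function as a supremum over bounded measurable fluxes -/

lemma abs_exp_sub_le {a b D : ℝ} (ha : a ≤ D) (hb : b ≤ D) :
    |Real.exp a - Real.exp b| ≤ Real.exp D * |a - b| := by
  have key : ∀ a b : ℝ, a ≤ D → b ≤ a →
      |Real.exp a - Real.exp b| ≤ Real.exp D * |a - b| := by
    intro a b ha hab
    rw [abs_of_nonneg (sub_nonneg.2 (Real.exp_le_exp.2 hab)), abs_of_nonneg (sub_nonneg.2 hab)]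
    have h1 := Real.add_one_le_exp (b - a)
    have h2 : Real.exp b = Real.exp a * Real.exp (b - a) := by rw [← Real.exp_add]; ring_nf
    have h3 : Real.exp a - Real.exp b ≤ Real.exp a * (a - b) := by
      rw [h2]; nlinarith [Real.exp_pos a]
    exact h3.trans (mul_le_mul_of_nonneg_right (Real.exp_le_exp.2 ha) (sub_nonneg.2 hab))
  rcases le_total b a with h | h
  · exact key a b ha h
  · rw [abs_sub_comm, abs_sub_comm a b]
    exact key b a hb h

lemma abs_exp_sub_one_le {a C : ℝ} (ha : |a| ≤ C) : |Real.exp a - 1| ≤ Real.exp C + 1 := by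
  have h1 := Real.exp_le_exp.2 ((le_abs_self a).trans ha)
  rw [abs_le]
  constructor <;> linarith [Real.exp_pos a, Real.exp_pos C]

/-- A bounded measurable function is close in `L¹` to polynomials with almost the same bound. -/
lemma exists_polynomial_integral_sub_le (ν : Measure ℝ) [IsFiniteMeasure ν] {T C δ : ℝ}
    {f : ℝ → ℝ} (hf : Measurable f) (hC : ∀ t, |f t| ≤ C) (hδ : 0 < δ) :
    ∃ p : Polynomial ℝ, (∀ t ∈ Icc 0 T, |p.eval t| ≤ C + 1) ∧
      ∫ t in Icc 0 T, |f t - p.eval t| ∂ν ≤ δ := by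
  set ρ := ν.restrict (Icc 0 T)
  have hC0 : 0 ≤ C := (abs_nonneg _).trans (hC 0)
  have hfi : Integrable f ρ := Integrable.of_bound hf.aestronglyMeasurable C
    (Eventually.of_forall hC)
  obtain ⟨g, hg, hgi⟩ := hfi.exists_boundedContinuous_integral_sub_le (half_pos hδ)
  set κ := min 1 (δ / (2 * (ρ.real univ + 1))) with hκ
  have hκ0 : 0 < κ := by
    refine lt_min one_pos ?_
    have : 0 ≤ ρ.real univ := measureReal_nonneg
    positivity
  let k : ℝ → ℝ := fun t => max (-C) (min C (g t))
  have hk : Continuous k := by fun_prop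
  obtain ⟨p, hp⟩ := exists_polynomial_near_of_continuousOn 0 T k hk.continuousOn κ hκ0
  have hkC : ∀ t, |k t| ≤ C := fun t =>
    abs_le.2 ⟨le_max_left _ _, max_le (by linarith) (min_le_left _ _)⟩
  refine ⟨p, fun t ht => ?_, ?_⟩
  · have h1 := (hp t ht).le.trans (min_le_left _ _)
    have h2 := abs_add_le (p.eval t - k t) (k t)
    rw [sub_add_cancel] at h2
    linarith [hkC t]
  · have hfk : ∀ t, |f t - k t| ≤ ‖f t - g t‖ := by
      intro t
      have h1 : f t = max (-C) (min C (f t)) := by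
        rw [min_eq_right ((le_abs_self _).trans (hC t)), max_eq_right (abs_le.1 (hC t)).1]
      have h2 := abs_max_sub_max_le_max (-C) (min C (f t)) (-C) (min C (g t))
      have h3 := abs_min_sub_min_le_max C (f t) C (g t)
      rw [← h1, sub_self, abs_zero, max_eq_right (abs_nonneg (min C (f t) - min C (g t)))] at h2
      rw [sub_self, abs_zero, max_eq_right (abs_nonneg (f t - g t))] at h3
      exact h2.trans h3
    have hn : Integrable (fun t => ‖f t - g t‖) ρ := (hfi.sub hgi).norm
    have hle : ∫ t, |f t - p.eval t| ∂ρ ≤ ∫ t, (‖f t - g t‖ + κ) ∂ρ := by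
      refine integral_mono_of_nonneg (Eventually.of_forall fun t => abs_nonneg _)
        (hn.add (integrable_const _)) ?_
      filter_upwards [ae_restrict_mem measurableSet_Icc] with t ht
      have h1 := abs_sub_le (f t) (k t) (p.eval t)
      have h2 := (hp t ht).le
      rw [abs_sub_comm] at h2
      linarith [hfk t]
    refine hle.trans ?_
    rw [integral_add hn (integrable_const _), integral_const, smul_eq_mul]
    have h0 : 0 ≤ ρ.real univ := measureReal_nonneg
    have h1 : ρ.real univ * κ ≤ δ / 2 := by
      have h2 : κ ≤ δ / (2 * (ρ.real univ + 1)) := min_le_right _ _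
      have h3 := mul_le_mul_of_nonneg_left h2 h0
      refine h3.trans ?_
      rw [mul_div_assoc', div_le_div_iff₀ (by positivity) two_pos]
      nlinarith
    linarith

lemma derivIntegrable_of_min {T : ℝ} (hT : 0 < T) (μ : MFPath T) {ψ : ℝ → ℕ → ℝ}
    (hψ : ∀ x, ContDiffOn ℝ 1 (fun t => ψ t x) (Icc 0 T)) {M : ℕ}
    (hM : ∀ t x, ψ t x = ψ t (min x M)) : DerivIntegrable μ ψ := by
  have hb : ∀ x, ∃ C, ∀ t ∈ Icc 0 T, ‖timeDeriv T ψ t x‖ ≤ C := fun x =>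
    isCompact_Icc.exists_bound_of_continuousOn (continuousOn_timeDeriv hT hψ x)
  choose C hC using hb
  have hb' : ∀ t ∈ Icc 0 T, ∀ x, ‖timeDeriv T ψ t x‖ ≤ ∑ y ∈ Finset.range (M + 1), |C y| := by
    intro t ht x
    have h1 : timeDeriv T ψ t x = timeDeriv T ψ t (min x M) := by
      unfold timeDeriv
      congr 1
      ext s
      exact hM s x
    rw [h1]
    refine ((hC _ t ht).trans (le_abs_self _)).trans ?_
    exact Finset.single_le_sum (f := fun y => |C y|) (fun _ _ => abs_nonneg _)
      (Finset.mem_range.2 (Nat.lt_succ_of_le (min_le_right x M)))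
  set D := ∑ y ∈ Finset.range (M + 1), |C y|
  unfold DerivIntegrable
  calc ∫⁻ t in Icc 0 T, ∫⁻ x, ‖timeDeriv T ψ t x‖ₑ ∂(μ.law t : Measure ℕ)
      ≤ ∫⁻ _ in Icc 0 T, ENNReal.ofReal D := by
        refine setLIntegral_mono' measurableSet_Icc fun t ht => ?_
        calc ∫⁻ x, ‖timeDeriv T ψ t x‖ₑ ∂(μ.law t : Measure ℕ)
            ≤ ∫⁻ _, ENNReal.ofReal D ∂(μ.law t : Measure ℕ) :=
              lintegral_mono fun x => by
                rw [← ofReal_norm]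
                exact ENNReal.ofReal_le_ofReal (hb' t ht x)
          _ = ENNReal.ofReal D := by simp
    _ < ⊤ := by
        rw [setLIntegral_const]
        exact ENNReal.mul_lt_top ENNReal.ofReal_lt_top measure_Icc_lt_top

lemma mem_C1b_of_min {T : ℝ} {ψ : ℝ → ℕ → ℝ}
    (hψ : ∀ x, ContDiffOn ℝ 1 (fun t => ψ t x) (Icc 0 T)) {M : ℕ}
    (hM : ∀ t x, ψ t x = ψ t (min x M)) : ψ ∈ C1b T := by
  have hb : ∀ x, ∃ C, ∀ t ∈ Icc 0 T, ‖ψ t x‖ ≤ C := fun x =>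
    isCompact_Icc.exists_bound_of_continuousOn (hψ x).continuousOn
  choose C hC using hb
  refine ⟨hψ, ∑ y ∈ Finset.range (M + 1), |C y|, fun t ht x => ?_⟩
  rw [hM]
  refine ((hC _ t ht).trans (le_abs_self _)).trans ?_
  exact Finset.single_le_sum (f := fun y => |C y|) (fun _ _ => abs_nonneg _)
    (Finset.mem_range.2 (Nat.lt_succ_of_le (min_le_right x M)))

namespace MFPath

variable {T : ℝ} {α : ℝ≥0} {h ϕ : ℝ → ℝ} (μ : MFPath T) {ψ : ℝ → ℕ → ℝ}

/-- The functional `J` written in terms of the jump `f = Dψ` of the test function, restricted to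
the states below `M`. -/
def cost (hT : 0 < T) (h ϕ : ℝ → ℝ) (f : ℝ → ℕ → ℝ) (M : ℕ) : ℝ :=
  ∑ x ∈ Finset.range M, ((∫ t in Ioc 0 T, f t x ∂μ.flux hT x)
    - ∫ t in Ioc 0 T, (Real.exp (f t x) - 1) * (μ.ms x t * μ.lam h ϕ t))

lemma integrable_mul_ms_lam (hT : 0 < T) (hA : Assumptions T α h ϕ) {s : Set ℝ}
    (hs : volume s ≠ ⊤) {g : ℝ → ℝ} {C : ℝ}
    (hg : AEStronglyMeasurable g (volume.restrict s))
    (hC : ∀ᵐ t ∂volume.restrict s, |g t| ≤ C) (x : ℕ) :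
    IntegrableOn (fun t => g t * (μ.ms x t * μ.lam h ϕ t)) s := by
  obtain ⟨c, K, hc, hK, hlow, hup, -⟩ := hA.exists_lam_bounds hT
  have : IsFiniteMeasure (volume.restrict s) := ⟨by simpa using hs.lt_top⟩
  refine Integrable.of_bound (C := C * (1 * (ϕ 0 + K * μ.meanFun T)))
    (hg.mul ((μ.measurable_ms hT x).mul (μ.measurable_lam hA hT)).aestronglyMeasurable) ?_
  filter_upwards [hC] with t ht
  rw [norm_mul, norm_mul]
  refine mul_le_mul ht (mul_le_mul (μ.abs_ms_le_one x t) ?_ (norm_nonneg _) zero_le_one)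
    (by positivity) ((abs_nonneg _).trans ht)
  rw [Real.norm_eq_abs, abs_of_pos (hc.trans_le (hlow μ t))]
  exact hup μ t

/-- Integrals against the compensator `μ_t({x}) λ_μ(t) dt`, as a limit over the states. -/
lemma tendsto_sum_integral_ms_lam (hT : 0 < T) (hA : Assumptions T α h ϕ) {g : ℝ → ℕ → ℝ}
    {D t : ℝ} (ht : t ∈ Icc 0 T)
    (hg : ∀ x, AEStronglyMeasurable (fun s => g s x) (volume.restrict (Ioc 0 t)))
    (hD : ∀ s ∈ Ioc 0 t, ∀ x, |g s x| ≤ D) :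
    Tendsto (fun M => ∑ x ∈ Finset.range M,
      ∫ s in Ioc 0 t, g s x * (μ.ms x s * μ.lam h ϕ s)) atTop
      (𝓝 (∫ s in (0 : ℝ)..t, (∫ x, g s x ∂(μ.law s : Measure ℕ)) * μ.intensity h ϕ s)) := by
  obtain ⟨c, K, hc, hK, hlow, hup, -⟩ := hA.exists_lam_bounds hT
  have hint : ∀ x, IntegrableOn (fun s => g s x * (μ.ms x s * μ.lam h ϕ s)) (Ioc 0 t) := fun x =>
    μ.integrable_mul_ms_lam hT hA measure_Ioc_lt_top.ne (hg x) (by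
      filter_upwards [ae_restrict_mem measurableSet_Ioc] with s hs using hD s hs x) x
  simp_rw [fun M => (integral_finsetSum (Finset.range M) fun x _ => hint x).symm]
  rw [intervalIntegral.integral_of_le ht.1]
  refine tendsto_integral_of_dominated_convergence
    (fun _ => |D| * (ϕ 0 + K * μ.meanFun T))
    (fun M => (integrable_finsetSum _ fun x _ => hint x).aestronglyMeasurable)
    (integrable_const _) (fun M => ?_) ?_
  · filter_upwards [ae_restrict_mem measurableSet_Ioc] with s hs
    have hl0 : 0 ≤ μ.lam h ϕ s := hc.le.trans (hlow μ s)
    calc ‖∑ x ∈ Finset.range M, g s x * (μ.ms x s * μ.lam h ϕ s)‖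
        ≤ ∑ x ∈ Finset.range M, |D| * μ.lam h ϕ s * μ.ms x s := by
          refine (norm_sum_le _ _).trans (Finset.sum_le_sum fun x _ => ?_)
          rw [Real.norm_eq_abs, abs_mul, abs_mul, abs_of_nonneg hl0,
            abs_of_nonneg (μ.ms_nonneg x s)]
          have := mul_le_mul_of_nonneg_right ((hD s hs x).trans (le_abs_self D))
            (mul_nonneg (μ.ms_nonneg x s) hl0)
          linarith
      _ ≤ |D| * μ.lam h ϕ s * 1 := by
          rw [← Finset.mul_sum]
          exact mul_le_mul_of_nonneg_left (μ.sum_ms_le_one M s) (by positivity)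
      _ ≤ |D| * (ϕ 0 + K * μ.meanFun T) := by
          rw [mul_one]
          exact mul_le_mul_of_nonneg_left (hup μ s) (abs_nonneg D)
  · filter_upwards [ae_restrict_mem measurableSet_Ioc] with s hs
    have hs' : s ∈ Icc 0 T := ⟨hs.1.le, hs.2.trans ht.2⟩
    have hi : Integrable (fun x => g s x) (μ.law s : Measure ℕ) :=
      Integrable.of_bound Measurable.of_discrete.aestronglyMeasurable D
        (Eventually.of_forall fun x => hD s hs x)
    have := ((hasSum_integral_nat hi).mul_right (μ.lam h ϕ s)).tendsto_sum_nat
    rw [μ.intensity_eq hT hA hs']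
    refine this.congr fun M => Finset.sum_congr rfl fun x _ => ?_
    rw [μ.measure_singleton_eq hs']
    ring

/-- The functional `J` depends on the test function only through its jumps. -/
theorem tendsto_cost (hT : 0 < T) (hA : Assumptions T α h ϕ) (hψ : ψ ∈ C1b T)
    (hd : DerivIntegrable μ ψ) :
    Tendsto (fun M => μ.cost hT h ϕ (jump ψ) M) atTop (𝓝 (J h ϕ μ ψ)) := by
  have hlip := C1b_subset_C1lip T hψ
  obtain ⟨D, hD⟩ := hlip.2
  have hjc : ∀ x, ContinuousOn (fun t => jump ψ t x) (Icc 0 T) := fun x =>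
    (hψ.1 (x + 1)).continuousOn.sub (hψ.1 x).continuousOn
  have hB := μ.tendsto_sum_integral_ms_lam hT hA (right_mem_Icc.2 hT.le)
    (g := fun t x => Real.exp (jump ψ t x) - 1) (D := Real.exp D + 1)
    (fun x => ((Real.continuous_exp.comp_continuousOn (hjc x)).sub
      continuousOn_const).mono Ioc_subset_Icc_self |>.aestronglyMeasurable measurableSet_Ioc)
    (fun t ht x => abs_exp_sub_one_le (hD t (Ioc_subset_Icc_self ht) x))
  have hA' := μ.tendsto_sum_integral_flux hT hlip hd (right_mem_Icc.2 hT.le)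
  refine (hA'.sub hB).congr fun M => ?_
  rw [cost, Finset.sum_sub_distrib]

lemma J_le_of_rateFunction_le {R : ℝ} (hR : rateFunction h ϕ μ ≤ (R : EReal)) (hψ : ψ ∈ C1b T)
    (hd : DerivIntegrable μ ψ) : J h ϕ μ ψ ≤ R := by
  have h1 : (J h ϕ μ ψ : EReal) ≤ rateFunction h ϕ μ :=
    le_iSup₂ (f := fun ψ (_ : ψ ∈ {ψ | ψ ∈ C1b T ∧ DerivIntegrable μ ψ}) =>
      (J h ϕ μ ψ : EReal)) ψ ⟨hψ, hd⟩
  exact_mod_cast h1.trans hR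

/-- For a test function frozen beyond `M`, the functional `J` is a finite sum. -/
lemma J_min_eq_cost (hT : 0 < T) (hA : Assumptions T α h ϕ)
    (hψ : ∀ x, ContDiffOn ℝ 1 (fun t => ψ t x) (Icc 0 T)) (M : ℕ) :
    (fun t x => ψ t (min x M)) ∈ C1b T ∧ DerivIntegrable μ (fun t x => ψ t (min x M)) ∧
      J h ϕ μ (fun t x => ψ t (min x M)) = μ.cost hT h ϕ (jump ψ) M := by
  set χ : ℝ → ℕ → ℝ := fun t x => ψ t (min x M) with hχ
  have hc : ∀ x, ContDiffOn ℝ 1 (fun t => χ t x) (Icc 0 T) := fun x => hψ _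
  have hM : ∀ t x, χ t x = χ t (min x M) := fun t x => by simp [hχ]
  have hmem := mem_C1b_of_min hc hM
  have hd := derivIntegrable_of_min hT μ hc hM
  refine ⟨hmem, hd, ?_⟩
  have hj1 : ∀ t x, x < M → jump χ t x = jump ψ t x := by
    intro t x hx
    simp only [jump, hχ]
    rw [min_eq_left hx.le, min_eq_left (Nat.succ_le_of_lt hx)]
  have hj2 : ∀ t x, M ≤ x → jump χ t x = 0 := by
    intro t x hx
    simp only [jump, hχ]
    rw [min_eq_right hx, min_eq_right (hx.trans (Nat.le_succ x)), sub_self]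
  refine tendsto_nhds_unique (μ.tendsto_cost hT hA hmem hd) (tendsto_const_nhds.congr' ?_)
  filter_upwards [eventually_ge_atTop M] with M' hM'
  unfold cost
  symm
  rw [← Finset.sum_range_add_sum_Ico _ hM', Finset.sum_eq_zero (s := Finset.Ico M M'), add_zero]
  · refine Finset.sum_congr rfl fun x hx => ?_
    simp_rw [hj1 _ x (Finset.mem_range.1 hx)]
  · intro x hx
    simp_rw [hj2 _ x (Finset.mem_Ico.1 hx).1]
    simp

lemma cost_le_of_contDiff (hT : 0 < T) (hA : Assumptions T α h ϕ) {R : ℝ}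
    (hR : rateFunction h ϕ μ ≤ (R : EReal)) {f : ℝ → ℕ → ℝ}
    (hf : ∀ x, ContDiff ℝ 1 fun t => f t x) (M : ℕ) : μ.cost hT h ϕ f M ≤ R := by
  have hj : jump (fun t x => ∑ y ∈ Finset.range x, f t y) = f := by
    ext t x
    rw [jump, Finset.sum_range_succ, add_sub_cancel_left]
  obtain ⟨hb, hd, hJ⟩ := μ.J_min_eq_cost hT hA (ψ := fun t x => ∑ y ∈ Finset.range x, f t y)
    (fun x => (ContDiff.sum fun y _ => hf y).contDiffOn) M
  rw [hj] at hJ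
  rw [← hJ]
  exact μ.J_le_of_rateFunction_le hR hb hd

/-- The variational inequality extends from smooth to bounded measurable functions. -/
theorem cost_le (hT : 0 < T) (hA : Assumptions T α h ϕ) {R : ℝ}
    (hR : rateFunction h ϕ μ ≤ (R : EReal)) {f : ℝ → ℕ → ℝ} {C : ℝ}
    (hf : ∀ x, Measurable fun t => f t x) (hC : ∀ t x, |f t x| ≤ C) (M : ℕ) :
    μ.cost hT h ϕ f M ≤ R := by
  obtain ⟨c, K, hc, hK, hlow, hup, -⟩ := hA.exists_lam_bounds hT
  set Λ := ϕ 0 + K * μ.meanFun T with hΛ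
  have hΛ0 : 0 ≤ Λ := (hc.le.trans (hlow μ 0)).trans (hup μ 0)
  set L := 1 + Real.exp (C + 1) * Λ with hL
  have hL0 : 0 < L := by positivity
  -- Replacing `f` by a polynomial within `δ` in `L¹(flux + dt)` changes each summand by `L * δ`.
  have key : ∀ δ : ℝ, 0 < δ → μ.cost hT h ϕ f M ≤ R + M * (L * δ) := by
    intro δ hδ
    have hex := fun x => exists_polynomial_integral_sub_le
      (μ.flux hT x + volume.restrict (Icc 0 T)) (T := T) (hf x) (fun t => hC t x) hδ
    choose p hp hpδ using hex
    have hpl := μ.cost_le_of_contDiff hT hA hR (f := fun t x => (p x).eval t)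
      (fun x => by simpa using (p x).contDiff_aeval (𝕜 := ℝ) 1) M
    have hterm : ∀ x, ((∫ t in Ioc 0 T, f t x ∂μ.flux hT x)
        - ∫ t in Ioc 0 T, (Real.exp (f t x) - 1) * (μ.ms x t * μ.lam h ϕ t))
        ≤ ((∫ t in Ioc 0 T, (p x).eval t ∂μ.flux hT x)
        - ∫ t in Ioc 0 T, (Real.exp ((p x).eval t) - 1) * (μ.ms x t * μ.lam h ϕ t)) + L * δ := by
      intro x
      set ρ := (μ.flux hT x + volume.restrict (Icc 0 T)).restrict (Icc 0 T) with hρ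
      have hpm : Measurable fun t => (p x).eval t := (p x).continuous.measurable
      have hpi : ∀ (τ : Measure ℝ) [IsFiniteMeasure τ],
          Integrable (fun t => (p x).eval t) (τ.restrict (Icc 0 T)) := fun τ _ =>
        (p x).continuous.continuousOn.integrableOn_compact isCompact_Icc
      have hfi : ∀ (τ : Measure ℝ) [IsFiniteMeasure τ], Integrable (fun t => f t x) τ := fun τ _ =>
        Integrable.of_bound (hf x).aestronglyMeasurable C (Eventually.of_forall fun t => hC t x)
      have hdi : Integrable (fun t => |f t x - (p x).eval t|) ρ :=
        ((hfi _).sub (hpi _)).abs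
      have hle1 : (μ.flux hT x).restrict (Ioc 0 T) ≤ ρ :=
        (Measure.restrict_mono_set _ Ioc_subset_Icc_self).trans
          (Measure.restrict_mono le_rfl (Measure.le_add_right le_rfl))
      have hle2 : volume.restrict (Ioc 0 T) ≤ ρ := by
        have h1 : volume.restrict (Icc 0 T) ≤ ρ := by
          calc volume.restrict (Icc 0 T) = (volume.restrict (Icc 0 T)).restrict (Icc 0 T) := by
                rw [Measure.restrict_restrict measurableSet_Icc, inter_self]
            _ ≤ ρ := Measure.restrict_mono le_rfl (Measure.le_add_left le_rfl)
        exact (Measure.restrict_mono_set _ Ioc_subset_Icc_self).trans h1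
      have h1 : (∫ t in Ioc 0 T, f t x ∂μ.flux hT x) - ∫ t in Ioc 0 T, (p x).eval t ∂μ.flux hT x
          ≤ δ := by
        rw [← integral_sub (hfi _) ((hpi (μ.flux hT x)).mono_measure
          (Measure.restrict_mono_set _ Ioc_subset_Icc_self))]
        refine (le_abs_self _).trans ((abs_integral_le_integral_abs).trans ?_)
        exact (integral_mono_measure hle1 (Eventually.of_forall fun t => abs_nonneg _) hdi).trans
          (hpδ x)
      have hmem : ∀ᵐ t ∂volume.restrict (Ioc 0 T), t ∈ Icc 0 T := by
        filter_upwards [ae_restrict_mem measurableSet_Ioc] with t ht using Ioc_subset_Icc_self ht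
      have h2 : (∫ t in Ioc 0 T, (Real.exp ((p x).eval t) - 1) * (μ.ms x t * μ.lam h ϕ t))
          - ∫ t in Ioc 0 T, (Real.exp (f t x) - 1) * (μ.ms x t * μ.lam h ϕ t)
          ≤ Real.exp (C + 1) * Λ * δ := by
        rw [← integral_sub]
        · refine (le_abs_self _).trans ((abs_integral_le_integral_abs).trans ?_)
          calc ∫ t in Ioc 0 T, |(Real.exp ((p x).eval t) - 1) * (μ.ms x t * μ.lam h ϕ t)
                - (Real.exp (f t x) - 1) * (μ.ms x t * μ.lam h ϕ t)|
              ≤ ∫ t in Ioc 0 T, Real.exp (C + 1) * Λ * |f t x - (p x).eval t| := by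
                refine integral_mono_of_nonneg (Eventually.of_forall fun t => abs_nonneg _)
                  ((hdi.mono_measure hle2).const_mul _) ?_
                filter_upwards [hmem] with t ht
                have e1 := abs_exp_sub_le ((le_abs_self _).trans (hp x t ht))
                  (((le_abs_self _).trans (hC t x)).trans (le_add_of_nonneg_right zero_le_one))
                have hl0 : 0 ≤ μ.lam h ϕ t := hc.le.trans (hlow μ t)
                rw [← sub_mul, sub_sub_sub_cancel_right, abs_mul, abs_mul, abs_of_nonneg hl0,
                  abs_of_nonneg (μ.ms_nonneg x t), abs_sub_comm (f t x)]
                have e2 : μ.ms x t * μ.lam h ϕ t ≤ 1 * Λ :=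
                  mul_le_mul (μ.ms_le_one x t) (hup μ t) hl0 zero_le_one
                calc _ ≤ (Real.exp (C + 1) * |(p x).eval t - f t x|) * (1 * Λ) :=
                      mul_le_mul e1 e2 (mul_nonneg (μ.ms_nonneg x t) hl0) (by positivity)
                  _ = _ := by ring
            _ = Real.exp (C + 1) * Λ * ∫ t in Ioc 0 T, |f t x - (p x).eval t| :=
                integral_const_mul _ _
            _ ≤ Real.exp (C + 1) * Λ * δ := by
                refine mul_le_mul_of_nonneg_left ?_ (by positivity)
                exact (integral_mono_measure hle2 (Eventually.of_forall fun t => abs_nonneg _)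
                  hdi).trans (hpδ x)
        · exact μ.integrable_mul_ms_lam hT hA measure_Ioc_lt_top.ne
            ((Real.measurable_exp.comp hpm).sub measurable_const).aestronglyMeasurable
            (by filter_upwards [hmem] with t ht using abs_exp_sub_one_le (hp x t ht)) x
        · exact μ.integrable_mul_ms_lam hT hA measure_Ioc_lt_top.ne
            ((Real.measurable_exp.comp (hf x)).sub measurable_const).aestronglyMeasurable
            (Eventually.of_forall fun t => abs_exp_sub_one_le (hC t x)) x
      rw [hL]
      linarith
    unfold cost at hpl ⊢
    refine (Finset.sum_le_sum fun x _ => hterm x).trans ?_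
    rw [Finset.sum_add_distrib, Finset.sum_const, Finset.card_range, nsmul_eq_mul]
    linarith
  refine le_of_forall_pos_le_add fun ε hε => ?_
  refine (key (ε / ((M + 1) * L)) (by positivity)).trans (add_le_add_right ?_ R)
  rw [mul_div_assoc', mul_div_assoc', div_le_iff₀ (by positivity)]
  nlinarith [mul_pos hε hL0]

end MFPath

/-! ### Paths of finite rate are continuous, and the rate function is lower semicontinuous -/

namespace MFPath

variable {T : ℝ} {α : ℝ≥0} {h ϕ : ℝ → ℝ} (μ : MFPath T) {ψ : ℝ → ℕ → ℝ}

/-- A quantitative bound on the mean: the test function `a 1_{(s,t]}` is admissible. -/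
lemma mul_meanFun_sub_le (hT : 0 < T) (hA : Assumptions T α h ϕ) {R Λ : ℝ}
    (hR : rateFunction h ϕ μ ≤ (R : EReal)) (hΛ : ∀ t, μ.lam h ϕ t ≤ Λ)
    (hl : ∀ t, 0 ≤ μ.lam h ϕ t) {a s t : ℝ} (ha : 0 ≤ a) (hs : 0 ≤ s) (hst : s ≤ t) (ht : t ≤ T) :
    a * (μ.meanFun t - μ.meanFun s) ≤ R + (Real.exp a - 1) * Λ * (t - s) := by
  have hea : 0 ≤ Real.exp a - 1 := sub_nonneg.2 (Real.one_le_exp ha)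
  have key : ∀ M, a * ∑ x ∈ Finset.range M, (μ.tl x t - μ.tl x s)
      ≤ R + (Real.exp a - 1) * Λ * (t - s) := by
    intro M
    have h1 := μ.cost_le hT hA hR (f := fun u _ => (Ioc s t).indicator (fun _ => a) u) (C := a)
      (fun x => measurable_const.indicator measurableSet_Ioc) (fun u x => by
        rw [← Real.norm_eq_abs]
        exact (norm_indicator_le_norm_self _ _).trans (by simp [abs_of_nonneg ha])) M
    have hsub : Ioc 0 T ∩ Ioc s t = Ioc s t :=
      inter_eq_right.2 (Ioc_subset_Ioc hs ht)
    have hfl : ∀ x, ∫ u in Ioc 0 T, (Ioc s t).indicator (fun _ => a) u ∂μ.flux hT x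
        = a * (μ.tl x t - μ.tl x s) := by
      intro x
      rw [setIntegral_indicator measurableSet_Ioc, hsub, setIntegral_const,
        μ.flux_real_Ioc hT x hst, smul_eq_mul, mul_comm]
    have hin : ∀ x, IntegrableOn (fun u => (Real.exp a - 1) * (μ.ms x u * μ.lam h ϕ u))
        (Ioc s t) := fun x =>
      μ.integrable_mul_ms_lam hT hA measure_Ioc_lt_top.ne aestronglyMeasurable_const
        (Eventually.of_forall fun _ => le_rfl) x
    have hex : ∀ x, ∫ u in Ioc 0 T, (Real.exp ((Ioc s t).indicator (fun _ => a) u) - 1)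
        * (μ.ms x u * μ.lam h ϕ u)
        = ∫ u in Ioc s t, (Real.exp a - 1) * (μ.ms x u * μ.lam h ϕ u) := by
      intro x
      have : ∀ u, (Real.exp ((Ioc s t).indicator (fun _ => a) u) - 1)
          * (μ.ms x u * μ.lam h ϕ u) = (Ioc s t).indicator
            (fun u => (Real.exp a - 1) * (μ.ms x u * μ.lam h ϕ u)) u := by
        intro u
        by_cases hu : u ∈ Ioc s t <;> simp [hu]
      simp_rw [this]
      rw [setIntegral_indicator measurableSet_Ioc, hsub]
    unfold cost at h1
    simp_rw [hfl, hex] at h1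
    rw [Finset.sum_sub_distrib, ← Finset.mul_sum, ← integral_finsetSum _ fun x _ => hin x] at h1
    have h2 : ∫ u in Ioc s t, ∑ x ∈ Finset.range M, (Real.exp a - 1) * (μ.ms x u * μ.lam h ϕ u)
        ≤ ∫ _ in Ioc s t, (Real.exp a - 1) * Λ := by
      refine integral_mono (integrable_finsetSum _ fun x _ => hin x) (integrable_const _) ?_
      intro u
      beta_reduce
      rw [← Finset.mul_sum, ← Finset.sum_mul]
      refine mul_le_mul_of_nonneg_left ?_ hea
      calc _ ≤ 1 * μ.lam h ϕ u := mul_le_mul_of_nonneg_right (μ.sum_ms_le_one M u) (hl u)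
        _ ≤ Λ := by rw [one_mul]; exact hΛ u
    rw [setIntegral_const, Real.volume_real_Ioc_of_le hst, smul_eq_mul] at h2
    linarith
  have hsum := (((μ.hasSum_tl hT t).sub (μ.hasSum_tl hT s)).mul_left a).tendsto_sum_nat
  refine le_of_tendsto' hsum fun M => ?_
  rw [← Finset.mul_sum]
  exact key M

/-- A path of finite rate has a uniformly continuous mean. -/
theorem exists_modulus (hT : 0 < T) (hA : Assumptions T α h ϕ) {R : ℝ}
    (hR : rateFunction h ϕ μ ≤ (R : EReal)) {κ : ℝ} (hκ : 0 < κ) :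
    ∃ d : ℝ, 0 < d ∧ ∀ s t, s ≤ t → t - s ≤ d → μ.meanFun t - μ.meanFun s ≤ κ := by
  obtain ⟨c, K, hc, hK, hlow, hup, -⟩ := hA.exists_lam_bounds hT
  set Λ := ϕ 0 + K * μ.meanFun T
  have hΛ0 : 0 < Λ := (hc.trans_le (hlow μ 0)).trans_le (hup μ 0)
  -- In `a * (m(t) - m(s)) ≤ R + (e^a - 1) Λ (t - s)`, this `a` makes `R` small against `a * κ`, and
  -- then the last term is at most `1` for `t - s` small.
  set a := 2 * (|R| + 1) / κ with ha
  have ha0 : 0 < a := by positivity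
  have hea : 0 < Real.exp a - 1 := sub_pos.2 (Real.one_lt_exp_iff.2 ha0)
  refine ⟨1 / ((Real.exp a - 1) * Λ), by positivity, fun s t hst hd => ?_⟩
  set p := max 0 (min s T)
  set q := max 0 (min t T)
  have hpq : p ≤ q := max_le_max le_rfl (min_le_min hst le_rfl)
  have hq := clamp_mem hT t
  have hqp : q - p ≤ t - s := by
    have h1 := abs_max_sub_max_le_max 0 (min t T) 0 (min s T)
    have h2 := abs_min_sub_min_le_max t T s T
    rw [sub_self, abs_zero, max_eq_right (abs_nonneg (min t T - min s T))] at h1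
    rw [sub_self, abs_zero, max_eq_left (abs_nonneg (t - s)),
      abs_of_nonneg (sub_nonneg.2 hst)] at h2
    exact (le_abs_self _).trans (h1.trans h2)
  have hm : ∀ r, μ.meanFun r = μ.meanFun (max 0 (min r T)) := by
    intro r
    have hr := clamp_mem hT r
    unfold meanFun
    rw [min_eq_left hr.2, max_eq_right hr.1]
  have h1 := μ.mul_meanFun_sub_le hT hA hR (hup μ) (fun t => hc.le.trans (hlow μ t)) ha0.le
    (le_max_left _ _ : 0 ≤ p) hpq hq.2
  rw [hm t, hm s]
  have h2 : (Real.exp a - 1) * Λ * (q - p) ≤ 1 := by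
    have := mul_le_mul_of_nonneg_left (hqp.trans hd) (by positivity : 0 ≤ (Real.exp a - 1) * Λ)
    rwa [mul_one_div_cancel (by positivity)] at this
  have h3 : a * (μ.meanFun q - μ.meanFun p) ≤ a * κ := by
    rw [ha, div_mul_cancel₀ _ hκ.ne', ← ha]
    linarith [le_abs_self R, abs_nonneg R]
  exact le_of_mul_le_mul_left h3 ha0

lemma continuous_tl_of_modulus (hT : 0 < T)
    (hm : ∀ κ : ℝ, 0 < κ →
      ∃ d : ℝ, 0 < d ∧ ∀ s t, s ≤ t → t - s ≤ d → μ.meanFun t - μ.meanFun s ≤ κ) (x : ℕ) :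
    Continuous (μ.tl x) := by
  have hle : ∀ s t, s ≤ t → μ.tl x t - μ.tl x s ≤ μ.meanFun t - μ.meanFun s := by
    intro s t hst
    have := (μ.hasSum_tl hT t).sub (μ.hasSum_tl hT s)
    exact le_hasSum this x fun y _ => sub_nonneg.2 (μ.tl_mono hT y hst)
  rw [Metric.continuous_iff]
  intro t κ hκ
  obtain ⟨d, hd, hm⟩ := hm (κ / 2) (half_pos hκ)
  refine ⟨d, hd, fun s hs => ?_⟩
  rw [Real.dist_eq] at hs ⊢
  have key : ∀ s t, s ≤ t → |s - t| < d → |μ.tl x s - μ.tl x t| < κ := by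
    intro s t hst hs
    rw [abs_sub_comm, abs_of_nonneg (sub_nonneg.2 hst)] at hs
    rw [abs_sub_comm, abs_of_nonneg (sub_nonneg.2 (μ.tl_mono hT x hst))]
    linarith [hm s t hst hs.le, hle s t hst]
  rcases le_total s t with h | h
  · exact key s t h hs
  · rw [abs_sub_comm] at hs ⊢
    exact key t s h hs

lemma W1_lawc_le (ν : MFPath T) (hT : 0 < T) (t : ℝ) :
    W1 (ν.lawc t) (μ.lawc t) ≤ ⨆ t ∈ Icc 0 T, W1 (ν.law t) (μ.law t) :=
  le_iSup₂ (f := fun t (_ : t ∈ Icc 0 T) => W1 (ν.law t) (μ.law t)) _ (clamp_mem hT t)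

variable {μs : ℕ → MFPath T}

lemma tendsto_tl (hT : 0 < T) (hμ : ConvergesTo μs μ) (x : ℕ) (t : ℝ) :
    Tendsto (fun n => (μs n).tl x t) atTop (𝓝 (μ.tl x t)) :=
  tendsto_of_ofReal_abs_le hμ (Eventually.of_forall fun n =>
    (ofReal_abs_tail_sub_le _ _ x).trans (μ.W1_lawc_le (μs n) hT t))

lemma tendsto_ms (hT : 0 < T) (hμ : ConvergesTo μs μ) (x : ℕ) (t : ℝ) :
    Tendsto (fun n => (μs n).ms x t) atTop (𝓝 (μ.ms x t)) := by
  cases x with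
  | zero =>
    simp_rw [ms_zero]
    exact (μ.tendsto_tl hT hμ 0 t).const_sub 1
  | succ y =>
    simp_rw [ms_succ]
    exact (μ.tendsto_tl hT hμ y t).sub (μ.tendsto_tl hT hμ (y + 1) t)

lemma tendsto_meanFun (hT : 0 < T) (hμ : ConvergesTo μs μ) (t : ℝ) :
    Tendsto (fun n => (μs n).meanFun t) atTop (𝓝 (μ.meanFun t)) :=
  tendsto_of_ofReal_abs_le hμ (Eventually.of_forall fun n =>
    (ofReal_abs_mean_sub_le ((μs n).finiteMean_lawc hT t) (μ.finiteMean_lawc hT t)).trans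
      (μ.W1_lawc_le (μs n) hT t))

lemma tendsto_lam (hT : 0 < T) (hA : Assumptions T α h ϕ) (hμ : ConvergesTo μs μ) (t : ℝ) :
    Tendsto (fun n => (μs n).lam h ϕ t) atTop (𝓝 (μ.lam h ϕ t)) := by
  obtain ⟨c, K, hc, hK, -, -, hLip⟩ := hA.exists_lam_bounds hT
  set D : ℕ → ℝ := fun n => (⨆ t ∈ Icc 0 T, W1 ((μs n).law t) (μ.law t)).toReal
  have hD : Tendsto D atTop (𝓝 0) := by
    have := (ENNReal.tendsto_toReal ENNReal.zero_ne_top).comp hμ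
    exact this
  have hlt : ∀ᶠ n in atTop, (⨆ t ∈ Icc 0 T, W1 ((μs n).law t) (μ.law t)) < 1 :=
    hμ.eventually_lt_const zero_lt_one
  rw [tendsto_iff_norm_sub_tendsto_zero]
  refine squeeze_zero' (Eventually.of_forall fun _ => norm_nonneg _) ?_
    (by simpa using hD.const_mul K)
  filter_upwards [hlt] with n hn
  refine hLip (μs n) μ t t (D n) fun u _ => ?_
  rw [← ENNReal.ofReal_le_iff_le_toReal (hn.trans ENNReal.one_lt_top).ne]
  exact (ofReal_abs_mean_sub_le ((μs n).finiteMean_lawc hT _) (μ.finiteMean_lawc hT _)).trans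
    (μ.W1_lawc_le (μs n) hT _)

lemma tendsto_integral_flux (hT : 0 < T)
    (hψ : ∀ x, ContDiffOn ℝ 1 (fun t => ψ t x) (Icc 0 T)) (hμ : ConvergesTo μs μ) (x y : ℕ) :
    Tendsto (fun n => ∫ u in Ioc 0 T, ψ u y ∂(μs n).flux hT x) atTop
      (𝓝 (∫ u in Ioc 0 T, ψ u y ∂μ.flux hT x)) := by
  have hTm : T ∈ Icc 0 T := right_mem_Icc.2 hT.le
  have h1 := fun ν : MFPath T => ν.integral_flux_by_parts hT hψ x y hTm
  simp_rw [h1]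
  refine ((μ.tendsto_tl hT hμ x T).const_mul _).sub ?_
  have hi := intervalIntegrable_timeDeriv hT hψ y hTm
  refine intervalIntegral.tendsto_integral_filter_of_dominated_convergence
    (fun s => |timeDeriv T ψ s y|) (Eventually.of_forall fun n => ?_)
    (Eventually.of_forall fun n => Eventually.of_forall fun s _ => ?_) hi.abs
    (Eventually.of_forall fun s _ => (μ.tendsto_tl hT hμ x s).const_mul _)
  · exact (intervalIntegrable_iff.1 hi).aestronglyMeasurable.mul
      ((μs n).measurable_tl hT x).aestronglyMeasurable
  · rw [norm_mul, Real.norm_eq_abs]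
    exact mul_le_of_le_one_right (abs_nonneg _) ((μs n).abs_tl_le_one x s)

lemma tendsto_cost_of_convergesTo (hT : 0 < T) (hA : Assumptions T α h ϕ)
    (hψ : ∀ x, ContDiffOn ℝ 1 (fun t => ψ t x) (Icc 0 T)) (hμ : ConvergesTo μs μ) (M : ℕ) :
    Tendsto (fun n => (μs n).cost hT h ϕ (jump ψ) M) atTop (𝓝 (μ.cost hT h ϕ (jump ψ) M)) := by
  obtain ⟨c, K, hc, hK, hlow, hup, -⟩ := hA.exists_lam_bounds hT
  refine tendsto_finsetSum _ fun x _ => Tendsto.sub ?_ ?_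
  · have hci : ∀ (ν : MFPath T) (y : ℕ),
        IntegrableOn (fun u => ψ u y) (Ioc 0 T) (ν.flux hT x) := fun ν y =>
      ((hψ y).continuousOn.integrableOn_compact isCompact_Icc).mono_set Ioc_subset_Icc_self
    have h1 := fun ν : MFPath T => integral_sub (hci ν (x + 1)) (hci ν x)
    unfold jump
    simp_rw [h1]
    exact (μ.tendsto_integral_flux hT hψ hμ x _).sub (μ.tendsto_integral_flux hT hψ hμ x _)
  · have hjc : ContinuousOn (fun t => Real.exp (jump ψ t x) - 1) (Icc 0 T) :=
      (Real.continuous_exp.comp_continuousOn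
        ((hψ (x + 1)).continuousOn.sub (hψ x).continuousOn)).sub continuousOn_const
    obtain ⟨D, hD⟩ := isCompact_Icc.exists_bound_of_continuousOn hjc
    have hm1 : ∀ᶠ n in atTop, (μs n).meanFun T ≤ μ.meanFun T + 1 :=
      (μ.tendsto_meanFun hT hμ T).eventually_le_const (by linarith)
    have haes := (hjc.mono Ioc_subset_Icc_self).aestronglyMeasurable (μ := volume)
      measurableSet_Ioc
    refine tendsto_integral_filter_of_dominated_convergence
      (fun _ => D * (1 * (ϕ 0 + K * (μ.meanFun T + 1)))) (Eventually.of_forall fun n => ?_) ?_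
      (integrable_const _) (Eventually.of_forall fun t => ?_)
    · exact haes.mul
        (((μs n).measurable_ms hT x).mul ((μs n).measurable_lam hA hT)).aestronglyMeasurable
    · filter_upwards [hm1] with n hn
      filter_upwards [ae_restrict_mem measurableSet_Ioc] with t ht
      have h1 := hD t (Ioc_subset_Icc_self ht)
      rw [norm_mul, norm_mul]
      refine mul_le_mul h1 (mul_le_mul ((μs n).abs_ms_le_one x t) ?_ (norm_nonneg _) zero_le_one)
        (by positivity) ((norm_nonneg _).trans h1)
      rw [Real.norm_eq_abs, abs_of_pos (hc.trans_le (hlow _ t))]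
      have := mul_le_mul_of_nonneg_left hn hK
      linarith [hup (μs n) t]
    · exact ((μ.tendsto_ms hT hμ x t).mul (μ.tendsto_lam hT hA hμ t)).const_mul _

/-- Lower semicontinuity of the rate function.  A nearly optimal test function is frozen beyond a
large state `M`, which turns `J` into a finite sum over the states and makes the test function
admissible for every path. -/
theorem eventually_lt_rateFunction (hT : 0 < T) (hA : Assumptions T α h ϕ)
    (hμ : ConvergesTo μs μ) {r : EReal} (hr : r < rateFunction h ϕ μ) :
    ∀ᶠ n in atTop, r < rateFunction h ϕ (μs n) := by
  obtain ⟨ψ, hψ⟩ := lt_iSup_iff.1 hr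
  obtain ⟨⟨hb, hd⟩, hlt⟩ := lt_iSup_iff.1 hψ
  have h1 := continuous_coe_real_ereal.continuousAt.tendsto.comp (μ.tendsto_cost hT hA hb hd)
  obtain ⟨M, hM⟩ := (h1.eventually_const_lt hlt).exists
  have h2 := continuous_coe_real_ereal.continuousAt.tendsto.comp
    (μ.tendsto_cost_of_convergesTo hT hA hb.1 hμ M)
  filter_upwards [h2.eventually_const_lt hM] with n hn
  obtain ⟨m1, m2, m3⟩ := (μs n).J_min_eq_cost hT hA hb.1 M
  refine hn.trans_le ?_
  simp only [Function.comp]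
  rw [← m3]
  exact le_iSup₂ (f := fun ψ (_ : ψ ∈ {ψ | ψ ∈ C1b T ∧ DerivIntegrable (μs n) ψ}) =>
    (J h ϕ (μs n) ψ : EReal)) _ ⟨m1, m2⟩

end MFPath

/-! ### The perturbed mean-field equation in terms of tails -/

namespace MFPath

variable {T : ℝ} {α : ℝ≥0} {h ϕ : ℝ → ℝ} (μ ν : MFPath T)

lemma flux_restrict_eq (hT : 0 < T) {x : ℕ} {g : ℝ → ℝ} (hg0 : ∀ s ∈ Ioc 0 T, 0 ≤ g s)
    (hgi : IntegrableOn g (Ioc 0 T))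
    (htl : ∀ t ∈ Icc 0 T, μ.tl x t = ∫ s in Ioc 0 t, g s) {t : ℝ} (ht : t ∈ Icc 0 T) :
    (μ.flux hT x).restrict (Ioc 0 t)
      = (volume.restrict (Ioc 0 t)).withDensity fun s => ENNReal.ofReal (g s) := by
  have hint : ∀ a b : ℝ, 0 ≤ a → b ≤ T → IntegrableOn g (Ioc a b) := fun a b ha hb =>
    hgi.mono_set (Ioc_subset_Ioc ha hb)
  refine Measure.ext_of_Ioc' _ _ (fun a b _ => measure_ne_top _ _) fun a b hab => ?_
  rw [Measure.restrict_apply measurableSet_Ioc, withDensity_apply _ measurableSet_Ioc,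
    Measure.restrict_restrict measurableSet_Ioc, Ioc_inter_Ioc, flux_Ioc]
  set p := max a 0
  set q := min b t
  have hp : 0 ≤ p := le_max_right _ _
  have hq : q ≤ T := (min_le_right _ _).trans ht.2
  rcases le_or_gt q p with hqp | hpq
  · rw [Ioc_eq_empty (not_lt.2 hqp), Measure.restrict_empty, lintegral_zero_measure,
      ENNReal.ofReal_eq_zero]
    exact sub_nonpos.2 (μ.tl_mono hT x hqp)
  · rw [← ofReal_integral_eq_lintegral_ofReal (hint p q hp hq)]
    · congr 1
      rw [htl q ⟨hp.trans hpq.le, hq⟩, htl p ⟨hp, hpq.le.trans hq⟩,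
        ← Ioc_union_Ioc_eq_Ioc hp hpq.le, setIntegral_union (Ioc_disjoint_Ioc_of_le le_rfl)
          measurableSet_Ioc (hint 0 p le_rfl (hpq.le.trans hq)) (hint p q hp hq)]
      ring
    · filter_upwards [ae_restrict_mem measurableSet_Ioc] with s hs
      exact hg0 s ⟨hp.trans_lt hs.1, hs.2.trans hq⟩

lemma integral_flux_eq (hT : 0 < T) {x : ℕ} {g : ℝ → ℝ} (hgm : Measurable g)
    (hg0 : ∀ s ∈ Ioc 0 T, 0 ≤ g s) (hgi : IntegrableOn g (Ioc 0 T))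
    (htl : ∀ t ∈ Icc 0 T, μ.tl x t = ∫ s in Ioc 0 t, g s) {t : ℝ} (ht : t ∈ Icc 0 T)
    (f : ℝ → ℝ) : ∫ s in Ioc 0 t, f s ∂μ.flux hT x = ∫ s in Ioc 0 t, f s * g s := by
  rw [μ.flux_restrict_eq hT hg0 hgi htl ht,
    integral_withDensity_eq_integral_toReal_smul hgm.ennreal_ofReal
      (Eventually.of_forall fun _ => ENNReal.ofReal_lt_top)]
  refine setIntegral_congr_fun measurableSet_Ioc fun s hs => ?_
  rw [ENNReal.toReal_ofReal (hg0 s ⟨hs.1, hs.2.trans ht.2⟩), smul_eq_mul, mul_comm]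

/-- The perturbed equation tested against the indicators of the sets `(x, ∞)`. -/
lemma tl_eq_of_solvesPerturbed (hT : 0 < T) (hA : Assumptions T α h ϕ) {φ : ℝ → ℕ → ℝ}
    (hμ : SolvesPerturbed h ϕ φ μ) (x : ℕ) {t : ℝ} (ht : t ∈ Icc 0 T) :
    μ.tl x t = ∫ s in Ioc 0 t, Real.exp (φ s x) * (μ.ms x s * μ.lam h ϕ s) := by
  set ψ : ℝ → ℕ → ℝ := fun _ y => (Ioi x).indicator (fun _ => 1) y with hψ
  have htd : timeDeriv T ψ = fun _ _ => 0 := by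
    ext s y
    simp [timeDeriv, hψ]
  have hj : ∀ s y, jump ψ s y = ({x} : Set ℕ).indicator (fun _ => 1) y := by
    intro s y
    simp only [jump, hψ, indicator_apply, mem_Ioi, mem_singleton_iff]
    rcases lt_trichotomy y x with h | h | h
    · rw [if_neg (by omega), if_neg (by omega), if_neg (by omega)]; simp
    · rw [if_pos (by omega), if_neg (by omega), if_pos h]; simp
    · rw [if_pos (by omega), if_pos h, if_neg (by omega)]; simp
  have h1 := hμ ψ ⟨fun y => contDiffOn_const, 1, fun s _ y => by
    rw [hj, ← Real.norm_eq_abs]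
    exact (norm_indicator_le_norm_self _ _).trans (by simp)⟩
    (by simp [DerivIntegrable, htd]) t ht
  have h2 : ∫ y, ψ t y ∂(μ.law t : Measure ℕ) = μ.tl x t := by
    rw [← μ.lawc_eq ht, hψ, integral_indicator measurableSet_Ioi]
    simp [tl, tail]
  have h3 : ψ 0 0 = 0 := by simp [hψ]
  rw [h2, h3, htd] at h1
  simp only [integral_zero, intervalIntegral.integral_zero, zero_add] at h1
  rw [h1, intervalIntegral.integral_of_le ht.1]
  refine setIntegral_congr_fun measurableSet_Ioc fun s hs => ?_
  have hs' : s ∈ Icc 0 T := ⟨hs.1.le, hs.2.trans ht.2⟩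
  rw [μ.intensity_eq hT hA hs']
  have h4 : ∀ y, jump ψ s y * Real.exp (φ s y)
      = ({x} : Set ℕ).indicator (fun _ => Real.exp (φ s x)) y := by
    intro y
    rw [hj]
    by_cases hy : y = x
    · simp [hy]
    · simp [hy]
  simp_rw [h4]
  rw [integral_indicator (measurableSet_singleton x), setIntegral_const,
    μ.measure_singleton_eq hs', smul_eq_mul]
  ring

lemma integrableOn_exp_mul (hT : 0 < T) (hA : Assumptions T α h ϕ) {φ : ℝ → ℕ → ℝ} {C : ℝ}
    (hφ : Measurable (Function.uncurry φ)) (hC : ∀ t ∈ Icc 0 T, ∀ x, |φ t x| ≤ C) (x : ℕ) :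
    IntegrableOn (fun s => Real.exp (φ s x) * (μ.ms x s * μ.lam h ϕ s)) (Ioc 0 T) := by
  refine μ.integrable_mul_ms_lam hT hA measure_Ioc_lt_top.ne
    (C := Real.exp C) (Real.measurable_exp.comp
      (hφ.comp measurable_prodMk_right)).aestronglyMeasurable ?_ x
  filter_upwards [ae_restrict_mem measurableSet_Ioc] with s hs
  change |Real.exp (φ s x)| ≤ _
  rw [Real.abs_exp]
  exact Real.exp_le_exp.2 ((le_abs_self _).trans (hC s (Ioc_subset_Icc_self hs) x))

lemma solvesPerturbed_of_tl_eq (hT : 0 < T) (hA : Assumptions T α h ϕ) {φ : ℝ → ℕ → ℝ} {C : ℝ}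
    (hφ : Measurable (Function.uncurry φ)) (hC : ∀ t ∈ Icc 0 T, ∀ x, |φ t x| ≤ C)
    (htl : ∀ x, ∀ t ∈ Icc 0 T,
      μ.tl x t = ∫ s in Ioc 0 t, Real.exp (φ s x) * (μ.ms x s * μ.lam h ϕ s)) :
    SolvesPerturbed h ϕ φ μ := by
  intro ψ hψ hd t ht
  obtain ⟨c, K, hc, hK, hlow, hup, -⟩ := hA.exists_lam_bounds hT
  have hφx : ∀ x, Measurable fun s => φ s x := fun x => hφ.comp measurable_prodMk_right
  obtain ⟨D, hD⟩ := hψ.2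
  have h1 := μ.tendsto_sum_integral_flux hT hψ hd ht
  have hsub : Ioc 0 t ⊆ Icc 0 T := fun s hs => ⟨hs.1.le, hs.2.trans ht.2⟩
  have h2 := μ.tendsto_sum_integral_ms_lam hT hA ht
    (g := fun s x => jump ψ s x * Real.exp (φ s x)) (D := D * Real.exp C)
    (fun x => ((((hψ.1 (x + 1)).continuousOn.sub (hψ.1 x).continuousOn).mono
      hsub).aestronglyMeasurable measurableSet_Ioc).mul
        (Real.measurable_exp.comp (hφx x)).aestronglyMeasurable)
    (fun s hs x => by
      have h3 := hD s (hsub hs) x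
      rw [abs_mul, Real.abs_exp]
      exact mul_le_mul h3 (Real.exp_le_exp.2 ((le_abs_self _).trans (hC s (hsub hs) x)))
        (Real.exp_pos _).le ((abs_nonneg _).trans h3))
  have h3 := tendsto_nhds_unique (h1.congr fun M => ?_) h2
  · linarith
  · refine Finset.sum_congr rfl fun x _ => ?_
    rw [μ.integral_flux_eq hT (g := fun s => Real.exp (φ s x) * (μ.ms x s * μ.lam h ϕ s))
      ((Real.measurable_exp.comp (hφx x)).mul
      ((μ.measurable_ms hT x).mul (μ.measurable_lam hA hT)))
      (fun s _ => mul_nonneg (Real.exp_pos _).le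
        (mul_nonneg (μ.ms_nonneg x s) (hc.le.trans (hlow μ s))))
      (μ.integrableOn_exp_mul hT hA hφ hC x) (fun t ht => htl x t ht) ht]
    simp only [mul_assoc]

lemma sum_abs_ms_sub_le (M : ℕ) (t : ℝ) :
    ∑ x ∈ Finset.range M, |μ.ms x t - ν.ms x t|
      ≤ 2 * ∑ x ∈ Finset.range M, |μ.tl x t - ν.tl x t| := by
  have h : ∀ M, ∑ x ∈ Finset.range M, |μ.ms x t - ν.ms x t|
      + ∑ x ∈ (Finset.range M).filter (· + 1 = M), |μ.tl x t - ν.tl x t|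
      ≤ 2 * ∑ x ∈ Finset.range M, |μ.tl x t - ν.tl x t| := by
    intro M
    induction M with
    | zero => simp
    | succ n ih =>
      have e1 : (Finset.range (n + 1)).filter (· + 1 = n + 1) = {n} := by
        ext y
        simp
      rw [e1, Finset.sum_singleton, Finset.sum_range_succ, Finset.sum_range_succ _ n]
      cases n with
      | zero =>
        simp only [Finset.range_zero, Finset.sum_empty, zero_add, ms_zero]
        rw [sub_sub_sub_cancel_left, abs_sub_comm]
        linarith
      | succ k =>
        have e2 : (Finset.range (k + 1)).filter (· + 1 = k + 1) = {k} := by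
          ext y
          simp
        rw [e2, Finset.sum_singleton] at ih
        rw [ms_succ, ms_succ]
        have h3 : |μ.tl k t - μ.tl (k + 1) t - (ν.tl k t - ν.tl (k + 1) t)|
            ≤ |μ.tl k t - ν.tl k t| + |μ.tl (k + 1) t - ν.tl (k + 1) t| := by
          rw [sub_sub_sub_comm]
          exact abs_sub _ _
        linarith
  refine le_trans ?_ (h M)
  exact le_add_of_nonneg_right (Finset.sum_nonneg fun _ _ => abs_nonneg _)

/-- Uniqueness for the perturbed equation: the distance `∑ₓ |μ_t((x,∞)) - ν_t((x,∞))|` satisfies a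
Gronwall inequality, because the intensity is Lipschitz in the past of the mean. -/
theorem tl_unique (hT : 0 < T) (hA : Assumptions T α h ϕ) {φ : ℝ → ℕ → ℝ} {C : ℝ}
    (hφ : Measurable (Function.uncurry φ)) (hC : ∀ t ∈ Icc 0 T, ∀ x, |φ t x| ≤ C)
    (hμ : ∀ x, ∀ t ∈ Icc 0 T,
      μ.tl x t = ∫ s in Ioc 0 t, Real.exp (φ s x) * (μ.ms x s * μ.lam h ϕ s))
    (hν : ∀ x, ∀ t ∈ Icc 0 T,
      ν.tl x t = ∫ s in Ioc 0 t, Real.exp (φ s x) * (ν.ms x s * ν.lam h ϕ s))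
    (x : ℕ) {t : ℝ} (ht : t ∈ Icc 0 T) : μ.tl x t = ν.tl x t := by
  obtain ⟨c, K, hc, hK, hlow, hup, hLip⟩ := hA.exists_lam_bounds hT
  set Λ := ϕ 0 + K * μ.meanFun T
  have hΛ0 : 0 ≤ Λ := (hc.le.trans (hlow μ 0)).trans (hup μ 0)
  set B := μ.meanFun T + ν.meanFun T
  have hB : 0 ≤ B := add_nonneg (μ.meanFun_nonneg _) (ν.meanFun_nonneg _)
  set L := Real.exp C * (2 * Λ + K) with hL
  have hL0 : 0 ≤ L := by positivity
  have hsub : ∀ {t : ℝ}, t ∈ Icc 0 T → Ioc 0 t ⊆ Ioc 0 T := fun ht =>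
    Ioc_subset_Ioc_right ht.2
  -- The `k`-th iterate of the Gronwall inequality.
  have key : ∀ k : ℕ, ∀ t ∈ Icc 0 T, ∀ M,
      ∑ x ∈ Finset.range M, |μ.tl x t - ν.tl x t| ≤ B * (L * t) ^ k / k.factorial := by
    intro k
    induction k with
    | zero =>
      intro t _ M
      simp only [pow_zero, mul_one, Nat.factorial_zero, Nat.cast_one, div_one]
      calc _ ≤ ∑ x ∈ Finset.range M, (μ.tl x t + ν.tl x t) := by
            refine Finset.sum_le_sum fun x _ => (abs_sub _ _).trans ?_
            rw [abs_of_nonneg (μ.tl_nonneg x t), abs_of_nonneg (ν.tl_nonneg x t)]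
        _ ≤ B := by
            rw [Finset.sum_add_distrib]
            exact add_le_add ((μ.sum_tl_le hT M t).trans (μ.meanFun_le hT t))
              ((ν.sum_tl_le hT M t).trans (ν.meanFun_le hT t))
    | succ k ih =>
      intro t ht M
      have hmean : ∀ r ≤ t, |μ.meanFun r - ν.meanFun r|
          ≤ B * (L * max r 0) ^ k / k.factorial := by
        intro r hr
        rcases le_total r 0 with h0 | h0
        · rw [μ.meanFun_of_nonpos hT h0, ν.meanFun_of_nonpos hT h0, sub_self, abs_zero]
          positivity
        · rw [max_eq_left h0]
          have hlim := ((μ.hasSum_tl hT r).sub (ν.hasSum_tl hT r)).tendsto_sum_nat.abs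
          refine le_of_tendsto' hlim fun M => ?_
          exact (Finset.abs_sum_le_sum_abs _ _).trans (ih r ⟨h0, hr.trans ht.2⟩ M)
      set G : ℕ → ℝ → ℝ := fun x s => Real.exp (φ s x) * (μ.ms x s * μ.lam h ϕ s)
        - Real.exp (φ s x) * (ν.ms x s * ν.lam h ϕ s) with hG
      have hi1 := fun x => (μ.integrableOn_exp_mul hT hA hφ hC x).mono_set (hsub ht)
      have hi2 := fun x => (ν.integrableOn_exp_mul hT hA hφ hC x).mono_set (hsub ht)
      have hGi : ∀ x, IntegrableOn (G x) (Ioc 0 t) := fun x => (hi1 x).sub (hi2 x)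
      have hpt : ∀ s ∈ Ioc 0 t, ∑ x ∈ Finset.range M, |G x s|
          ≤ L * (B * (L * s) ^ k / k.factorial) := by
        intro s hs
        have hs' : s ∈ Icc 0 T := ⟨hs.1.le, hs.2.trans ht.2⟩
        set b := B * (L * s) ^ k / k.factorial
        have hlam : |μ.lam h ϕ s - ν.lam h ϕ s| ≤ K * b := by
          refine hLip μ ν s s _ fun u hu => ?_
          refine (hmean (s - u) (by linarith [hu.1, hs.2])).trans ?_
          have h1 : max (s - u) 0 ≤ s := max_le (by linarith [hu.1]) hs.1.le
          have h2 : 0 ≤ max (s - u) 0 := le_max_right _ _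
          change B * (L * max (s - u) 0) ^ k / k.factorial ≤ B * (L * s) ^ k / k.factorial
          gcongr
        have hterm : ∀ x, |G x s| ≤ Real.exp C * (Λ * |μ.ms x s - ν.ms x s|
            + ν.ms x s * (K * b)) := by
          intro x
          have e1 : G x s = Real.exp (φ s x) * ((μ.ms x s - ν.ms x s) * μ.lam h ϕ s
              + ν.ms x s * (μ.lam h ϕ s - ν.lam h ϕ s)) := by
            simp only [hG]; ring
          rw [e1, abs_mul, Real.abs_exp]
          refine mul_le_mul (Real.exp_le_exp.2 ((le_abs_self _).trans (hC s hs' x))) ?_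
            (abs_nonneg _) (Real.exp_pos _).le
          refine (abs_add_le _ _).trans (add_le_add ?_ ?_)
          · rw [abs_mul, mul_comm, abs_of_nonneg (hc.le.trans (hlow μ s))]
            exact mul_le_mul_of_nonneg_right (hup μ s) (abs_nonneg _)
          · rw [abs_mul, abs_of_nonneg (ν.ms_nonneg x s)]
            exact mul_le_mul_of_nonneg_left hlam (ν.ms_nonneg x s)
        have hKb : 0 ≤ K * b := (abs_nonneg _).trans hlam
        calc ∑ x ∈ Finset.range M, |G x s|
            ≤ ∑ x ∈ Finset.range M, Real.exp C * (Λ * |μ.ms x s - ν.ms x s|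
              + ν.ms x s * (K * b)) := Finset.sum_le_sum fun x _ => hterm x
          _ = Real.exp C * (Λ * ∑ x ∈ Finset.range M, |μ.ms x s - ν.ms x s|
              + (∑ x ∈ Finset.range M, ν.ms x s) * (K * b)) := by
              rw [← Finset.mul_sum, Finset.sum_add_distrib, ← Finset.mul_sum, Finset.sum_mul]
          _ ≤ Real.exp C * (Λ * (2 * b) + 1 * (K * b)) := by
              refine mul_le_mul_of_nonneg_left (add_le_add ?_ ?_) (Real.exp_pos _).le
              · refine mul_le_mul_of_nonneg_left ?_ hΛ0
                refine (μ.sum_abs_ms_sub_le ν M s).trans ?_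
                exact mul_le_mul_of_nonneg_left (ih s hs' M) two_pos.le
              · exact mul_le_mul_of_nonneg_right (ν.sum_ms_le_one M s) hKb
          _ = L * b := by rw [hL]; ring
      calc ∑ x ∈ Finset.range M, |μ.tl x t - ν.tl x t|
          = ∑ x ∈ Finset.range M, |∫ s in Ioc 0 t, G x s| := by
            refine Finset.sum_congr rfl fun x _ => ?_
            rw [hμ x t ht, hν x t ht, ← integral_sub (hi1 x) (hi2 x)]
        _ ≤ ∑ x ∈ Finset.range M, ∫ s in Ioc 0 t, |G x s| :=
            Finset.sum_le_sum fun x _ => abs_integral_le_integral_abs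
        _ = ∫ s in Ioc 0 t, ∑ x ∈ Finset.range M, |G x s| :=
            (integral_finsetSum _ fun x _ => (hGi x).abs).symm
        _ ≤ ∫ s in Ioc 0 t, L * (B * (L * s) ^ k / k.factorial) := by
            refine setIntegral_mono_on (integrable_finsetSum _ fun x _ => (hGi x).abs) ?_
              measurableSet_Ioc hpt
            exact (Continuous.integrableOn_Icc (by fun_prop)).mono_set Ioc_subset_Icc_self
        _ = B * (L * t) ^ (k + 1) / (k + 1).factorial := by
            rw [← intervalIntegral.integral_of_le ht.1]
            have e1 : ∀ s : ℝ, L * (B * (L * s) ^ k / k.factorial)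
                = (L * B * L ^ k / k.factorial) * s ^ k := by
              intro s
              rw [mul_pow]
              ring
            simp_rw [e1]
            rw [intervalIntegral.integral_const_mul, integral_pow, Nat.factorial_succ]
            push_cast
            have : (k.factorial : ℝ) ≠ 0 := by positivity
            field_simp
            ring_nf
  have hlim : Tendsto (fun k : ℕ => B * (L * t) ^ k / k.factorial) atTop (𝓝 0) := by
    have := (FloorSemiring.tendsto_pow_div_factorial_atTop (L * t)).const_mul B
    simpa [mul_div_assoc] using this
  have h0 : |μ.tl x t - ν.tl x t| ≤ 0 := by
    refine ge_of_tendsto' hlim fun k => ?_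
    refine le_trans ?_ (key k t ht (x + 1))
    exact Finset.single_le_sum (f := fun x => |μ.tl x t - ν.tl x t|) (fun _ _ => abs_nonneg _)
      (Finset.self_mem_range_succ x)
  exact sub_eq_zero.1 (abs_eq_zero.1 (le_antisymm h0 (abs_nonneg _)))

lemma law_eq_of_tl_eq {t : ℝ} (ht : t ∈ Icc 0 T) (htl : ∀ x, μ.tl x t = ν.tl x t) :
    μ.law t = ν.law t := by
  refine Subtype.ext (eq_of_tail (ν := (μ.law t : Measure ℕ)) (μ := (ν.law t : Measure ℕ))
    fun x => ?_)
  have := htl x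
  simp only [tl, lawc_eq _ ht] at this
  rw [← ofReal_tail, ← ofReal_tail, this]

/-- A path with flux densities `g` comparable with its masses is a perturbed mean field. -/
theorem exists_isPerturbedMeanField (hT : 0 < T) (hA : Assumptions T α h ϕ) {g : ℕ → ℝ → ℝ}
    (hgm : ∀ x, Measurable (g x))
    (htl : ∀ x, ∀ t ∈ Icc 0 T, μ.tl x t = ∫ s in Ioc 0 t, g x s) {A : ℝ} (hA0 : 0 < A)
    (hpos : ∀ t ∈ Ioc 0 T, ∀ x, 0 < μ.ms x t) (hgA : ∀ t ∈ Ioc 0 T, ∀ x, g x t ≤ A * μ.ms x t)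
    (hAg : ∀ t ∈ Ioc 0 T, ∀ x, μ.ms x t ≤ A * g x t) :
    ∃ φ : ℝ → ℕ → ℝ, Measurable (Function.uncurry φ) ∧
      (∃ C : ℝ, ∀ t ∈ Icc 0 T, ∀ x, |φ t x| ≤ C) ∧ IsPerturbedMeanField h ϕ φ μ := by
  obtain ⟨c, K, hc, hK, hlow, hup, -⟩ := hA.exists_lam_bounds hT
  set Λ := ϕ 0 + K * μ.meanFun T
  have hΛ0 : 0 < Λ := (hc.trans_le (hlow μ 0)).trans_le (hup μ 0)
  -- The perturbation is dictated by `g = e^φ μ_t({x}) λ_μ(t)`, and is bounded by comparability.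
  set C := max (Real.log (A / c)) (Real.log (A * Λ))
  set φ : ℝ → ℕ → ℝ := fun t x =>
    (Ioc 0 T).indicator (fun t => Real.log (g x t / (μ.ms x t * μ.lam h ϕ t))) t with hφ
  have hgpos : ∀ t ∈ Ioc 0 T, ∀ x, 0 < g x t := fun t ht x =>
    pos_of_mul_pos_right ((hpos t ht x).trans_le (hAg t ht x)) hA0.le
  have hφm : Measurable (Function.uncurry φ) := measurable_from_prod_countable_left fun x =>
    (Real.measurable_log.comp ((hgm x).div
      ((μ.measurable_ms hT x).mul (μ.measurable_lam hA hT)))).indicator measurableSet_Ioc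
  have hlog : ∀ t ∈ Ioc 0 T, ∀ x,
      |Real.log (g x t / (μ.ms x t * μ.lam h ϕ t))| ≤ C := by
    intro t ht x
    have hl := hc.trans_le (hlow μ t)
    have hm := hpos t ht x
    have hg := hgpos t ht x
    rw [abs_le']
    constructor
    · refine le_trans (Real.log_le_log (by positivity) ?_) (le_max_left _ _)
      rw [div_le_div_iff₀ (by positivity) hc]
      calc g x t * c ≤ (A * μ.ms x t) * μ.lam h ϕ t :=
            mul_le_mul (hgA t ht x) (hlow μ t) hc.le (by positivity)
        _ = _ := by ring
    · rw [← Real.log_inv, inv_div]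
      refine le_trans (Real.log_le_log (by positivity) ?_) (le_max_right _ _)
      rw [div_le_iff₀ hg]
      calc μ.ms x t * μ.lam h ϕ t ≤ (A * g x t) * Λ :=
            mul_le_mul (hAg t ht x) (hup μ t) hl.le (by positivity)
        _ = _ := by ring
  have hC : ∀ t ∈ Icc 0 T, ∀ x, |φ t x| ≤ max C 0 := by
    intro t _ x
    by_cases ht : t ∈ Ioc 0 T
    · simp only [hφ, indicator_of_mem ht]
      exact (hlog t ht x).trans (le_max_left _ _)
    · simp only [hφ, indicator_of_notMem ht, abs_zero]
      exact le_max_right _ _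
  have heq : ∀ x, ∀ t ∈ Icc 0 T,
      μ.tl x t = ∫ s in Ioc 0 t, Real.exp (φ s x) * (μ.ms x s * μ.lam h ϕ s) := by
    intro x t ht
    rw [htl x t ht]
    refine setIntegral_congr_fun measurableSet_Ioc fun s hs => ?_
    have hs' : s ∈ Ioc 0 T := ⟨hs.1, hs.2.trans ht.2⟩
    have hl := hc.trans_le (hlow μ s)
    have hm := hpos s hs' x
    simp only [hφ, indicator_of_mem hs']
    rw [Real.exp_log (div_pos (hgpos s hs' x) (mul_pos hm hl)),
      div_mul_cancel₀ _ (mul_pos hm hl).ne']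
  refine ⟨φ, hφm, ⟨_, hC⟩, μ.solvesPerturbed_of_tl_eq hT hA hφm hC heq, fun ν hν t ht => ?_⟩
  exact ν.law_eq_of_tl_eq μ ht fun x => ν.tl_unique μ hT hA hφm hC
    (fun x t ht => ν.tl_eq_of_solvesPerturbed hT hA hν x ht) heq x ht

end MFPath

/-! ### Paths from their tails -/

/-- Conditions under which `g x t` is the tail `μ_t((x,∞))` of a continuous path in `M[0,T]`. -/
structure TailData (T : ℝ) (g : ℕ → ℝ → ℝ) : Prop where
  antitone : ∀ t ∈ Icc 0 T, Antitone fun x => g x t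
  le_one : ∀ t ∈ Icc 0 T, ∀ x, g x t ≤ 1
  mono : ∀ x, MonotoneOn (g x) (Icc 0 T)
  cont : ∀ x, ContinuousOn (g x) (Icc 0 T)
  zero : ∀ x, g x 0 = 0
  summable : Summable fun x => g x T

namespace TailData

variable {T : ℝ} {g : ℕ → ℝ → ℝ} (D : TailData T g)
include D

lemma nonneg {t : ℝ} (ht : t ∈ Icc 0 T) (x : ℕ) : 0 ≤ g x t :=
  (D.zero x).symm.le.trans (D.mono x ⟨le_rfl, ht.1.trans ht.2⟩ ht ht.1)

lemma le_final {t : ℝ} (ht : t ∈ Icc 0 T) (x : ℕ) : g x t ≤ g x T :=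
  D.mono x ht ⟨ht.1.trans ht.2, le_rfl⟩ ht.2

lemma summable_at {t : ℝ} (ht : t ∈ Icc 0 T) : Summable fun x => g x t :=
  D.summable.of_nonneg_of_le (D.nonneg ht) (D.le_final ht)

end TailData

/-- The law at time `t` of the path with tails `g`. -/
def TailData.law {T : ℝ} {g : ℕ → ℝ → ℝ} (D : TailData T g) (hT : 0 < T) (t : ℝ) :
    ProbabilityMeasure ℕ :=
  ofTail (fun x => g x (max 0 (min t T))) (D.antitone _ (MFPath.clamp_mem hT t))
    (D.summable_at (MFPath.clamp_mem hT t)).tendsto_atTop_zero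

lemma TailData.tail_law {T : ℝ} {g : ℕ → ℝ → ℝ} (D : TailData T g) (hT : 0 < T) (x : ℕ) (t : ℝ) :
    tail (D.law hT t) x = g x (max 0 (min t T)) :=
  tail_ofTail _ _ (D.le_one _ (MFPath.clamp_mem hT t)) x

lemma TailData.tendsto_W1 {T : ℝ} {g : ℕ → ℝ → ℝ} (D : TailData T g) (hT : 0 < T) (t : ℝ) :
    Tendsto (fun s => W1 (D.law hT s) (D.law hT t)) (𝓝 t) (𝓝 0) := by
  have hmem := MFPath.clamp_mem hT
  have hc : ∀ x, Continuous fun s => g x (max 0 (min s T)) := fun x =>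
    (D.cont x).comp_continuous (by fun_prop) hmem
  have hbd : ∀ s x, |g x (max 0 (min s T)) - g x (max 0 (min t T))| ≤ g x T := by
    intro s x
    rw [abs_sub_le_iff]
    constructor
    · linarith [D.le_final (hmem s) x, D.nonneg (hmem t) x]
    · linarith [D.le_final (hmem t) x, D.nonneg (hmem s) x]
  have h1 : Tendsto (fun s => ∑' x, |g x (max 0 (min s T)) - g x (max 0 (min t T))|) (𝓝 t)
      (𝓝 (∑' _ : ℕ, 0)) := by
    refine tendsto_tsum_of_dominated_convergence D.summable (fun x => ?_)
      (Eventually.of_forall fun s x => by simpa using hbd s x)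
    have := ((hc x).sub (continuous_const (y := g x (max 0 (min t T))))).abs.tendsto t
    simpa using this
  rw [tsum_zero] at h1
  have h2 := ENNReal.tendsto_ofReal h1
  rw [ENNReal.ofReal_zero] at h2
  refine tendsto_of_tendsto_of_tendsto_of_le_of_le tendsto_const_nhds h2 (fun _ => bot_le) ?_
  intro s
  refine (W1_le_tsum _ _).trans ?_
  simp_rw [D.tail_law hT]
  rw [ENNReal.ofReal_tsum_of_nonneg (fun x => abs_nonneg _)
    (D.summable.of_nonneg_of_le (fun x => abs_nonneg _) (hbd s))]

/-- The path with tails `g`. -/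
def TailData.path {T : ℝ} {g : ℕ → ℝ → ℝ} (D : TailData T g) (hT : 0 < T) : MFPath T where
  law := D.law hT
  finiteMean t _ := finiteMean_of_summable ((D.summable_at (MFPath.clamp_mem hT t)).congr
      fun x => (D.tail_law hT x t).symm)
  rightCts t _ := (D.tendsto_W1 hT t).mono_left nhdsWithin_le_nhds
  leftLim t ht := by
    refine ⟨D.law hT t, ?_, (D.tendsto_W1 hT t).mono_left nhdsWithin_le_nhds⟩
    exact finiteMean_of_summable ((D.summable_at (MFPath.clamp_mem hT t)).congr
      fun x => (D.tail_law hT x t).symm)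
  init := by
    have h := real_singleton_zero (D.law hT 0)
    rw [D.tail_law hT, min_eq_left hT.le, max_self, D.zero, sub_zero, measureReal_def] at h
    exact (ENNReal.toReal_eq_one_iff _).1 h
  antitone_cdf x := by
    intro s hs t ht hst
    have hmono : tail (D.law hT s) x ≤ tail (D.law hT t) x := by
      rw [D.tail_law hT, D.tail_law hT]
      exact D.mono x (MFPath.clamp_mem hT s) (MFPath.clamp_mem hT t)
        (max_le_max le_rfl (min_le_min hst le_rfl))
    have hc : ∀ r, (D.law hT r : Measure ℕ) (Iic x) = 1 - ENNReal.ofReal (tail (D.law hT r) x) := by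
      intro r
      rw [ofReal_tail, ← prob_compl_eq_one_sub measurableSet_Ioi, compl_Ioi]
    beta_reduce
    rw [hc, hc]
    exact tsub_le_tsub_left (ENNReal.ofReal_le_ofReal hmono) 1

lemma TailData.tl_path {T : ℝ} {g : ℕ → ℝ → ℝ} (D : TailData T g) (hT : 0 < T) (x : ℕ) {t : ℝ}
    (ht : t ∈ Icc 0 T) : (D.path hT).tl x t = g x t := by
  change tail ((D.path hT).lawc t) x = _
  rw [MFPath.lawc_eq _ ht]
  change tail (D.law hT t) x = _
  rw [D.tail_law hT, min_eq_left ht.2, max_eq_right ht.1]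

/-! ### The Poisson path -/

/-- The mass at `x` of the Poisson law with mean `t`. -/
def pois (x : ℕ) (t : ℝ) : ℝ := Real.exp (-t) * t ^ x / x.factorial

/-- The tail of the Poisson law with mean `t`. -/
def poisTail (x : ℕ) (t : ℝ) : ℝ := 1 - ∑ y ∈ Finset.range (x + 1), pois y t

lemma pois_nonneg (x : ℕ) {t : ℝ} (ht : 0 ≤ t) : 0 ≤ pois x t := by unfold pois; positivity

lemma pois_pos (x : ℕ) {t : ℝ} (ht : 0 < t) : 0 < pois x t := by unfold pois; positivity

lemma continuous_pois (x : ℕ) : Continuous (pois x) := by unfold pois; fun_prop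

lemma poisTail_succ (x : ℕ) (t : ℝ) : poisTail (x + 1) t = poisTail x t - pois (x + 1) t := by
  rw [poisTail, Finset.sum_range_succ, poisTail]
  ring

lemma poisTail_zero' (t : ℝ) : poisTail 0 t = 1 - pois 0 t := by simp [poisTail]

lemma hasDerivAt_pois_zero (t : ℝ) : HasDerivAt (pois 0) (-pois 0 t) t := by
  have h : pois 0 = fun t => Real.exp (-t) := by ext t; simp [pois]
  rw [h]
  exact (hasDerivAt_neg t).exp.congr_deriv (by ring)

lemma hasDerivAt_pois_succ (x : ℕ) (t : ℝ) :
    HasDerivAt (pois (x + 1)) (pois x t - pois (x + 1) t) t := by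
  have h1 : HasDerivAt (fun t => Real.exp (-t)) (-Real.exp (-t)) t :=
    (hasDerivAt_neg t).exp.congr_deriv (by ring)
  have h2 := (h1.mul (hasDerivAt_pow (x + 1) t)).div_const ((x + 1).factorial : ℝ)
  refine h2.congr_deriv ?_
  unfold pois
  rw [Nat.factorial_succ]
  push_cast
  have : (x.factorial : ℝ) ≠ 0 := by positivity
  field_simp
  ring

lemma hasDerivAt_poisTail (x : ℕ) (t : ℝ) : HasDerivAt (poisTail x) (pois x t) t := by
  induction x with
  | zero =>
    rw [show poisTail 0 = fun t => 1 - pois 0 t from funext poisTail_zero']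
    simpa using (hasDerivAt_pois_zero t).const_sub 1
  | succ n ih =>
    rw [show poisTail (n + 1) = fun t => poisTail n t - pois (n + 1) t from
      funext (poisTail_succ n)]
    exact (ih.sub (hasDerivAt_pois_succ n t)).congr_deriv (by ring)

lemma poisTail_apply_zero (x : ℕ) : poisTail x 0 = 0 := by
  rw [poisTail, Finset.sum_range_succ', Finset.sum_eq_zero]
  · simp [pois]
  · intro y _
    simp [pois]

lemma integral_pois (x : ℕ) (t : ℝ) : ∫ s in (0 : ℝ)..t, pois x s = poisTail x t := by
  rw [intervalIntegral.integral_eq_sub_of_hasDerivAt (fun s _ => hasDerivAt_poisTail x s)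
    ((continuous_pois x).intervalIntegrable _ _), poisTail_apply_zero, sub_zero]

lemma poisTail_nonneg (x : ℕ) {t : ℝ} (ht : 0 ≤ t) : 0 ≤ poisTail x t := by
  rw [← integral_pois]
  exact intervalIntegral.integral_nonneg ht fun s hs => pois_nonneg x hs.1

lemma poisTail_le_one (x : ℕ) {t : ℝ} (ht : 0 ≤ t) : poisTail x t ≤ 1 :=
  sub_le_self _ (Finset.sum_nonneg fun y _ => pois_nonneg y ht)

lemma sum_pois_le_one (M : ℕ) {t : ℝ} (ht : 0 ≤ t) : ∑ x ∈ Finset.range M, pois x t ≤ 1 := by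
  cases M with
  | zero => simp
  | succ n =>
    have := poisTail_nonneg n ht
    unfold poisTail at this
    linarith

lemma poisTail_antitone {t : ℝ} (ht : 0 ≤ t) : Antitone fun x => poisTail x t :=
  antitone_nat_of_succ_le fun x => by
    rw [poisTail_succ]
    linarith [pois_nonneg (x + 1) ht]

lemma poisTail_monotoneOn (x : ℕ) : MonotoneOn (poisTail x) (Ici 0) := by
  intro s hs t ht hst
  rw [← sub_nonneg, ← integral_pois, ← integral_pois, intervalIntegral.integral_interval_sub_left
    ((continuous_pois x).intervalIntegrable _ _) ((continuous_pois x).intervalIntegrable _ _)]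
  exact intervalIntegral.integral_nonneg hst fun u hu => pois_nonneg x (le_trans hs hu.1)

lemma sum_poisTail_le (M : ℕ) {t : ℝ} (ht : 0 ≤ t) :
    ∑ x ∈ Finset.range M, poisTail x t ≤ t := by
  simp_rw [← integral_pois]
  rw [← intervalIntegral.integral_finsetSum fun x _ => (continuous_pois x).intervalIntegrable _ _]
  calc _ ≤ ∫ _ in (0 : ℝ)..t, (1 : ℝ) := by
        refine intervalIntegral.integral_mono_on ht
          ((continuous_finsetSum _ fun x _ => continuous_pois x).intervalIntegrable _ _)
          (by simp) fun s hs => sum_pois_le_one M hs.1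
    _ = t := by simp

/-- A lower bound for the Poisson masses away from the time origin. -/
lemma le_pois {T r : ℝ} (hr0 : 0 < r) (hr1 : r ≤ 1) {N x : ℕ} (hx : x ≤ N) {t : ℝ} (htT : t ≤ T)
    (h : r ≤ t ∨ x = 0) : Real.exp (-T) * r ^ N / N.factorial ≤ pois x t := by
  unfold pois
  have h1 : r ^ N ≤ t ^ x := by
    rcases h with h | h
    · exact (pow_le_pow_of_le_one hr0.le hr1 hx).trans (pow_le_pow_left₀ hr0.le h x)
    · rw [h, pow_zero]
      exact pow_le_one₀ hr0.le hr1
  have h2 : (x.factorial : ℝ) ≤ N.factorial := by exact_mod_cast Nat.factorial_le hx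
  have h3 : Real.exp (-T) ≤ Real.exp (-t) := Real.exp_le_exp.2 (neg_le_neg htT)
  have h4 : 0 ≤ r ^ N := by positivity
  have h5 : (0 : ℝ) < x.factorial := by positivity
  exact div_le_div₀ (mul_nonneg (Real.exp_pos _).le (h4.trans h1))
    (mul_le_mul h3 h1 h4 (Real.exp_pos _).le) h5 h2

/-! ### The approximating paths -/

namespace MFPath

variable {T : ℝ} {α : ℝ≥0} {h ϕ : ℝ → ℝ} (μ : MFPath T)

/-- The average of `μ_{t-s}((x,∞))` over delays `s` in `[η, 2η]`. -/
def avg (η : ℝ) (x : ℕ) (t : ℝ) : ℝ := η⁻¹ * ∫ s in η..2 * η, μ.tl x (t - s)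

/-- The average of `μ_{t-s}({x})` over delays `s` in `[η, 2η]`. -/
def avgMs (η : ℝ) (x : ℕ) (t : ℝ) : ℝ := η⁻¹ * ∫ s in η..2 * η, μ.ms x (t - s)

section avg

variable {η : ℝ}

lemma intervalIntegrable_tl (hT : 0 < T) (x : ℕ) (t a b : ℝ) :
    IntervalIntegrable (fun s => μ.tl x (t - s)) volume a b := by
  rw [intervalIntegrable_iff]
  have : IsFiniteMeasure (volume.restrict (uIoc a b)) := ⟨by simp [uIoc]⟩
  exact Integrable.of_bound ((μ.measurable_tl hT x).comp
    (measurable_const.sub measurable_id)).aestronglyMeasurable 1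
    (Eventually.of_forall fun s => μ.abs_tl_le_one x _)

lemma intervalIntegrable_ms (hT : 0 < T) (x : ℕ) (t a b : ℝ) :
    IntervalIntegrable (fun s => μ.ms x (t - s)) volume a b := by
  rw [intervalIntegrable_iff]
  have : IsFiniteMeasure (volume.restrict (uIoc a b)) := ⟨by simp [uIoc]⟩
  exact Integrable.of_bound ((μ.measurable_ms hT x).comp
    (measurable_const.sub measurable_id)).aestronglyMeasurable 1
    (Eventually.of_forall fun s => μ.abs_ms_le_one x _)

/-- Averages over `[η, 2η]` preserve inequalities. -/
lemma average_mono (hη : 0 < η) {f g : ℝ → ℝ} (hf : IntervalIntegrable f volume η (2 * η))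
    (hg : IntervalIntegrable g volume η (2 * η)) (hfg : ∀ s ∈ Icc η (2 * η), f s ≤ g s) :
    η⁻¹ * ∫ s in η..2 * η, f s ≤ η⁻¹ * ∫ s in η..2 * η, g s :=
  mul_le_mul_of_nonneg_left (intervalIntegral.integral_mono_on (by linarith) hf hg hfg)
    (inv_nonneg.2 hη.le)

lemma average_const (hη : 0 < η) (c : ℝ) : η⁻¹ * ∫ _ in η..2 * η, c = c := by
  rw [intervalIntegral.integral_const, smul_eq_mul]
  field_simp
  ring

lemma avg_le (hT : 0 < T) (hη : 0 < η) (x : ℕ) (t : ℝ) : μ.avg η x t ≤ μ.tl x t := by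
  rw [← average_const hη (μ.tl x t)]
  exact average_mono hη (μ.intervalIntegrable_tl hT x t _ _) intervalIntegrable_const
    fun s hs => μ.tl_mono hT x (by linarith [hs.1])

lemma le_avg (hT : 0 < T) (hη : 0 < η) (x : ℕ) (t : ℝ) :
    μ.tl x (t - 2 * η) ≤ μ.avg η x t := by
  rw [← average_const hη (μ.tl x (t - 2 * η))]
  exact average_mono hη intervalIntegrable_const (μ.intervalIntegrable_tl hT x t _ _)
    fun s hs => μ.tl_mono hT x (by linarith [hs.2])

lemma avg_nonneg (hT : 0 < T) (hη : 0 < η) (x : ℕ) (t : ℝ) : 0 ≤ μ.avg η x t :=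
  (μ.tl_nonneg x _).trans (μ.le_avg hT hη x t)

lemma avg_mono (hT : 0 < T) (hη : 0 < η) (x : ℕ) : Monotone (μ.avg η x) := fun _ _ hst =>
  average_mono hη (μ.intervalIntegrable_tl hT x _ _ _) (μ.intervalIntegrable_tl hT x _ _ _)
    fun s _ => μ.tl_mono hT x (by linarith)

lemma avg_antitone (hT : 0 < T) (hη : 0 < η) (t : ℝ) : Antitone fun x => μ.avg η x t :=
  fun _ _ hxy => average_mono hη (μ.intervalIntegrable_tl hT _ _ _ _)
    (μ.intervalIntegrable_tl hT _ _ _ _) fun _ _ => μ.tl_antitone _ hxy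

lemma avg_of_le (hT : 0 < T) (hη : 0 < η) (x : ℕ) {t : ℝ} (ht : t ≤ η) : μ.avg η x t = 0 := by
  rw [avg, intervalIntegral.integral_congr (g := fun _ => 0), intervalIntegral.integral_zero,
    mul_zero]
  intro s hs
  rw [uIcc_of_le (by linarith)] at hs
  exact μ.tl_of_nonpos hT x (by linarith [hs.1])

lemma avgMs_zero (hT : 0 < T) (hη : 0 < η) (t : ℝ) : μ.avgMs η 0 t = 1 - μ.avg η 0 t := by
  unfold avgMs avg
  simp_rw [ms_zero]
  rw [intervalIntegral.integral_sub intervalIntegrable_const (μ.intervalIntegrable_tl hT 0 t _ _),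
    mul_sub, average_const hη]

lemma avgMs_succ (hT : 0 < T) (x : ℕ) (t : ℝ) :
    μ.avgMs η (x + 1) t = μ.avg η x t - μ.avg η (x + 1) t := by
  unfold avgMs avg
  simp_rw [ms_succ]
  rw [intervalIntegral.integral_sub (μ.intervalIntegrable_tl hT _ t _ _)
    (μ.intervalIntegrable_tl hT _ t _ _), mul_sub]

lemma avgMs_nonneg (hη : 0 < η) (x : ℕ) (t : ℝ) : 0 ≤ μ.avgMs η x t :=
  mul_nonneg (inv_nonneg.2 hη.le)
    (intervalIntegral.integral_nonneg (by linarith) fun s _ => μ.ms_nonneg x _)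

lemma avgMs_le_one (hT : 0 < T) (hη : 0 < η) (x : ℕ) (t : ℝ) : μ.avgMs η x t ≤ 1 := by
  refine (average_mono hη (μ.intervalIntegrable_ms hT x t _ _) intervalIntegrable_const
    fun s _ => μ.ms_le_one x _).trans (average_const hη 1).le

/-- Averaging in time makes the flux absolutely continuous, with a bounded density. -/
lemma hasDerivAt_avg {x : ℕ} (hc : Continuous (μ.tl x)) (t : ℝ) :
    HasDerivAt (μ.avg η x) (η⁻¹ * (μ.tl x (t - η) - μ.tl x (t - 2 * η))) t := by
  have hF : ∀ r, HasDerivAt (fun r => ∫ s in (0 : ℝ)..r, μ.tl x s) (μ.tl x r) r := fun r =>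
    intervalIntegral.integral_hasDerivAt_right (hc.intervalIntegrable _ _)
      hc.aestronglyMeasurable.stronglyMeasurableAtFilter hc.continuousAt
  have h1 : μ.avg η x = fun t => η⁻¹ * ((∫ s in (0 : ℝ)..t - η, μ.tl x s)
      - ∫ s in (0 : ℝ)..t - 2 * η, μ.tl x s) := by
    ext t
    rw [avg, intervalIntegral.integral_comp_sub_left (fun s => μ.tl x s),
      intervalIntegral.integral_interval_sub_left (hc.intervalIntegrable _ _)
        (hc.intervalIntegrable _ _)]
  rw [h1]
  exact (((hF (t - η)).comp_sub_const t η).sub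
    ((hF (t - 2 * η)).comp_sub_const t (2 * η))).const_mul _

lemma continuous_avg (hc : ∀ x, Continuous (μ.tl x)) (x : ℕ) : Continuous (μ.avg η x) :=
  continuous_iff_continuousAt.2 fun t => (μ.hasDerivAt_avg (hc x) t).continuousAt

end avg

/-- The tails of the approximating path: with probability `ε` a Poisson path of rate one, otherwise
the given path stopped at the state `N` and delayed by a random time uniform on `[η, 2η]`. -/
def smTail (ε η : ℝ) (N x : ℕ) (t : ℝ) : ℝ :=
  (1 - ε) * (if x < N then μ.avg η x t else 0) + ε * poisTail x t

/-- The flux density of the approximating path. -/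
def smDens (ε η : ℝ) (N x : ℕ) (t : ℝ) : ℝ :=
  (1 - ε) * (if x < N then η⁻¹ * (μ.tl x (t - η) - μ.tl x (t - 2 * η)) else 0) + ε * pois x t

/-- The masses of the given path, stopped at the state `N` and delayed by a random time uniform on
`[η, 2η]`. -/
def stopMs (η : ℝ) (N x : ℕ) (t : ℝ) : ℝ :=
  if x < N then μ.avgMs η x t else if x = N then μ.avg η (N - 1) t else 0

section approximation

variable {ε η : ℝ} {N : ℕ}

lemma tailData_smTail (hT : 0 < T) (hε : 0 ≤ ε) (hε1 : ε ≤ 1) (hη : 0 < η)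
    (hc : ∀ x, Continuous (μ.tl x)) : TailData T (μ.smTail ε η N) where
  antitone t ht x y hxy := by
    refine add_le_add (mul_le_mul_of_nonneg_left ?_ (sub_nonneg.2 hε1))
      (mul_le_mul_of_nonneg_left (poisTail_antitone ht.1 hxy) hε)
    by_cases hy : y < N
    · rw [if_pos hy, if_pos (hxy.trans_lt hy)]
      exact μ.avg_antitone hT hη t hxy
    · rw [if_neg hy]
      split_ifs
      · exact μ.avg_nonneg hT hη x t
      · exact le_rfl
  le_one t ht x := by
    have h1 : (if x < N then μ.avg η x t else 0) ≤ 1 := by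
      split_ifs
      · exact (μ.avg_le hT hη x t).trans (μ.tl_le_one x t)
      · exact zero_le_one
    have h2 := mul_le_mul_of_nonneg_left h1 (sub_nonneg.2 hε1)
    have h3 := mul_le_mul_of_nonneg_left (poisTail_le_one x ht.1) hε
    unfold smTail
    linarith
  mono x s hs t ht hst := by
    refine add_le_add (mul_le_mul_of_nonneg_left ?_ (sub_nonneg.2 hε1))
      (mul_le_mul_of_nonneg_left (poisTail_monotoneOn x hs.1 ht.1 hst) hε)
    split_ifs
    · exact μ.avg_mono hT hη x hst
    · exact le_rfl
  cont x := by
    have h1 : Continuous (μ.avg η x) := μ.continuous_avg hc x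
    have h2 : Continuous (poisTail x) :=
      continuous_iff_continuousAt.2 fun t => (hasDerivAt_poisTail x t).continuousAt
    unfold smTail
    split_ifs
    · fun_prop
    · fun_prop
  zero x := by
    rw [smTail, μ.avg_of_le hT hη x hη.le, poisTail_apply_zero]
    simp
  summable := by
    refine Summable.add (Summable.mul_left _ ?_) (Summable.mul_left _ ?_)
    · refine summable_of_ne_finset_zero (s := Finset.range N) fun x hx => ?_
      rw [if_neg (by simpa using hx)]
    · exact summable_of_sum_range_le (fun x => poisTail_nonneg x hT.le)
        fun M => sum_poisTail_le M hT.le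

lemma continuous_smDens (hc : ∀ x, Continuous (μ.tl x)) (x : ℕ) :
    Continuous (μ.smDens ε η N x) := by
  have h1 := continuous_pois x
  have h2 := hc x
  unfold smDens
  split_ifs <;> fun_prop

lemma smTail_eq_integral (hT : 0 < T) (hη : 0 < η) (hc : ∀ x, Continuous (μ.tl x)) (x : ℕ) (t : ℝ) :
    μ.smTail ε η N x t = ∫ s in (0 : ℝ)..t, μ.smDens ε η N x s := by
  have h : ∀ s, HasDerivAt (μ.smTail ε η N x) (μ.smDens ε η N x s) s := by
    intro s
    have h2 := (hasDerivAt_poisTail x s).const_mul ε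
    unfold smTail smDens
    split_ifs
    · exact ((μ.hasDerivAt_avg (hc x) s).const_mul (1 - ε)).add h2
    · exact (hasDerivAt_const s ((1 - ε) * 0)).add h2 |>.congr_deriv (by ring)
  rw [intervalIntegral.integral_eq_sub_of_hasDerivAt (fun s _ => h s)
    ((μ.continuous_smDens hc x).intervalIntegrable _ _)]
  simp [smTail, μ.avg_of_le hT hη x hη.le, poisTail_apply_zero]

lemma ms_path (hT : 0 < T) (hη : 0 < η) (hN : 0 < N) (D : TailData T (μ.smTail ε η N)) (x : ℕ)
    {t : ℝ} (ht : t ∈ Icc 0 T) :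
    (D.path hT).ms x t = (1 - ε) * μ.stopMs η N x t + ε * pois x t := by
  cases x with
  | zero =>
    rw [ms_zero, D.tl_path hT 0 ht, smTail, stopMs, if_pos hN, if_pos hN, μ.avgMs_zero hT hη,
      poisTail_zero']
    ring
  | succ y =>
    rw [ms_succ, D.tl_path hT _ ht, D.tl_path hT _ ht, smTail, smTail, stopMs, poisTail_succ]
    rcases lt_trichotomy (y + 1) N with h | h | h
    · rw [if_pos h, if_pos h, if_pos (by omega), μ.avgMs_succ hT]
      ring
    · subst h
      rw [if_pos (Nat.lt_succ_self y), if_neg (lt_irrefl _), if_neg (lt_irrefl _), if_pos rfl,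
        Nat.add_sub_cancel]
      ring
    · rw [if_neg (by omega), if_neg (by omega), if_neg (by omega), if_neg (by omega)]
      ring

lemma stopMs_nonneg (hT : 0 < T) (hη : 0 < η) (x : ℕ) (t : ℝ) : 0 ≤ μ.stopMs η N x t := by
  unfold stopMs
  split_ifs
  · exact μ.avgMs_nonneg hη x t
  · exact μ.avg_nonneg hT hη _ t
  · exact le_rfl

lemma stopMs_le_one (hT : 0 < T) (hη : 0 < η) (x : ℕ) (t : ℝ) : μ.stopMs η N x t ≤ 1 := by
  unfold stopMs
  split_ifs
  · exact μ.avgMs_le_one hT hη x t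
  · exact (μ.avg_le hT hη _ t).trans (μ.tl_le_one _ t)
  · exact zero_le_one

/-- The Poisson component makes the flux densities and the masses comparable: at states and times
not reached by the delayed and stopped path only the Poisson component is present, elsewhere it
is bounded below. -/
lemma exists_comparable (hT : 0 < T) (hε : 0 < ε) (hε1 : ε ≤ 1) (hη : 0 < η) :
    ∃ A : ℝ, 0 < A ∧ ∀ t ∈ Ioc 0 T, ∀ x,
      μ.smDens ε η N x t ≤ A * ((1 - ε) * μ.stopMs η N x t + ε * pois x t) ∧
      (1 - ε) * μ.stopMs η N x t + ε * pois x t ≤ A * μ.smDens ε η N x t := by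
  -- `c₀` bounds the Poisson masses from below at the states `x ≤ N` and times `t ≥ η`; before time
  -- `η` the delayed path has not left the state `0`.
  have hr0 : 0 < min η 1 := lt_min hη one_pos
  set c₀ := Real.exp (-T) * min η 1 ^ N / N.factorial with hc₀
  have hc₀0 : 0 < c₀ := by positivity
  set A := (η⁻¹ + 1) / (ε * c₀) with hA
  have hA0 : 0 < A := by positivity
  have hη' : 0 < η⁻¹ := inv_pos.2 hη
  refine ⟨A + 1, by positivity, fun t ht x => ?_⟩
  set a := if x < N then η⁻¹ * (μ.tl x (t - η) - μ.tl x (t - 2 * η)) else 0 with ha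
  set b := μ.stopMs η N x t
  have hq : 0 ≤ ε * pois x t := mul_nonneg hε.le (pois_nonneg x ht.1.le)
  have ha0 : 0 ≤ a := by
    rw [ha]
    split_ifs
    · exact mul_nonneg hη'.le (sub_nonneg.2 (μ.tl_mono hT x (by linarith)))
    · exact le_rfl
  have hb0 : 0 ≤ b := μ.stopMs_nonneg hT hη x t
  have ha1 : a ≤ η⁻¹ := by
    rw [ha]
    split_ifs
    · refine mul_le_of_le_one_right hη'.le ?_
      linarith [μ.tl_le_one x (t - η), μ.tl_nonneg x (t - 2 * η)]
    · exact hη'.le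
  have hb1 : b ≤ 1 := μ.stopMs_le_one hT hη x t
  have key : a ≤ A * (ε * pois x t) ∧ b ≤ A * (ε * pois x t) := by
    by_cases hcase : x ≤ N ∧ (η ≤ t ∨ x = 0)
    · have hlow : c₀ ≤ pois x t := le_pois hr0 (min_le_right _ _) hcase.1 ht.2
        (hcase.2.imp (fun h => (min_le_left _ _).trans h) id)
      have h1 : η⁻¹ + 1 ≤ A * (ε * pois x t) := by
        calc η⁻¹ + 1 = A * (ε * c₀) := by rw [hA]; field_simp
          _ ≤ A * (ε * pois x t) := by gcongr
      exact ⟨by linarith, by linarith⟩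
    · have hz : a = 0 ∧ b = 0 := by
        by_cases hx : x ≤ N
        · have h2 : t < η ∧ x ≠ 0 := by
            by_contra hcon
            refine hcase ⟨hx, ?_⟩
            by_contra hcon2
            rw [not_or, not_le] at hcon2
            exact hcon hcon2
          obtain ⟨y, rfl⟩ := Nat.exists_eq_succ_of_ne_zero h2.2
          constructor
          · rw [ha, μ.tl_of_nonpos hT _ (by linarith), μ.tl_of_nonpos hT _ (by linarith)]
            simp
          · simp only [b, stopMs, Nat.succ_eq_add_one, μ.avgMs_succ hT,
              μ.avg_of_le hT hη _ h2.1.le]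
            simp
        · rw [not_le] at hx
          exact ⟨by rw [ha, if_neg (by omega)], by
            simp only [b, stopMs]
            rw [if_neg (by omega), if_neg (by omega)]⟩
      rw [hz.1, hz.2]
      have := mul_nonneg hA0.le hq
      exact ⟨this, this⟩
  have e : μ.smDens ε η N x t = (1 - ε) * a + ε * pois x t := rfl
  have h1 : 0 ≤ 1 - ε := sub_nonneg.2 hε1
  have h2 : (1 - ε) * a ≤ a := mul_le_of_le_one_left ha0 (by linarith)
  have h3 : (1 - ε) * b ≤ b := mul_le_of_le_one_left hb0 (by linarith)
  have h4 : 0 ≤ (1 - ε) * a := mul_nonneg h1 ha0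
  have h5 : 0 ≤ (1 - ε) * b := mul_nonneg h1 hb0
  have h6 := mul_nonneg hA0.le h4
  have h7 := mul_nonneg hA0.le h5
  rw [e]
  constructor <;> nlinarith [key.1, key.2]

/-- The approximating path is close to the given path, uniformly in time. -/
lemma sum_abs_smTail_sub_le (hT : 0 < T) (hε : 0 ≤ ε) (hε1 : ε ≤ 1) (hη : 0 < η) {ω : ℝ}
    (hω : ∀ t, μ.meanFun t - μ.meanFun (t - 2 * η) ≤ ω)
    (hN : ∀ M, ∑ x ∈ Finset.range M, (if x < N then 0 else μ.tl x T) ≤ ω) (M : ℕ) {t : ℝ}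
    (ht : t ∈ Icc 0 T) :
    ∑ x ∈ Finset.range M, |μ.smTail ε η N x t - μ.tl x t|
      ≤ 2 * ω + ε * (μ.meanFun T + T) := by
  have hterm : ∀ x, |μ.smTail ε η N x t - μ.tl x t|
      ≤ (μ.tl x t - μ.tl x (t - 2 * η)) + (if x < N then 0 else μ.tl x T)
        + ε * μ.tl x t + ε * poisTail x t := by
    intro x
    have h1 := μ.avg_le hT hη x t
    have h2 := μ.le_avg hT hη x t
    have h3 := μ.avg_nonneg hT hη x t
    have h4 := poisTail_nonneg x ht.1
    have h5 := μ.tl_nonneg x t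
    have h6 := μ.tl_mono hT x ht.2
    have h7 := μ.tl_mono hT x (by linarith : t - 2 * η ≤ t)
    have h8 := mul_nonneg hε h5
    have h9 := mul_nonneg hε h4
    have h10 := mul_nonneg hε h3
    have h11 := mul_le_mul_of_nonneg_left h1 hε
    have h12 := mul_nonneg (sub_nonneg.2 hε1) h3
    unfold smTail
    rw [abs_le]
    split_ifs with h
    · constructor <;> linarith
    · constructor <;> linarith
  refine (Finset.sum_le_sum fun x _ => hterm x).trans ?_
  simp only [Finset.sum_add_distrib, ← Finset.mul_sum]
  have h1 : ∑ x ∈ Finset.range M, (μ.tl x t - μ.tl x (t - 2 * η)) ≤ ω := by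
    refine (sum_le_hasSum _ (fun x _ => ?_)
      ((μ.hasSum_tl hT t).sub (μ.hasSum_tl hT (t - 2 * η)))).trans (hω t)
    exact sub_nonneg.2 (μ.tl_mono hT x (by linarith))
  have h2 := mul_le_mul_of_nonneg_left ((μ.sum_tl_le hT M t).trans (μ.meanFun_le hT t)) hε
  have h3 := mul_le_mul_of_nonneg_left ((sum_poisTail_le M ht.1).trans ht.2) hε
  linarith [hN M]

end approximation

end MFPath

/-! ### The cost of the approximating paths -/

namespace MFPath

variable {T : ℝ} {α : ℝ≥0} {h ϕ : ℝ → ℝ} (μ : MFPath T)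

/-- The relative entropy bound `f - (e^f - 1) λ ≤ λ - 1 - log λ`. -/
lemma _root_.MeanFieldHawkes.sub_exp_sub_one_mul_le {c Λ l : ℝ} (hc : 0 < c) (hcl : c ≤ l)
    (hl : l ≤ Λ) (f : ℝ) : f - (Real.exp f - 1) * l ≤ Λ + |Real.log c| := by
  have hl0 : 0 < l := hc.trans_le hcl
  have h1 := Real.add_one_le_exp (f + Real.log l)
  rw [Real.exp_add, Real.exp_log hl0] at h1
  have h2 := Real.log_le_log hc hcl
  have h3 := neg_abs_le (Real.log c)
  linarith

lemma _root_.MeanFieldHawkes.abs_log_div_le {c Λ a b : ℝ} (hc : 0 < c) (ha : a ∈ Icc c Λ)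
    (hb : b ∈ Icc c Λ) : |Real.log (a / b)| ≤ Real.log (Λ / c) := by
  have ha0 := hc.trans_le ha.1
  have hb0 := hc.trans_le hb.1
  rw [Real.log_div ha0.ne' hb0.ne', Real.log_div (ha0.trans_le ha.2).ne' hc.ne', abs_le]
  have := Real.log_le_log hc ha.1
  have := Real.log_le_log ha0 ha.2
  have := Real.log_le_log hc hb.1
  have := Real.log_le_log hb0 hb.2
  constructor <;> linarith

lemma _root_.MeanFieldHawkes.le_log_div {c δ a b : ℝ} (hc : 0 < c) (ha : c ≤ a) (hb : c ≤ b)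
    (hδ : 0 ≤ δ) (hab : |a - b| ≤ δ) : -(δ / c) ≤ Real.log (a / b) := by
  have ha0 := hc.trans_le ha
  have hb0 := hc.trans_le hb
  have h1 := Real.one_sub_inv_le_log_of_pos (div_pos ha0 hb0)
  have h2 : 1 - (a / b)⁻¹ = (a - b) / a := by field_simp
  have h3 : -(δ / c) ≤ (a - b) / a := by
    rw [← neg_div, div_le_div_iff₀ hc ha0]
    have h4 := (abs_le.1 hab).1
    nlinarith
  linarith

/-- Delaying the path by `s` and running it with another intensity `l`, close to the shifted
intensity of the path, increases the cost only a little: the change of intensity is absorbed into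
the test function. -/
lemma shift_cost_le (hT : 0 < T) (hA : Assumptions T α h ϕ) {R : ℝ}
    (hR : rateFunction h ϕ μ ≤ (R : EReal)) {c Λ δ s C : ℝ} (hc : 0 < c) (hδ : 0 ≤ δ) (hs : 0 ≤ s)
    (hlam : ∀ t, μ.lam h ϕ t ∈ Icc c Λ) {l : ℝ → ℝ} (hlm : Measurable l) (hl : ∀ t, l t ∈ Icc c Λ)
    (hclose : ∀ t, |l (t + s) - μ.lam h ϕ t| ≤ δ) {F : ℝ → ℕ → ℝ}
    (hF : ∀ x, Measurable fun t => F t x) (hC : ∀ t x, |F t x| ≤ C)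
    (hF0 : ∀ t, t ∉ Ioc 0 T → ∀ x, F t x = 0) (N : ℕ) :
    ∑ x ∈ Finset.range N, ((∫ t in Ioc 0 T, F (t + s) x ∂μ.flux hT x)
      - ∫ t in Ioc (-s) T, (Real.exp (F (t + s) x) - 1) * l (t + s) * μ.ms x t)
      ≤ R + δ / c * μ.meanFun T + δ * T + Λ * s := by
  have hΛ : 0 < Λ := hc.trans_le ((hl 0).1.trans (hl 0).2)
  -- The test function at time `t + s`, tilted by the ratio of the two intensities.
  set G : ℝ → ℕ → ℝ := fun t x =>
    (Ioc 0 (T - s)).indicator (fun t => F (t + s) x + Real.log (l (t + s) / μ.lam h ϕ t)) t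
    with hG
  have hGm : ∀ x, Measurable fun t => G t x := fun x =>
    (((hF x).comp (measurable_id.add_const s)).add
      (((hlm.comp (measurable_id.add_const s)).div (μ.measurable_lam hA hT)).log)).indicator
      measurableSet_Ioc
  have hGin : ∀ t ∈ Ioc 0 (T - s), ∀ x,
      G t x = F (t + s) x + Real.log (l (t + s) / μ.lam h ϕ t) := fun t ht x =>
    indicator_of_mem ht _
  have hGout : ∀ t, t ∉ Ioc 0 (T - s) → ∀ x, G t x = 0 := fun t ht x => indicator_of_notMem ht _
  have hGC : ∀ t x, |G t x| ≤ C + Real.log (Λ / c) := by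
    intro t x
    have h1 := abs_log_div_le hc (hl (t + s)) (hlam t)
    have h2 := hC (t + s) x
    by_cases ht : t ∈ Ioc 0 (T - s)
    · rw [hGin t ht]
      exact (abs_add_le _ _).trans (add_le_add h2 h1)
    · rw [hGout t ht, abs_zero]
      exact add_nonneg ((abs_nonneg _).trans h2) ((abs_nonneg _).trans h1)
  have hcost := μ.cost_le hT hA hR hGm hGC N
  have hfin : IsFiniteMeasure (volume.restrict (Ioc (-s) T)) := inferInstance
  have hms : ∀ x, Integrable (μ.ms x) (volume.restrict (Ioc (-s) T)) := fun x =>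
    Integrable.of_bound (μ.measurable_ms hT x).aestronglyMeasurable 1
      (Eventually.of_forall fun t => μ.abs_ms_le_one x t)
  -- The error in the exponential term: `δ` from the change of intensity, and `Λ` during `(-s, 0]`,
  -- when the delayed path still rests at `0`.
  set e : ℝ → ℝ := fun t => if 0 < t then δ else Λ with he
  have hem : Measurable e := Measurable.ite measurableSet_Ioi measurable_const measurable_const
  have he0 : ∀ t, 0 ≤ e t := fun t => by
    simp only [he]; split_ifs; exacts [hδ, hΛ.le]
  have heb : ∀ t, |e t| ≤ δ + Λ := fun t => by
    rw [abs_of_nonneg (he0 t)]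
    simp only [he]; split_ifs <;> linarith
  have hei : ∀ x, Integrable (fun t => e t * μ.ms x t) (volume.restrict (Ioc (-s) T)) := fun x =>
    (hms x).bdd_mul hem.aestronglyMeasurable (c := δ + Λ) (Eventually.of_forall heb)
  have hlast : ∑ x ∈ Finset.range N, ∫ t in Ioc (-s) T, e t * μ.ms x t ≤ δ * T + Λ * s := by
    rw [← integral_finsetSum _ fun x _ => hei x]
    have h1 : ∀ t, ∑ x ∈ Finset.range N, e t * μ.ms x t ≤ e t := fun t => by
      rw [← Finset.mul_sum]
      exact mul_le_of_le_one_right (he0 t) (μ.sum_ms_le_one N t)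
    have h2 : Integrable e (volume.restrict (Ioc (-s) T)) :=
      Integrable.of_bound hem.aestronglyMeasurable (δ + Λ) (Eventually.of_forall heb)
    refine (integral_mono (integrable_finsetSum _ fun x _ => hei x) h2 h1).trans ?_
    have h3 : Ioc (-s) T = Ioc (-s) 0 ∪ Ioc 0 T := (Ioc_union_Ioc_eq_Ioc (by linarith) hT.le).symm
    rw [h3, setIntegral_union (by
        rw [Set.disjoint_left]; intro t h1 h2; exact absurd h2.1 (not_lt.2 h1.2))
        measurableSet_Ioc (h2.mono_measure (Measure.restrict_mono (h3 ▸ subset_union_left) le_rfl))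
        (h2.mono_measure (Measure.restrict_mono (h3 ▸ subset_union_right) le_rfl)),
      setIntegral_congr_fun (g := fun _ => Λ) measurableSet_Ioc
        (fun t ht => if_neg (not_lt.2 ht.2)),
      setIntegral_congr_fun (g := fun _ => δ) measurableSet_Ioc (fun t ht => if_pos ht.1),
      setIntegral_const, setIntegral_const, Real.volume_real_Ioc_of_le (by linarith),
      Real.volume_real_Ioc_of_le hT.le, smul_eq_mul, smul_eq_mul]
    linarith
  have hterm : ∀ x, (∫ t in Ioc 0 T, F (t + s) x ∂μ.flux hT x)
      - ∫ t in Ioc (-s) T, (Real.exp (F (t + s) x) - 1) * l (t + s) * μ.ms x t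
      ≤ ((∫ t in Ioc 0 T, G t x ∂μ.flux hT x)
        - ∫ t in Ioc 0 T, (Real.exp (G t x) - 1) * (μ.ms x t * μ.lam h ϕ t))
        + δ / c * μ.tl x T + ∫ t in Ioc (-s) T, e t * μ.ms x t := by
    intro x
    have hGi : Integrable (fun t => G t x) ((μ.flux hT x).restrict (Ioc 0 T)) :=
      Integrable.of_bound (hGm x).aestronglyMeasurable _ (Eventually.of_forall fun t => hGC t x)
    have hFi : Integrable (fun t => F (t + s) x) ((μ.flux hT x).restrict (Ioc 0 T)) :=
      Integrable.of_bound ((hF x).comp (measurable_id.add_const s)).aestronglyMeasurable C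
        (Eventually.of_forall fun t => hC _ x)
    have h1 : ∫ t in Ioc 0 T, F (t + s) x ∂μ.flux hT x
        ≤ (∫ t in Ioc 0 T, G t x ∂μ.flux hT x) + δ / c * μ.tl x T := by
      have h2 : ∀ t ∈ Ioc 0 T, F (t + s) x ≤ G t x + δ / c := by
        intro t ht'
        by_cases ht : t ∈ Ioc 0 (T - s)
        · rw [hGin t ht]
          linarith [le_log_div hc (hl (t + s)).1 (hlam t).1 hδ (hclose t)]
        · have h3 : t + s ∉ Ioc 0 T := fun h4 => ht ⟨ht'.1, by linarith [h4.2]⟩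
          rw [hGout t ht, hF0 _ h3]
          positivity
      refine (setIntegral_mono_on hFi (hGi.add (integrable_const _)) measurableSet_Ioc h2).trans ?_
      rw [integral_add' hGi (integrable_const _), setIntegral_const, μ.flux_real_Ioc hT x hT.le,
        μ.tl_of_nonpos hT x le_rfl, smul_eq_mul]
      linarith
    have h3 : ∫ t in Ioc 0 T, (Real.exp (G t x) - 1) * (μ.ms x t * μ.lam h ϕ t)
        = ∫ t in Ioc (-s) T, (Real.exp (G t x) - 1) * μ.lam h ϕ t * μ.ms x t := by
      rw [setIntegral_eq_of_subset_of_forall_sdiff_eq_zero measurableSet_Ioc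
        (Ioc_subset_Ioc_left (by linarith : -s ≤ 0)) fun t ht => ?_]
      · exact setIntegral_congr_fun measurableSet_Ioc fun t _ => by ring
      · have h4 : t ∉ Ioc 0 (T - s) := fun h5 => ht.2 ⟨h5.1, by linarith [h5.2]⟩
        rw [hGout t h4]
        simp
    have hbdd : ∀ {g k : ℝ → ℝ} {D : ℝ}, Measurable g → Measurable k → (∀ t, |g t| ≤ D) →
        (∀ t, k t ∈ Icc c Λ) →
        Integrable (fun t => (Real.exp (g t) - 1) * k t * μ.ms x t)
          (volume.restrict (Ioc (-s) T)) := by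
      intro g k D hg hk hgD hkc
      refine (hms x).bdd_mul (c := (Real.exp D + 1) * Λ)
        (((Real.measurable_exp.comp hg).sub measurable_const).mul hk).aestronglyMeasurable
        (Eventually.of_forall fun t => ?_)
      rw [Real.norm_eq_abs, abs_mul]
      have h4 : |k t| ≤ Λ := by
        rw [abs_of_nonneg (hc.le.trans (hkc t).1)]
        exact (hkc t).2
      exact mul_le_mul (abs_exp_sub_one_le (hgD t)) h4 (abs_nonneg _) (by positivity)
    have h6 := hbdd ((hF x).comp (measurable_id.add_const s)) (hlm.comp (measurable_id.add_const s))
      (fun t => hC _ x) fun t => hl _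
    have h7 := hbdd (hGm x) (μ.measurable_lam hA hT) (fun t => hGC t x) hlam
    have h8 : ∫ t in Ioc (-s) T, (Real.exp (G t x) - 1) * μ.lam h ϕ t * μ.ms x t
        ≤ (∫ t in Ioc (-s) T, (Real.exp (F (t + s) x) - 1) * l (t + s) * μ.ms x t)
          + ∫ t in Ioc (-s) T, e t * μ.ms x t := by
      have h9 : ∫ t in Ioc (-s) T, ((Real.exp (F (t + s) x) - 1) * l (t + s) * μ.ms x t
          + e t * μ.ms x t) = _ := integral_add h6 (hei x)
      rw [← h9]
      refine setIntegral_mono_on h7 (h6.add (hei x)) measurableSet_Ioc fun t ht => ?_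
      have h10 : (Real.exp (G t x) - 1) * μ.lam h ϕ t
          ≤ (Real.exp (F (t + s) x) - 1) * l (t + s) + e t := by
        have hl0 := hc.trans_le (hl (t + s)).1
        have hlam0 := hc.trans_le (hlam t).1
        by_cases ht1 : t ∈ Ioc 0 (T - s)
        · rw [hGin t ht1, Real.exp_add, Real.exp_log (div_pos hl0 hlam0)]
          have h11 : Real.exp (F (t + s) x) * (l (t + s) / μ.lam h ϕ t) * μ.lam h ϕ t
              = Real.exp (F (t + s) x) * l (t + s) := by field_simp
          have h12 : e t = δ := if_pos ht1.1
          linarith [(abs_le.1 (hclose t)).2]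
        · rw [hGout t ht1, Real.exp_zero, sub_self, zero_mul]
          by_cases ht0 : 0 < t
          · have h11 : t + s ∉ Ioc 0 T := fun h4 => ht1 ⟨ht0, by linarith [h4.2]⟩
            rw [hF0 _ h11, Real.exp_zero, sub_self, zero_mul, zero_add]
            exact he0 t
          · have h12 : e t = Λ := if_neg ht0
            nlinarith [mul_pos (Real.exp_pos (F (t + s) x)) hl0, (hl (t + s)).2]
      calc _ ≤ ((Real.exp (F (t + s) x) - 1) * l (t + s) + e t) * μ.ms x t :=
            mul_le_mul_of_nonneg_right h10 (μ.ms_nonneg x t)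
        _ = _ := by ring
    rw [h3]
    linarith
  refine (Finset.sum_le_sum fun x _ => hterm x).trans ?_
  rw [Finset.sum_add_distrib, Finset.sum_add_distrib, ← Finset.mul_sum]
  have h5 : δ / c * ∑ x ∈ Finset.range N, μ.tl x T ≤ δ / c * μ.meanFun T :=
    mul_le_mul_of_nonneg_left (μ.sum_tl_le hT N T) (by positivity)
  unfold cost at hcost
  linarith

end MFPath

namespace MFPath

variable {T : ℝ} {α : ℝ≥0} {h ϕ : ℝ → ℝ} (μ : MFPath T)

lemma flux_restrict_real_Ioc (hT : 0 < T) (x : ℕ) {a b : ℝ} (hab : a ≤ b) (hb : b ≤ T) :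
    ((μ.flux hT x).restrict (Ioc 0 T)).real (Ioc a b) = μ.tl x b - μ.tl x a := by
  have h1 : μ.tl x (max a 0) = μ.tl x a := by
    rcases le_total a 0 with ha | ha
    · rw [max_eq_right ha, μ.tl_of_nonpos hT x le_rfl, μ.tl_of_nonpos hT x ha]
    · rw [max_eq_left ha]
  rw [measureReal_restrict_apply measurableSet_Ioc, Ioc_inter_Ioc, min_eq_left hb, Measure.real,
    flux_Ioc, h1, ENNReal.toReal_ofReal (sub_nonneg.2 (μ.tl_mono hT x hab))]

lemma integrable_shift (hT : 0 < T) (x : ℕ) {η C : ℝ} {F : ℝ → ℝ} (hF : Measurable F)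
    (hC : ∀ t, |F t| ≤ C) :
    Integrable (Function.uncurry fun t s => F (t + s))
      (((μ.flux hT x).restrict (Ioc 0 T)).prod (volume.restrict (Ioc η (2 * η)))) :=
  Integrable.of_bound (hF.comp (measurable_fst.add measurable_snd)).aestronglyMeasurable C
    (Eventually.of_forall fun _ => hC _)

lemma intervalIntegrable_shift (hT : 0 < T) (x : ℕ) {η C : ℝ} (hη : 0 < η) {F : ℝ → ℝ}
    (hF : Measurable F) (hC : ∀ t, |F t| ≤ C) :
    IntervalIntegrable (fun s => ∫ t in Ioc 0 T, F (t + s) ∂μ.flux hT x) volume η (2 * η) := by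
  rw [intervalIntegrable_iff_integrableOn_Ioc_of_le (by linarith)]
  exact (μ.integrable_shift hT x hF hC).integral_prod_right

/-- Integrating against the flux of the delayed path amounts to delaying the flux. -/
lemma integral_mul_density_eq (hT : 0 < T) (x : ℕ) {η C : ℝ} (hη : 0 < η) {F : ℝ → ℝ}
    (hF : Measurable F) (hC : ∀ t, |F t| ≤ C) (hF0 : ∀ t, t ∉ Ioc 0 T → F t = 0) :
    ∫ r in Ioc 0 T, F r * (η⁻¹ * (μ.tl x (r - η) - μ.tl x (r - 2 * η)))
      = η⁻¹ * ∫ s in η..2 * η, ∫ t in Ioc 0 T, F (t + s) ∂μ.flux hT x := by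
  set ρ := (μ.flux hT x).restrict (Ioc 0 T) with hρ
  -- The increment of the tail over `(r - 2η, r - η]` is the flux of the times `t` with
  -- `r - t ∈ [η, 2η)`.
  set k : ℝ → ℝ → ℝ := fun r t => F r * (Ico η (2 * η)).indicator 1 (r - t) with hk
  have hind : ∀ r t, |(Ico η (2 * η)).indicator (1 : ℝ → ℝ) (r - t)| ≤ 1 := fun r t => by
    by_cases hm : r - t ∈ Ico η (2 * η)
    · rw [indicator_of_mem hm]; simp
    · rw [indicator_of_notMem hm]; simp
  have hkm : Measurable (Function.uncurry k) :=
    (hF.comp measurable_fst).mul ((measurable_one.indicator measurableSet_Ico).comp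
      (measurable_fst.sub measurable_snd))
  have hkC : ∀ r t, |k r t| ≤ C := fun r t => by
    rw [hk, abs_mul]
    exact (mul_le_of_le_one_right (abs_nonneg _) (hind r t)).trans (hC r)
  have h1 : ∀ r ∈ Ioc 0 T, F r * (η⁻¹ * (μ.tl x (r - η) - μ.tl x (r - 2 * η)))
      = η⁻¹ * ∫ t, k r t ∂ρ := by
    intro r hr
    rw [← μ.flux_restrict_real_Ioc hT x (by linarith) (by linarith [hr.2]), ← hρ, hk,
      integral_const_mul]
    have h2 : (fun t => (Ico η (2 * η)).indicator (1 : ℝ → ℝ) (r - t))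
        = (Ioc (r - 2 * η) (r - η)).indicator 1 := by
      ext t
      by_cases hm : r - t ∈ Ico η (2 * η)
      · rw [indicator_of_mem hm, indicator_of_mem
          (show t ∈ Ioc (r - 2 * η) (r - η) from ⟨by linarith [hm.2], by linarith [hm.1]⟩)]
        rfl
      · rw [indicator_of_notMem hm, indicator_of_notMem fun hm' =>
          hm ⟨by linarith [hm'.2], by linarith [hm'.1]⟩]
    rw [h2, integral_indicator_one measurableSet_Ioc]
    ring
  rw [setIntegral_congr_fun measurableSet_Ioc h1, integral_const_mul,
    integral_integral_swap (Integrable.of_bound hkm.aestronglyMeasurable C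
      (Eventually.of_forall fun p => hkC _ _)),
    intervalIntegral.integral_of_le (by linarith),
    ← integral_integral_swap (μ.integrable_shift hT x hF hC)]
  congr 2
  ext t
  rw [setIntegral_eq_integral_of_forall_compl_eq_zero fun r hr => by
      simp only [hk]; rw [hF0 r hr, zero_mul],
    ← integral_add_left_eq_self _ t, ← integral_Ico_eq_integral_Ioc,
    ← integral_indicator measurableSet_Ico]
  refine integral_congr_ae (Eventually.of_forall fun s => ?_)
  simp only [hk, add_sub_cancel_left]
  by_cases hm : s ∈ Ico η (2 * η)
  · rw [indicator_of_mem hm, indicator_of_mem hm]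
    simp
  · rw [indicator_of_notMem hm, indicator_of_notMem hm, mul_zero]

lemma integrable_ms_shift (hT : 0 < T) (x : ℕ) {η C : ℝ} {E : ℝ → ℝ} (hE : Measurable E)
    (hC : ∀ t, |E t| ≤ C) :
    Integrable (Function.uncurry fun r s => E r * μ.ms x (r - s))
      ((volume.restrict (Ioc 0 T)).prod (volume.restrict (Ioc η (2 * η)))) := by
  refine Integrable.of_bound ((hE.comp measurable_fst).mul ((μ.measurable_ms hT x).comp
    (measurable_fst.sub measurable_snd))).aestronglyMeasurable C
    (Eventually.of_forall fun p => ?_)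
  simp only [Function.uncurry, Real.norm_eq_abs, abs_mul]
  exact (mul_le_of_le_one_right (abs_nonneg _) (μ.abs_ms_le_one x _)).trans (hC _)

lemma setIntegral_ms_shift (x : ℕ) {s : ℝ} (hs : 0 ≤ s) {E : ℝ → ℝ}
    (hE0 : ∀ t, t ∉ Ioc 0 T → E t = 0) :
    ∫ t in Ioc (-s) T, E (t + s) * μ.ms x t = ∫ r in Ioc 0 T, E r * μ.ms x (r - s) := by
  rw [setIntegral_eq_integral_of_forall_compl_eq_zero (fun t ht => by
      rw [hE0 _ fun h1 => ht ⟨by linarith [h1.1], by linarith [h1.2]⟩, zero_mul]),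
    setIntegral_eq_integral_of_forall_compl_eq_zero (fun r hr => by rw [hE0 r hr, zero_mul]),
    ← integral_add_right_eq_self (fun r => E r * μ.ms x (r - s)) s]
  simp

lemma intervalIntegrable_ms_shift (hT : 0 < T) (x : ℕ) {η C : ℝ} (hη : 0 < η) {E : ℝ → ℝ}
    (hE : Measurable E) (hC : ∀ t, |E t| ≤ C) (hE0 : ∀ t, t ∉ Ioc 0 T → E t = 0) :
    IntervalIntegrable (fun s => ∫ t in Ioc (-s) T, E (t + s) * μ.ms x t) volume η (2 * η) := by
  rw [intervalIntegrable_iff_integrableOn_Ioc_of_le (by linarith),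
    integrableOn_congr_fun (fun s hs => μ.setIntegral_ms_shift x (hη.trans hs.1).le hE0)
      measurableSet_Ioc]
  exact (μ.integrable_ms_shift hT x hE hC).integral_prod_right

/-- Integrating against the masses of the randomly delayed path amounts to averaging over the
deterministic delays. -/
lemma integral_mul_avgMs_eq (hT : 0 < T) (x : ℕ) {η C : ℝ} (hη : 0 < η) {E : ℝ → ℝ}
    (hE : Measurable E) (hC : ∀ t, |E t| ≤ C) (hE0 : ∀ t, t ∉ Ioc 0 T → E t = 0) :
    ∫ r in Ioc 0 T, E r * μ.avgMs η x r
      = η⁻¹ * ∫ s in η..2 * η, ∫ t in Ioc (-s) T, E (t + s) * μ.ms x t := by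
  have h1 : ∫ s in η..2 * η, ∫ t in Ioc (-s) T, E (t + s) * μ.ms x t
      = ∫ s in Ioc η (2 * η), ∫ r in Ioc 0 T, E r * μ.ms x (r - s) := by
    rw [intervalIntegral.integral_of_le (by linarith)]
    exact setIntegral_congr_fun measurableSet_Ioc fun s hs =>
      μ.setIntegral_ms_shift x (hη.trans hs.1).le hE0
  rw [h1, ← integral_integral_swap (μ.integrable_ms_shift hT x hE hC), ← integral_const_mul]
  refine integral_congr_ae (Eventually.of_forall fun r => ?_)
  simp only [avgMs]
  rw [intervalIntegral.integral_of_le (by linarith), integral_const_mul]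
  ring

/-- The cost of the path delayed by a random time is at most an average of the costs of the paths
with deterministic delays. -/
lemma delayed_cost_le (hT : 0 < T) (hA : Assumptions T α h ϕ) {R : ℝ}
    (hR : rateFunction h ϕ μ ≤ (R : EReal)) {c Λ δ η C : ℝ} (hc : 0 < c) (hδ : 0 ≤ δ) (hη : 0 < η)
    (hlam : ∀ t, μ.lam h ϕ t ∈ Icc c Λ) {l : ℝ → ℝ} (hlm : Measurable l) (hl : ∀ t, l t ∈ Icc c Λ)
    (hclose : ∀ s ∈ Icc η (2 * η), ∀ t, |l (t + s) - μ.lam h ϕ t| ≤ δ) {F : ℝ → ℕ → ℝ}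
    (hF : ∀ x, Measurable fun t => F t x) (hC : ∀ t x, |F t x| ≤ C)
    (hF0 : ∀ t, t ∉ Ioc 0 T → ∀ x, F t x = 0) (N : ℕ) :
    ∑ x ∈ Finset.range N,
      ((∫ t in Ioc 0 T, F t x * (η⁻¹ * (μ.tl x (t - η) - μ.tl x (t - 2 * η))))
        - ∫ t in Ioc 0 T, (Real.exp (F t x) - 1) * l t * μ.avgMs η x t)
      ≤ R + δ / c * μ.meanFun T + δ * T + Λ * (2 * η) := by
  have hΛ : 0 < Λ := hc.trans_le ((hl 0).1.trans (hl 0).2)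
  have hE : ∀ x, Measurable fun t => (Real.exp (F t x) - 1) * l t := fun x =>
    ((Real.measurable_exp.comp (hF x)).sub measurable_const).mul hlm
  have hEC : ∀ x t, |(Real.exp (F t x) - 1) * l t| ≤ (Real.exp C + 1) * Λ := fun x t => by
    rw [abs_mul, abs_of_nonneg (hc.le.trans (hl t).1)]
    exact mul_le_mul (abs_exp_sub_one_le (hC t x)) (hl t).2 (hc.le.trans (hl t).1) (by positivity)
  have hE0 : ∀ x t, t ∉ Ioc 0 T → (Real.exp (F t x) - 1) * l t = 0 := fun x t ht => by
    rw [hF0 t ht, Real.exp_zero, sub_self, zero_mul]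
  have h1 : ∀ x, IntervalIntegrable (fun s => (∫ t in Ioc 0 T, F (t + s) x ∂μ.flux hT x)
      - ∫ t in Ioc (-s) T, (Real.exp (F (t + s) x) - 1) * l (t + s) * μ.ms x t)
      volume η (2 * η) := fun x =>
    (μ.intervalIntegrable_shift hT x hη (hF x) fun t => hC t x).sub
      (μ.intervalIntegrable_ms_shift hT x hη (hE x) (hEC x) (hE0 x))
  have h2 : ∀ x, ((∫ t in Ioc 0 T, F t x * (η⁻¹ * (μ.tl x (t - η) - μ.tl x (t - 2 * η))))
      - ∫ t in Ioc 0 T, (Real.exp (F t x) - 1) * l t * μ.avgMs η x t)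
      = η⁻¹ * ∫ s in η..2 * η, ((∫ t in Ioc 0 T, F (t + s) x ∂μ.flux hT x)
        - ∫ t in Ioc (-s) T, (Real.exp (F (t + s) x) - 1) * l (t + s) * μ.ms x t) := fun x => by
    rw [μ.integral_mul_density_eq hT x hη (hF x) (fun t => hC t x) (fun t ht => hF0 t ht x),
      μ.integral_mul_avgMs_eq hT x hη (hE x) (hEC x) (hE0 x), ← mul_sub,
      ← intervalIntegral.integral_sub
        (μ.intervalIntegrable_shift hT x hη (hF x) fun t => hC t x)
        (μ.intervalIntegrable_ms_shift hT x hη (hE x) (hEC x) (hE0 x))]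
  simp_rw [h2]
  rw [← Finset.mul_sum, ← intervalIntegral.integral_finsetSum fun x _ => h1 x,
    ← average_const hη (R + δ / c * μ.meanFun T + δ * T + Λ * (2 * η))]
  refine average_mono hη (by
    simpa only [Finset.sum_fn] using IntervalIntegrable.sum (Finset.range N) fun x _ => h1 x)
    intervalIntegrable_const ?_
  intro s hs
  refine (μ.shift_cost_le hT hA hR hc hδ (hη.le.trans hs.1) hlam hlm hl (hclose s hs) hF hC hF0
    N).trans ?_
  have := mul_le_mul_of_nonneg_left hs.2 hΛ.le
  linarith

end MFPath

namespace MFPath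

variable {T : ℝ} {α : ℝ≥0} {h ϕ : ℝ → ℝ} (μ : MFPath T) {ε η : ℝ} {N : ℕ}

lemma continuous_avgMs (hT : 0 < T) (hη : 0 < η) (hc : ∀ x, Continuous (μ.tl x)) (x : ℕ) :
    Continuous (μ.avgMs η x) := by
  cases x with
  | zero =>
    rw [show μ.avgMs η 0 = fun t => 1 - μ.avg η 0 t from funext (μ.avgMs_zero hT hη)]
    exact continuous_const.sub (μ.continuous_avg hc 0)
  | succ y =>
    rw [show μ.avgMs η (y + 1) = fun t => μ.avg η y t - μ.avg η (y + 1) t from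
      funext (μ.avgMs_succ hT y)]
    exact (μ.continuous_avg hc y).sub (μ.continuous_avg hc (y + 1))

lemma continuous_stopMs (hT : 0 < T) (hη : 0 < η) (hc : ∀ x, Continuous (μ.tl x)) (x : ℕ) :
    Continuous (μ.stopMs η N x) := by
  unfold stopMs
  split_ifs
  · exact μ.continuous_avgMs hT hη hc x
  · exact μ.continuous_avg hc _
  · exact continuous_const

lemma smDens_nonneg (hT : 0 < T) (hε : 0 ≤ ε) (hε1 : ε ≤ 1) (hη : 0 < η) (x : ℕ) {t : ℝ}
    (ht : 0 ≤ t) : 0 ≤ μ.smDens ε η N x t := by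
  refine add_nonneg (mul_nonneg (sub_nonneg.2 hε1) ?_) (mul_nonneg hε (pois_nonneg x ht))
  split_ifs
  · exact mul_nonneg (inv_nonneg.2 hη.le) (sub_nonneg.2 (μ.tl_mono hT x (by linarith)))
  · exact le_rfl

/-- For a given test function and intensity the cost is linear in the fluxes and the masses, so that
the approximating path costs at most the corresponding mixture of the cost of the delayed path, the
cost of stopping at `N` (where no jump occurs any more), and the relative entropy of the Poisson
path. -/
lemma cost_path_le (hT : 0 < T) (hA : Assumptions T α h ϕ) {R : ℝ}
    (hR : rateFunction h ϕ μ ≤ (R : EReal)) (hR0 : 0 ≤ R) (hε : 0 ≤ ε) (hε1 : ε ≤ 1) (hη : 0 < η)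
    (hN : 0 < N) (hcont : ∀ x, Continuous (μ.tl x)) (D : TailData T (μ.smTail ε η N))
    {c Λ δ C : ℝ} (hc : 0 < c) (hδ : 0 ≤ δ)
    (hlam : ∀ t, μ.lam h ϕ t ∈ Icc c Λ) (hl : ∀ t, (D.path hT).lam h ϕ t ∈ Icc c Λ)
    (hclose : ∀ s ∈ Icc η (2 * η), ∀ t, |(D.path hT).lam h ϕ (t + s) - μ.lam h ϕ t| ≤ δ)
    {F : ℝ → ℕ → ℝ} (hF : ∀ x, Measurable fun t => F t x) (hC : ∀ t x, |F t x| ≤ C)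
    (hF0 : ∀ t, t ∉ Ioc 0 T → ∀ x, F t x = 0) {M : ℕ} (hM : N ≤ M) :
    (D.path hT).cost hT h ϕ F M ≤ R + δ / c * μ.meanFun T + δ * T + Λ * (2 * η)
      + Λ * T * μ.tl (N - 1) T + ε * T * (Λ + |Real.log c|) := by
  set l := (D.path hT).lam h ϕ with hl_def
  have hlm : Measurable l := (D.path hT).measurable_lam hA hT
  have hΛ : 0 < Λ := hc.trans_le ((hl 0).1.trans (hl 0).2)
  set S := R + δ / c * μ.meanFun T + δ * T + Λ * (2 * η) with hS
  have hS0 : 0 ≤ S := by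
    have := μ.meanFun_nonneg T
    positivity
  set E : ℕ → ℝ → ℝ := fun x t => (Real.exp (F t x) - 1) * l t with hE
  have hEm : ∀ x, Measurable (E x) := fun x =>
    ((Real.measurable_exp.comp (hF x)).sub measurable_const).mul hlm
  have hEC : ∀ x t, |E x t| ≤ (Real.exp C + 1) * Λ := fun x t => by
    rw [hE, abs_mul, abs_of_nonneg (hc.le.trans (hl t).1)]
    exact mul_le_mul (abs_exp_sub_one_le (hC t x)) (hl t).2 (hc.le.trans (hl t).1) (by positivity)
  set A : ℕ → ℝ → ℝ := fun x t =>
    if x < N then η⁻¹ * (μ.tl x (t - η) - μ.tl x (t - 2 * η)) else 0 with hAdef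
  have hAc : ∀ x, Continuous (A x) := fun x => by
    have := hcont x
    simp only [hAdef]
    split_ifs <;> fun_prop
  have hFi : ∀ x {g : ℝ → ℝ}, Continuous g →
      Integrable (fun t => F t x * g t) (volume.restrict (Ioc 0 T)) := fun x g hg =>
    (hg.integrableOn_Ioc).bdd_mul (hF x).aestronglyMeasurable
      (Eventually.of_forall fun t => hC t x)
  have hEi : ∀ x {g : ℝ → ℝ}, Continuous g →
      Integrable (fun t => E x t * g t) (volume.restrict (Ioc 0 T)) := fun x g hg =>
    (hg.integrableOn_Ioc).bdd_mul (hEm x).aestronglyMeasurable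
      (Eventually.of_forall fun t => hEC x t)
  have hsc := μ.continuous_stopMs (N := N) hT hη hcont
  have hterm : ∀ x, (∫ t in Ioc 0 T, F t x ∂(D.path hT).flux hT x)
      - ∫ t in Ioc 0 T, (Real.exp (F t x) - 1) * ((D.path hT).ms x t * l t)
      = (1 - ε) * ((∫ t in Ioc 0 T, F t x * A x t) - ∫ t in Ioc 0 T, E x t * μ.stopMs η N x t)
        + ε * ∫ t in Ioc 0 T, (F t x - E x t) * pois x t := by
    intro x
    have hfl := (D.path hT).integral_flux_eq hT (x := x) (g := μ.smDens ε η N x)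
      (μ.continuous_smDens hcont x).measurable
      (fun s hs => μ.smDens_nonneg hT hε hε1 hη x hs.1.le)
      (μ.continuous_smDens hcont x).integrableOn_Ioc
      (fun t ht => by
        rw [D.tl_path hT x ht, μ.smTail_eq_integral hT hη hcont,
          intervalIntegral.integral_of_le ht.1])
      (t := T) ⟨hT.le, le_rfl⟩ fun t => F t x
    have e1 : ∫ t in Ioc 0 T, F t x * μ.smDens ε η N x t
        = (1 - ε) * (∫ t in Ioc 0 T, F t x * A x t) + ε * ∫ t in Ioc 0 T, F t x * pois x t := by
      rw [← integral_const_mul, ← integral_const_mul,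
        ← integral_add ((hFi x (hAc x)).const_mul _) ((hFi x (continuous_pois x)).const_mul _)]
      exact integral_congr_ae (Eventually.of_forall fun t => by
        simp only [smDens, hAdef]; ring)
    have e2 : ∫ t in Ioc 0 T, (Real.exp (F t x) - 1) * ((D.path hT).ms x t * l t)
        = (1 - ε) * (∫ t in Ioc 0 T, E x t * μ.stopMs η N x t)
          + ε * ∫ t in Ioc 0 T, E x t * pois x t := by
      rw [← integral_const_mul, ← integral_const_mul,
        ← integral_add ((hEi x (hsc x)).const_mul _) ((hEi x (continuous_pois x)).const_mul _)]
      refine setIntegral_congr_fun measurableSet_Ioc fun t ht => ?_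
      simp only [hE]
      rw [μ.ms_path hT hη hN D x ⟨ht.1.le, ht.2⟩]
      ring
    have e3 : ∫ t in Ioc 0 T, (F t x - E x t) * pois x t
        = (∫ t in Ioc 0 T, F t x * pois x t) - ∫ t in Ioc 0 T, E x t * pois x t := by
      simp_rw [sub_mul]
      exact integral_sub (hFi x (continuous_pois x)) (hEi x (continuous_pois x))
    rw [hfl, e1, e2, e3]
    ring
  have hpois : ∑ x ∈ Finset.range M, ∫ t in Ioc 0 T, (F t x - E x t) * pois x t
      ≤ T * (Λ + |Real.log c|) := by
    have hB : 0 ≤ Λ + |Real.log c| := by positivity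
    have hpi : ∀ x, Integrable (pois x) (volume.restrict (Ioc 0 T)) := fun x =>
      (continuous_pois x).integrableOn_Ioc
    have h1 : ∀ x, ∫ t in Ioc 0 T, (F t x - E x t) * pois x t
        ≤ (Λ + |Real.log c|) * ∫ t in Ioc 0 T, pois x t := fun x => by
      rw [← integral_const_mul]
      refine setIntegral_mono_on ?_ ((hpi x).const_mul _) measurableSet_Ioc fun t ht =>
        mul_le_mul_of_nonneg_right (sub_exp_sub_one_mul_le hc (hl t).1 (hl t).2 _)
          (pois_nonneg x ht.1.le)
      simp_rw [sub_mul]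
      exact (hFi x (continuous_pois x)).sub (hEi x (continuous_pois x))
    refine (Finset.sum_le_sum fun x _ => h1 x).trans ?_
    have h2 : ∑ x ∈ Finset.range M, ∫ t in Ioc 0 T, pois x t ≤ T := by
      simp_rw [← intervalIntegral.integral_of_le hT.le, integral_pois]
      exact sum_poisTail_le M hT.le
    rw [← Finset.mul_sum, mul_comm T]
    exact mul_le_mul_of_nonneg_left h2 hB
  have hmain : ∑ x ∈ Finset.range M,
      ((∫ t in Ioc 0 T, F t x * A x t) - ∫ t in Ioc 0 T, E x t * μ.stopMs η N x t)
      ≤ S + Λ * T * μ.tl (N - 1) T := by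
    rw [← Finset.sum_range_add_sum_Ico _ hM]
    refine add_le_add ?_ ?_
    · refine le_trans (le_of_eq (Finset.sum_congr rfl fun x hx => ?_))
        (μ.delayed_cost_le hT hA hR hc hδ hη hlam hlm hl hclose hF hC hF0 N)
      have hx' := Finset.mem_range.1 hx
      simp only [hAdef, stopMs, if_pos hx', hE]
    · have h1 : ∀ x ∈ Finset.Ico N M,
          (∫ t in Ioc 0 T, F t x * A x t) - ∫ t in Ioc 0 T, E x t * μ.stopMs η N x t
          ≤ if x = N then Λ * T * μ.tl (N - 1) T else 0 := by
        intro x hx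
        have hx' : ¬ x < N := not_lt.2 (Finset.mem_Ico.1 hx).1
        have h2 : ∀ t ∈ Ioc 0 T, -(E x t * μ.stopMs η N x t)
            ≤ if x = N then Λ * μ.tl (N - 1) T else 0 := by
          intro t ht
          simp only [stopMs, if_neg hx']
          split_ifs
          · have h3 : -E x t ≤ Λ := by
              simp only [hE]
              nlinarith [mul_pos (Real.exp_pos (F t x)) (hc.trans_le (hl t).1), (hl t).2]
            have h4 := (μ.avg_le hT hη (N - 1) t).trans (μ.tl_mono hT (N - 1) ht.2)
            have h5 := μ.avg_nonneg hT hη (N - 1) t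
            calc -(E x t * μ.avg η (N - 1) t) = -E x t * μ.avg η (N - 1) t := by ring
              _ ≤ Λ * μ.avg η (N - 1) t := mul_le_mul_of_nonneg_right h3 h5
              _ ≤ Λ * μ.tl (N - 1) T := mul_le_mul_of_nonneg_left h4 hΛ.le
          · simp
        have h6 := setIntegral_mono_on (hEi x (hsc x)).neg (integrable_const _) measurableSet_Ioc h2
        simp only [Pi.neg_apply] at h6
        rw [integral_neg, setIntegral_const, Real.volume_real_Ioc_of_le hT.le, smul_eq_mul] at h6
        have h7 : ∫ t in Ioc 0 T, F t x * A x t = 0 := by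
          simp [hAdef, if_neg hx']
        rw [h7]
        refine (by linarith : _ ≤ _) |>.trans (h6.trans (le_of_eq ?_))
        split_ifs <;> ring
      refine (Finset.sum_le_sum h1).trans ?_
      rw [Finset.sum_ite_eq']
      have := μ.tl_nonneg (N - 1) T
      split_ifs
      · exact le_rfl
      · positivity
  unfold cost
  rw [Finset.sum_congr rfl fun x _ => hterm x, Finset.sum_add_distrib, ← Finset.mul_sum,
    ← Finset.mul_sum]
  have h1 := mul_le_mul_of_nonneg_left hpois hε
  have h2 := mul_le_mul_of_nonneg_left hmain (sub_nonneg.2 hε1)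
  have h3 : 0 ≤ ε * (S + Λ * T * μ.tl (N - 1) T) := by
    have := μ.tl_nonneg (N - 1) T
    positivity
  linarith

/-- To bound the rate function it suffices to bound the costs of bounded measurable functions,
summed over large sets of states. -/
lemma rateFunction_le_of_cost_le (hT : 0 < T) (hA : Assumptions T α h ϕ) {ν : MFPath T} {B : ℝ}
    {N : ℕ}
    (hB : ∀ (F : ℝ → ℕ → ℝ) (C : ℝ), (∀ x, Measurable fun t => F t x) → (∀ t x, |F t x| ≤ C) →
      (∀ t, t ∉ Ioc 0 T → ∀ x, F t x = 0) → ∀ M, N ≤ M → ν.cost hT h ϕ F M ≤ B) :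
    rateFunction h ϕ ν ≤ (B : EReal) := by
  refine iSup₂_le fun ψ hψ => EReal.coe_le_coe_iff.2 ?_
  refine le_of_tendsto (ν.tendsto_cost hT hA hψ.1 hψ.2) ?_
  filter_upwards [eventually_ge_atTop N] with M hM
  obtain ⟨C, hC⟩ := hψ.1.2
  have hC0 : 0 ≤ C := (abs_nonneg _).trans (hC 0 ⟨le_rfl, hT.le⟩ 0)
  have hjc : ∀ x, ContinuousOn (fun t => jump ψ t x) (Icc 0 T) := fun x =>
    (hψ.1.1 (x + 1)).continuousOn.sub (hψ.1.1 x).continuousOn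
  have h1 := hB (fun t x => (Ioc 0 T).indicator (fun t => jump ψ t x) t) (2 * C) (fun x => ?_)
    (fun t x => ?_) (fun t ht x => indicator_of_notMem ht _) M hM
  · refine le_of_eq_of_le (Finset.sum_congr rfl fun x _ => ?_) h1
    refine congrArg₂ _ (setIntegral_congr_fun measurableSet_Ioc fun t ht => ?_)
      (setIntegral_congr_fun measurableSet_Ioc fun t ht => ?_)
    · simp only [indicator_of_mem ht]
    · simp only [indicator_of_mem ht]
  · classical
    simp_rw [← piecewise_eq_indicator]
    exact ((hjc x).mono Ioc_subset_Icc_self).measurable_piecewise continuous_zero.continuousOn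
      measurableSet_Ioc
  · by_cases ht : t ∈ Ioc 0 T
    · simp only [indicator_of_mem ht, jump]
      refine (abs_sub _ _).trans ?_
      have ht' := Ioc_subset_Icc_self ht
      linarith [hC t ht' (x + 1), hC t ht' x]
    · simp only [indicator_of_notMem ht, abs_zero]
      positivity

end MFPath

/-! ### Choice of the parameters -/

namespace MFPath

variable {T : ℝ} {α : ℝ≥0} {h ϕ : ℝ → ℝ} (μ : MFPath T)

lemma rateFunction_nonneg : 0 ≤ rateFunction h ϕ μ := by
  have h1 : (fun _ _ => 0 : ℝ → ℕ → ℝ) ∈ {ψ | ψ ∈ C1b T ∧ DerivIntegrable μ ψ} :=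
    ⟨⟨fun _ => contDiffOn_const, 0, by simp⟩, by simp [DerivIntegrable, timeDeriv]⟩
  refine le_trans (le_of_eq ?_) (le_iSup₂ (f := fun ψ _ => ((J h ϕ μ ψ : ℝ) : EReal)) _ h1)
  simp [J, timeDeriv, jump]

lemma exists_truncation (hT : 0 < T) {ω : ℝ} (hω : 0 < ω) :
    ∃ N : ℕ, ∀ M, ∑ x ∈ Finset.range M, (if x < N then 0 else μ.tl x T) ≤ ω := by
  have hs := μ.hasSum_tl hT T
  obtain ⟨N, hN⟩ := (hs.tendsto_sum_nat.eventually
    (lt_mem_nhds (sub_lt_self (μ.meanFun T) hω))).exists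
  refine ⟨N, fun M => ?_⟩
  have h1 : HasSum (fun x => if x < N then μ.tl x T else 0) (∑ x ∈ Finset.range N, μ.tl x T) := by
    rw [← Finset.sum_congr rfl fun x hx => if_pos (Finset.mem_range.1 hx)]
    exact hasSum_sum_of_ne_finset_zero fun x hx => if_neg (by simpa using hx)
  have h3 : HasSum (fun x => if x < N then 0 else μ.tl x T)
      (μ.meanFun T - ∑ x ∈ Finset.range N, μ.tl x T) := by
    have h4 : (fun x => if x < N then 0 else μ.tl x T)
        = fun x => μ.tl x T - if x < N then μ.tl x T else 0 := by
      ext x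
      split_ifs <;> simp
    rw [h4]
    exact hs.sub h1
  refine (sum_le_hasSum _ (fun x _ => ?_) h3).trans (by linarith)
  split_ifs
  · exact le_rfl
  · exact μ.tl_nonneg x T

variable {μ} in
/-- Paths with close tails have close means. -/
lemma abs_meanFun_sub_le (hT : 0 < T) {ν : MFPath T} {δ : ℝ}
    (hδ : ∀ M, ∀ t ∈ Icc 0 T, ∑ x ∈ Finset.range M, |ν.tl x t - μ.tl x t| ≤ δ) (t : ℝ) :
    |ν.meanFun t - μ.meanFun t| ≤ δ := by
  have hcl : ∀ ρ : MFPath T, ρ.meanFun t = ρ.meanFun (max 0 (min t T)) := fun ρ => by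
    have ht := clamp_mem hT t
    unfold meanFun
    rw [min_eq_left ht.2, max_eq_right ht.1]
  rw [hcl ν, hcl μ]
  refine le_of_tendsto' ((ν.hasSum_tl hT _).sub (μ.hasSum_tl hT _)).tendsto_sum_nat.abs fun M => ?_
  exact (Finset.abs_sum_le_sum_abs _ _).trans (hδ M _ (clamp_mem hT t))

variable {μ} in
lemma W1_le_of_tl {ν : MFPath T} {δ : ℝ}
    (hδ : ∀ M, ∀ t ∈ Icc 0 T, ∑ x ∈ Finset.range M, |ν.tl x t - μ.tl x t| ≤ δ) {t : ℝ}
    (ht : t ∈ Icc 0 T) : W1 (ν.law t) (μ.law t) ≤ ENNReal.ofReal δ := by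
  refine (W1_le_tsum _ _).trans (ENNReal.tsum_le_of_sum_range_le fun M => ?_)
  rw [← ENNReal.ofReal_sum_of_nonneg fun _ _ => abs_nonneg _]
  refine ENNReal.ofReal_le_ofReal ((le_of_eq ?_).trans (hδ M t ht))
  simp only [tl, lawc_eq _ ht]

/-- Every path of finite cost is close to a perturbed mean field of almost no larger cost. -/
theorem exists_approximation (hT : 0 < T) (hA : Assumptions T α h ϕ) {R : ℝ}
    (hR : rateFunction h ϕ μ ≤ (R : EReal)) (hR0 : 0 ≤ R) {κ : ℝ} (hκ : 0 < κ) :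
    ∃ (φ : ℝ → ℕ → ℝ) (ν : MFPath T), Measurable (Function.uncurry φ) ∧
      (∃ C : ℝ, ∀ t ∈ Icc 0 T, ∀ x, |φ t x| ≤ C) ∧ IsPerturbedMeanField h ϕ φ ν ∧
      (∀ t ∈ Icc 0 T, W1 (ν.law t) (μ.law t) ≤ ENNReal.ofReal κ) ∧
      rateFunction h ϕ ν ≤ ((R + κ : ℝ) : EReal) := by
  obtain ⟨c, K, hc, hK, hlow, hup, hlip⟩ := hA.exists_lam_bounds hT
  set m := μ.meanFun T with hm
  have hm0 : 0 ≤ m := μ.meanFun_nonneg T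
  have hϕ0 : 0 < ϕ 0 := hA.ϕ_pos 0 le_rfl
  set Λ := ϕ 0 + K * (2 * m + T + 1) with hΛ
  have hΛ0 : 0 < Λ := by positivity
  -- All errors below are at most `P * ω` or `Q * ω`, for a single small parameter `ω`.
  set P := 2 + m + T with hP
  set Q := K * (P + 1) * (m / c + T) + 2 * Λ + Λ * T + T * (Λ + |Real.log c|) with hQ
  have hP0 : 0 < P := by positivity
  have hQ0 : 0 < Q := by positivity
  obtain ⟨ω, hω0, hω1, hωP, hωQ⟩ : ∃ ω : ℝ, 0 < ω ∧ ω ≤ 1 / 2 ∧ P * ω ≤ κ ∧ Q * ω ≤ κ := by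
    refine ⟨min (1 / 2) (min (κ / P) (κ / Q)), by positivity, min_le_left _ _, ?_, ?_⟩
    · rw [mul_comm, ← le_div_iff₀ hP0]
      exact (min_le_right _ _).trans (min_le_left _ _)
    · rw [mul_comm, ← le_div_iff₀ hQ0]
      exact (min_le_right _ _).trans (min_le_right _ _)
  have hcont : ∀ x, Continuous (μ.tl x) :=
    μ.continuous_tl_of_modulus hT fun κ hκ => μ.exists_modulus hT hA hR hκ
  obtain ⟨d, hd0, hd⟩ := μ.exists_modulus hT hA hR hω0
  set η := min ω (d / 2) with hη
  have hη0 : 0 < η := by positivity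
  have hηω : η ≤ ω := min_le_left _ _
  have hηd : 2 * η ≤ d := by linarith [min_le_right ω (d / 2)]
  obtain ⟨N₀, hN₀⟩ := μ.exists_truncation hT hω0
  have hN₁ : μ.tl N₀ T ≤ ω := by
    refine le_trans ?_ (hN₀ (N₀ + 1))
    rw [Finset.sum_range_succ, if_neg (lt_irrefl _),
      Finset.sum_eq_zero fun x hx => if_pos (Finset.mem_range.1 hx), zero_add]
  have hN₂ : ∀ M, ∑ x ∈ Finset.range M, (if x < N₀ + 1 then 0 else μ.tl x T) ≤ ω := fun M => by
    refine (Finset.sum_le_sum fun x _ => ?_).trans (hN₀ M)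
    have := μ.tl_nonneg x T
    split_ifs <;> first | omega | linarith
  have hω1' : ω ≤ 1 := by linarith
  have D : TailData T (μ.smTail ω η (N₀ + 1)) := μ.tailData_smTail hT hω0.le hω1' hη0 hcont
  set ν := D.path hT with hν
  have hdist : ∀ M, ∀ t ∈ Icc 0 T, ∑ x ∈ Finset.range M, |ν.tl x t - μ.tl x t| ≤ P * ω := by
    intro M t ht
    have h1 := μ.sum_abs_smTail_sub_le hT hω0.le hω1' hη0
      (fun t => hd _ t (by linarith) (by linarith)) hN₂ M ht
    rw [Finset.sum_congr rfl fun x _ => by rw [hν, D.tl_path hT x ht]]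
    refine h1.trans (le_of_eq ?_)
    rw [hP, hm]
    ring
  have hmean := abs_meanFun_sub_le hT hdist
  have hνm : ν.meanFun T ≤ 2 * m + T + 1 := by
    have h1 := (abs_le.1 (hmean T)).2
    have h2 : P * ω ≤ P * (1 / 2) := mul_le_mul_of_nonneg_left hω1 hP0.le
    have h3 : P * (1 / 2) ≤ m + T + 1 := by rw [hP]; linarith
    linarith
  have hlamμ : ∀ t, μ.lam h ϕ t ∈ Icc c Λ := fun t => by
    refine ⟨hlow μ t, (hup μ t).trans (add_le_add_right (mul_le_mul_of_nonneg_left ?_ hK) _)⟩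
    linarith
  have hlamν : ∀ t, ν.lam h ϕ t ∈ Icc c Λ := fun t =>
    ⟨hlow ν t, (hup ν t).trans (add_le_add_right (mul_le_mul_of_nonneg_left hνm hK) _)⟩
  have hclose : ∀ s ∈ Icc η (2 * η), ∀ t,
      |ν.lam h ϕ (t + s) - μ.lam h ϕ t| ≤ K * ((P + 1) * ω) := by
    intro s hs t
    refine hlip ν μ _ _ _ fun u _ => ?_
    have h1 := hmean (t + s - u)
    have h2 := hd (t - u) (t + s - u) (by linarith [hs.1]) (by linarith [hs.2])
    have h3 := μ.monotone_meanFun (by linarith [hs.1] : t - u ≤ t + s - u)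
    have h4 := abs_le.1 h1
    rw [abs_le]
    constructor <;> linarith
  have hcost : rateFunction h ϕ ν ≤ ((R + κ : ℝ) : EReal) := by
    refine rateFunction_le_of_cost_le hT hA (N := N₀ + 1) fun F C hF hC hF0 M hM => ?_
    refine (μ.cost_path_le hT hA hR hR0 hω0.le hω1' hη0 N₀.succ_pos hcont D hc (by positivity)
      hlamμ hlamν hclose hF hC hF0 hM).trans ?_
    rw [Nat.succ_eq_add_one, Nat.add_sub_cancel]
    have h1 : Λ * (2 * η) ≤ 2 * Λ * ω := by nlinarith
    have h2 : Λ * T * μ.tl N₀ T ≤ Λ * T * ω := mul_le_mul_of_nonneg_left hN₁ (by positivity)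
    have h3 : K * ((P + 1) * ω) / c * m + K * ((P + 1) * ω) * T + 2 * Λ * ω + Λ * T * ω
        + ω * T * (Λ + |Real.log c|) = Q * ω := by
      rw [hQ]; ring
    linarith
  obtain ⟨A, hA0, hAc⟩ := μ.exists_comparable (N := N₀ + 1) hT hω0 hω1' hη0
  have hms : ∀ x, ∀ t ∈ Ioc 0 T,
      ν.ms x t = (1 - ω) * μ.stopMs η (N₀ + 1) x t + ω * pois x t := fun x t ht =>
    μ.ms_path hT hη0 N₀.succ_pos D x (Ioc_subset_Icc_self ht)
  obtain ⟨φ, hφm, hφb, hφ⟩ := ν.exists_isPerturbedMeanField hT hA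
    (g := μ.smDens ω η (N₀ + 1)) (fun x => (μ.continuous_smDens hcont x).measurable)
    (fun x t ht => by
      rw [hν, D.tl_path hT x ht, μ.smTail_eq_integral hT hη0 hcont,
        intervalIntegral.integral_of_le ht.1]) hA0
    (fun t ht x => by
      rw [hms x t ht]
      have h1 := mul_nonneg (sub_nonneg.2 hω1') (μ.stopMs_nonneg (N := N₀ + 1) hT hη0 x t)
      have h2 := mul_pos hω0 (pois_pos x ht.1)
      linarith)
    (fun t ht x => by rw [hms x t ht]; exact (hAc t ht x).1)
    (fun t ht x => by rw [hms x t ht]; exact (hAc t ht x).2)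
  exact ⟨φ, ν, hφm, hφb, hφ,
    fun t ht => (W1_le_of_tl hdist ht).trans (ENNReal.ofReal_le_ofReal hωP), hcost⟩

end MFPath

end MeanFieldHawkes

end

theorem theorem3p5 (T : ℝ) (hT : 0 < T) (α : ℝ≥0) (h ϕ : ℝ → ℝ) (hA : Assumptions T α h ϕ)
    (μ : MFPath T) (hμ : rateFunction h ϕ μ < ⊤) :
    ∃ (φ : ℕ → ℝ → ℕ → ℝ) (μs : ℕ → MFPath T),
      (∀ n, Measurable (Function.uncurry (φ n))) ∧
      (∀ n, ∃ C : ℝ, ∀ t ∈ Icc 0 T, ∀ x, |φ n t x| ≤ C) ∧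
      (∀ n, IsPerturbedMeanField h ϕ (φ n) (μs n)) ∧
      ConvergesTo μs μ ∧
      Tendsto (fun n => rateFunction h ϕ (μs n)) atTop (𝓝 (rateFunction h ϕ μ)) := by
  have h0 := μ.rateFunction_nonneg (h := h) (ϕ := ϕ)
  have hbot : rateFunction h ϕ μ ≠ ⊥ := fun hb => by
    rw [hb] at h0
    exact absurd h0 (by simp)
  have hcoe := EReal.coe_toReal hμ.ne hbot
  set R := (rateFunction h ϕ μ).toReal with hRdef
  have hR0 : 0 ≤ R := EReal.toReal_nonneg h0
  choose φ μs hφm hφb hφ hW hI using fun n : ℕ =>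
    μ.exists_approximation hT hA hcoe.ge hR0 (Nat.one_div_pos_of_nat (α := ℝ) (n := n))
  have hzero : Tendsto (fun n : ℕ => 1 / ((n : ℝ) + 1)) atTop (𝓝 0) :=
    tendsto_one_div_add_atTop_nhds_zero_nat
  have hconv : ConvergesTo μs μ := by
    have h1 := ENNReal.tendsto_ofReal hzero
    rw [ENNReal.ofReal_zero] at h1
    exact tendsto_of_tendsto_of_tendsto_of_le_of_le tendsto_const_nhds h1 (fun _ => bot_le)
      fun n => iSup₂_le fun t ht => hW n t ht
  refine ⟨φ, μs, hφm, hφb, hφ, hconv, tendsto_order.2 ⟨fun r hr => ?_, fun r hr => ?_⟩⟩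
  · exact μ.eventually_lt_rateFunction hT hA hconv hr
  · have h1 : Tendsto (fun n : ℕ => ((R + 1 / ((n : ℝ) + 1) : ℝ) : EReal)) atTop
        (𝓝 (rateFunction h ϕ μ)) := by
      rw [← hcoe]
      refine (continuous_coe_real_ereal.tendsto R).comp ?_
      simpa using hzero.const_add R
    filter_upwards [h1.eventually (gt_mem_nhds hr)] with n hn
    exact (hI n).trans_lt hn
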